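/- Let $\varepsilon_{t_z}(\mathbf k)=-2(\cos k_1+\cos k_2)-2t_z\cos k_3$ for $\mathbf k\in[-\pi,\pi]^3$, and let $$N_{t_z}(\epsilon)=\int_{[-\pi,\pi]^3}\delta\big(\varepsilon_{t_z}(\mathbf k)-\epsilon\big)\frac{d\mathbf k}{(2\pi)^3}=\frac{d}{d\epsilon}\,\frac{\big|\{\mathbf k\in[-\pi,\pi]^3:\varepsilon_{t_z}(\mathbf k)\le\epsilon\}\big|}{(2\pi)^3}$$ be the density of states. Throughout, $\tanh(\cdot/T)\equiv1$ for $T=0$ and $\tanh(\cdot/y)\equiv 1$ for $y=0$. For $U>0$ and $t_z\in(0,2)$, let the Néel temperature $T_N=T_N(U,t_z)>0$ be the unique positive solution of $$1=\int_{[-\pi,\pi]^3}\frac{U\tanh\big(\frac{\varepsilon_{t_z}(\mathbf k)}{2T_N}\big)}{2\varepsilon_{t_z}(\mathbf k)}\frac{d\mathbf k}{(2\pi)^3},$$ and for $0\le T<T_N$ let $\Delta=\Delta_{\mathrm{AF}}(U,t_z,T)>0$ be the unique positive solution of the mean-field equation $$\Delta=\Delta\int_{[-\pi,\pi]^3}\frac{U\tanh\big(\frac{\sqrt{\Delta^2+\varepsilon_{t_z}(\mathbf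 k)^2}}{2T}\big)}{2\sqrt{\Delta^2+\varepsilon_{t_z}(\mathbf k)^2}}\frac{d\mathbf k}{(2\pi)^3}.$$ Put $\hat m(U,t_z,T)=\Delta_{\mathrm{AF}}(U,t_z,T)/T_N(U,t_z)$. For $y\in[0,1]$ let $f_{\mathrm{BCS}}(y)\ge0$ be the unique nonnegative solution $x$ of $$\int_0^\infty\bigg(\frac{\tanh\big(\frac{\sqrt{x^2+\epsilon^2}}{2y}\big)}{\sqrt{x^2+\epsilon^2}}-\frac{\tanh(\frac\epsilon2)}{\epsilon}\bigg)d\epsilon=0,$$ the integral being required to converge absolutely. **Theorem.** All these objects are well defined: for $t_z\in(0,2)$ the derivative defining $N_{t_z}(\epsilon)$ exists for every $\epsilon\in\mathbb R$ and $N_{t_z}(0)>0$; the solutions above exist and are unique; $f_{\mathrm{BCS}}$ is differentiable on $[0,1)$ (one-sidedly at $0$); and the integral in $$g(U,t_z,y)=\big(f_{\mathrm{BCS}}(y)-yf_{\mathrm{BCS}}'(y)\big)\int_0^\infty\frac{N_{t_z}(T_N(U,t_z)\epsilon)-N_{t_z}(0)}{N_{t_z}(0)}\bigg(\frac{\tanh\big(\frac{\sqrt{f_{\mathrm{BCS}}(y)^2+\epsilon^2}}{2y}\big)}{\sqrt{f_{\mathrm{BCS}}(y)^2+\epsilon^2}}-\frac{\tanh(\frac\epsilon2)}{\epsilon}\bigg)d\epsilon$$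 converges absolutely for $U>0$, $t_z\in(0,2)$, $y\in[0,1)$. Moreover, $$\hat m(U,t_z,T)=f_{\mathrm{BCS}}\Big(\frac{T}{T_N(U,t_z)}\Big)+g\Big(U,t_z,\frac{T}{T_N(U,t_z)}\Big)+O\Big(U^{-2}e^{-\frac{4}{N_{t_z}(0)U}}\Big)\qquad\text{as }U\downarrow0,$$ uniformly for $t_z$ in compact subsets of $(0,2)$ and for $T\ge0$ such that $T/T_N(U,t_z)$ remains in a compact subset of $[0,1)$. In particular, for $T=0$, $$\hat m(U,t_z,0)=\pi e^{-\gamma}+g(U,t_z,0)+O\Big(U^{-2}e^{-\frac{4}{N_{t_z}(0)U}}\Big)\qquad\text{as }U\downarrow0,$$ uniformly for $t_z$ in compact subsets of $(0,2)$, where $\gamma$ is Euler's constant and, for all $U>0$ and $t_z\in(0,2)$, $$g(U,t_z,0)=\pi e^{-\gamma}\int_0^\infty\frac{N_{t_z}(T_N(U,t_z)\epsilon)-N_{t_z}(0)}{N_{t_z}(0)}\bigg(\frac{1}{\sqrt{\pi^2e^{-2\gamma}+\epsilon^2}}-\frac{\tanh(\frac\epsilon2)}{\epsilon}\bigg)d\epsilon.$$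 -/

import Mathlib

namespace HubbardAF

noncomputable section

/-- The Brillouin zone `[-π, π]³`. -/
def brillouinZone : Set (Fin 3 → ℝ) :=
  Set.Icc (fun _ => -Real.pi) (fun _ => Real.pi)

/-- The tight-binding band relation `ε(k) = -2 (cos k₁ + cos k₂) - 2 t_z cos k₃`
(in-plane hopping normalized to `t = 1`). -/
def band (tz : ℝ) (k : Fin 3 → ℝ) : ℝ :=
  -2 * (Real.cos (k 0) + Real.cos (k 1)) - 2 * tz * Real.cos (k 2)

/-- The integrated density of states: the normalized volume of `{k | ε(k) ≤ E}`. -/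
def integratedDOS (tz E : ℝ) : ℝ :=
  MeasureTheory.volume.real {k | k ∈ brillouinZone ∧ band tz k ≤ E} / (2 * Real.pi) ^ 3

/-- The density of states `N_{t_z}(E) = ∫ δ(ε(k) - E) dk / (2π)³`, that is, the derivative of the
integrated density of states `∫ θ(E - ε(k)) dk / (2π)³`, with `θ` the Heaviside function. -/
def dos (tz E : ℝ) : ℝ :=
  deriv (integratedDOS tz) E

/-- `tanh (a / (2 T))`, with the convention that it is identically `1` for `T = 0`. -/
def thermalTanh (a T : ℝ) : ℝ :=
  if T = 0 then 1 else Real.tanh (a / (2 * T))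

/-- `T > 0` solves the equation `1 = ∫ U tanh(ε(k) / (2T)) / (2 ε(k)) dk / (2π)³` of the Néel
temperature. The integrand is bounded, and `{k | ε(k) = 0}` is a null set. -/
def IsNeelTemperature (U tz T : ℝ) : Prop :=
  0 < T ∧
    1 = (∫ k in brillouinZone,
      U * Real.tanh (band tz k / (2 * T)) / (2 * band tz k)) / (2 * Real.pi) ^ 3

/-- The Néel temperature `T_N(U, t_z)`. -/
def neelTemperature (U tz : ℝ) : ℝ :=
  Classical.epsilon (IsNeelTemperature U tz)

/-- `Δ > 0` solves the antiferromagnetic mean-field equation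
`Δ = Δ ∫ U tanh(√(Δ² + ε(k)²) / (2T)) / (2 √(Δ² + ε(k)²)) dk / (2π)³` at temperature `T ≥ 0`. -/
def IsPositiveGap (U tz T Δ : ℝ) : Prop :=
  0 < Δ ∧
    Δ = Δ * ((∫ k in brillouinZone,
      U * thermalTanh (Real.sqrt (Δ ^ 2 + band tz k ^ 2)) T /
        (2 * Real.sqrt (Δ ^ 2 + band tz k ^ 2))) / (2 * Real.pi) ^ 3)

open Classical in
/-- The order parameter `Δ_AF(U, t_z, T)`: the positive solution of the mean-field equation if
there is one (which is the case precisely for `T < T_N`), and `0` otherwise. -/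
def gapAF (U tz T : ℝ) : ℝ :=
  if h : ∃ Δ, IsPositiveGap U tz T Δ then h.choose else 0

/-- The gap ratio `m̂(U, t_z, T) = Δ_AF(U, t_z, T) / T_N(U, t_z)`. -/
def gapRatio (U tz T : ℝ) : ℝ :=
  gapAF U tz T / neelTemperature U tz

/-- The kernel `tanh(√(x² + ε²) / (2y)) / √(x² + ε²) - tanh(ε/2) / ε`. -/
def bcsKernel (x y ε : ℝ) : ℝ :=
  thermalTanh (Real.sqrt (x ^ 2 + ε ^ 2)) y / Real.sqrt (x ^ 2 + ε ^ 2) - Real.tanh (ε / 2) / ε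

/-- `x ≥ 0` solves `J(x, y) = 0`, where `J(x, y)` is the integral of the kernel over `(0, ∞)`.
Convergence of the integral is part of the equation: at `x = y = 0` the integral is `+∞`. -/
def IsBCSGap (y x : ℝ) : Prop :=
  0 ≤ x ∧ MeasureTheory.IntegrableOn (bcsKernel x y) (Set.Ioi 0) ∧
    ∫ ε in Set.Ioi (0 : ℝ), bcsKernel x y ε = 0

/-- The BCS gap function `f_BCS(y)`, `y ∈ [0, 1]`. -/
def fBCS (y : ℝ) : ℝ :=
  Classical.epsilon (IsBCSGap y)

/-- The derivative of `f_BCS` on its domain `[0, 1]` (one-sided at the endpoints). -/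
def fBCSDeriv (y : ℝ) : ℝ :=
  derivWithin fBCS (Set.Icc 0 1) y

/-- The integrand of the subleading term. -/
def subleadingIntegrand (U tz y ε : ℝ) : ℝ :=
  (dos tz (neelTemperature U tz * ε) - dos tz 0) / dos tz 0 * bcsKernel (fBCS y) y ε

/-- The subleading term `g(U, t_z, y)`. -/
def subleading (U tz y : ℝ) : ℝ :=
  (fBCS y - y * fBCSDeriv y) * ∫ ε in Set.Ioi (0 : ℝ), subleadingIntegrand U tz y ε

end

end HubbardAF

open HubbardAF

namespace HubbardAF

open Real Set Filter Topology MeasureTheory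

noncomputable section

/-! ### The hyperbolic tangent -/

/-! Both self-consistency equations involve the momentum only through the band energy, so they
become energy integrals against the density of states N (`integral_band_of_even`). With k(x, y, ε) =
tanh(√(x² + ε²)/(2y))/√(x² + ε²) they read ∫ N(ε) k(0, τ, ε) dε = 1/U = ∫ N(ε) k(Δ, T, ε) dε over
(0, ∞), where τ = T_N. Subtraction eliminates U. Since k is homogeneous of degree −1, rescaling
energies by τ gives, for m = Δ/τ and y = T/τ, the equation ∫ (1 + w(ε)) (k(m, y, ε) − k(0, 1, ε)) dε
= 0 with w(ε) = (N(τε) − N(0))/N(0) (`weightedBcsIntegral_gapAF`). For w = 0 this is J(m, y) = 0,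
solved by f_BCS(y).

To first order in w the root is f_BCS(y) + R/A, where R is the integral of w times the kernel at
f_BCS(y) and A = −∂J/∂x there. The scaling law J(lx, ly) = J(x, y) − log l, a Frullani integral,
yields 1/A = f_BCS − y f_BCS', so the correction is g. Kernel estimates uniform down to y = 0,
together with monotonicity of the weighted equation, confine the root and make the remainder
quadratic in W = ∫ |w| (1 + ε)⁻³ dε (`exists_abs_sub_fBCS_sub_le`).

The size of W rests on |N(E) − N(0)| ≤ C E², which gives W = O(τ²(2 − log τ)). The Néel equation
gives 1/U = −N(0) log τ + O(1), so W = O(U⁻¹ exp(−2/(N(0)U))), and W² is the stated error. The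
quadratic bound is the delicate point: N(E) is the average over k of P(E + 2t_z cos k), where the
planar density P is an elliptic integral with a logarithmic singularity at 0. By evenness, N(E) −
N(0) is an average of symmetric second differences of P. In the splitting 1 = sin k + (1 − sin k),
the first weight is a Jacobian, and the resulting energy integral telescopes to boundary terms away
from the singularity; the second weight vanishes quadratically where cos k = 0. Compactness in (0,
2) keeps 2t_z away from the bad points 0 and 4 of P.

The value f_BCS(0) = πe^{−γ} comes from J(1, 0): inserting (1 − e⁻ᵗ)/t splits it into a limit of
arsinh n minus harmonic numbers, equal to log 2 − γ, and the logarithm of Wallis' product, log(π/2).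
-/

theorem hasDerivAt_tanh (z : ℝ) : HasDerivAt Real.tanh (1 - Real.tanh z ^ 2) z := by
  have h := (Real.hasDerivAt_sinh z).div (Real.hasDerivAt_cosh z) (Real.cosh_pos z).ne'
  have e : Real.tanh = fun z => Real.sinh z / Real.cosh z := by
    funext z; exact Real.tanh_eq_sinh_div_cosh z
  rw [e]
  refine h.congr_deriv ?_
  have := (Real.cosh_pos z).ne'
  field_simp

theorem continuous_tanh : Continuous Real.tanh :=
  continuous_iff_continuousAt.2 fun z => (hasDerivAt_tanh z).continuousAt

theorem one_sub_tanh_sq_pos (z : ℝ) : 0 < 1 - Real.tanh z ^ 2 := by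
  have := Real.tanh_sq_lt_one z; linarith

theorem strictMono_tanh : StrictMono Real.tanh :=
  strictMono_of_hasDerivAt_pos hasDerivAt_tanh one_sub_tanh_sq_pos

theorem tanh_nonneg {z : ℝ} (hz : 0 ≤ z) : 0 ≤ Real.tanh z := by
  simpa using strictMono_tanh.monotone hz

theorem tanh_pos {z : ℝ} (hz : 0 < z) : 0 < Real.tanh z := by
  simpa using strictMono_tanh hz

theorem one_sub_tanh_sq (z : ℝ) : 1 - Real.tanh z ^ 2 = 1 / Real.cosh z ^ 2 := by
  have h := (Real.cosh_pos z).ne'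
  rw [Real.tanh_eq_sinh_div_cosh, div_pow, Real.sinh_sq]
  field_simp
  ring

theorem sq_mul_one_sub_tanh_sq_le {z : ℝ} (hz : 0 ≤ z) : z ^ 2 * (1 - Real.tanh z ^ 2) ≤ 1 := by
  have h := Real.cosh_pos z
  rw [one_sub_tanh_sq, mul_one_div, div_le_one (by positivity), Real.cosh_sq]
  have := Real.self_le_sinh_iff.2 hz
  nlinarith

theorem tanh_le_self {z : ℝ} (hz : 0 ≤ z) : Real.tanh z ≤ z := by
  have hd : ∀ x, HasDerivAt (fun z => z - Real.tanh z) (Real.tanh x ^ 2) x := fun x =>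
    ((hasDerivAt_id x).sub (hasDerivAt_tanh x)).congr_deriv (by ring)
  have := monotone_of_hasDerivAt_nonneg hd (fun x => sq_nonneg _) hz
  simp at this
  exact this

/-- Multiplying by 1 + tanh z ≥ 1 reduces this to 1/cosh² z. Quadratic decay suffices: it produces
the ε⁻³ tails of the kernels with a factor y² that is harmless as y tends to 0. -/
theorem one_sub_tanh_le {z : ℝ} (hz : 0 < z) : 1 - Real.tanh z ≤ 1 / z ^ 2 := by
  have h1 := sq_mul_one_sub_tanh_sq_le hz.le
  have h2 := tanh_pos hz
  have h3 := Real.tanh_lt_one z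
  rw [le_div_iff₀ (by positivity)]
  have : 0 ≤ z ^ 2 * (Real.tanh z * (1 - Real.tanh z)) := by
    have := sub_pos.2 h3; positivity
  nlinarith

/-- `tanh z - z / cosh² z`, which governs the slope of `tanh z / z`. -/
def tanhDefect (z : ℝ) : ℝ := Real.tanh z - z * (1 - Real.tanh z ^ 2)

theorem hasDerivAt_tanhDefect (z : ℝ) :
    HasDerivAt tanhDefect (2 * z * Real.tanh z * (1 - Real.tanh z ^ 2)) z := by
  have h := hasDerivAt_tanh z
  refine (h.sub ((hasDerivAt_id z).mul ((h.pow 2).const_sub 1))).congr_deriv ?_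
  simp only [id, Pi.pow_apply]
  push_cast
  ring

theorem tanhDefect_strictMonoOn : StrictMonoOn tanhDefect (Ici 0) := by
  refine strictMonoOn_of_deriv_pos (convex_Ici 0)
    (fun z _ => (hasDerivAt_tanhDefect z).continuousAt.continuousWithinAt) fun z hz => ?_
  rw [interior_Ici] at hz
  rw [(hasDerivAt_tanhDefect z).deriv]
  have := tanh_pos hz
  have := one_sub_tanh_sq_pos z
  have : 0 < z := hz
  positivity

theorem tanhDefect_zero : tanhDefect 0 = 0 := by simp [tanhDefect]

theorem tanhDefect_pos {z : ℝ} (hz : 0 < z) : 0 < tanhDefect z := by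
  simpa [tanhDefect_zero] using tanhDefect_strictMonoOn (by simp) hz.le hz

theorem tanhDefect_nonneg {z : ℝ} (hz : 0 ≤ z) : 0 ≤ tanhDefect z := by
  simpa [tanhDefect_zero] using tanhDefect_strictMonoOn.monotoneOn (by simp) hz hz

theorem tanhDefect_le_one {z : ℝ} (hz : 0 ≤ z) : tanhDefect z ≤ 1 := by
  have := Real.tanh_lt_one z
  have := mul_nonneg hz (one_sub_tanh_sq_pos z).le
  unfold tanhDefect; linarith

theorem tanhDefect_le_sq {z : ℝ} (hz : 0 ≤ z) : tanhDefect z ≤ z ^ 2 := by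
  have h0 := tanh_nonneg hz
  have h1 := tanh_le_self hz
  have h2 := Real.tanh_lt_one z
  have : z * Real.tanh z ^ 2 ≤ z * z := by
    gcongr; nlinarith
  unfold tanhDefect; nlinarith

/-! ### The thermal factor -/

theorem thermalTanh_zero (a : ℝ) : thermalTanh a 0 = 1 := by simp [thermalTanh]

theorem thermalTanh_of_ne {y : ℝ} (hy : y ≠ 0) (a : ℝ) :
    thermalTanh a y = Real.tanh (a / (2 * y)) := by simp [thermalTanh, hy]

theorem thermalTanh_le_one (a y : ℝ) : thermalTanh a y ≤ 1 := by
  unfold thermalTanh; split_ifs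
  · exact le_rfl
  · exact (Real.tanh_lt_one _).le

theorem thermalTanh_nonneg {a y : ℝ} (ha : 0 ≤ a) (hy : 0 ≤ y) : 0 ≤ thermalTanh a y := by
  unfold thermalTanh; split_ifs
  · exact zero_le_one
  · exact tanh_nonneg (by positivity)

theorem thermalTanh_le_div {a y : ℝ} (ha : 0 ≤ a) (hy : 0 < y) :
    thermalTanh a y ≤ a / (2 * y) := by
  rw [thermalTanh_of_ne hy.ne']; exact tanh_le_self (by positivity)

theorem one_sub_thermalTanh_le {a y : ℝ} (ha : 0 < a) (hy : 0 ≤ y) :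
    1 - thermalTanh a y ≤ 4 * y ^ 2 / a ^ 2 := by
  rcases hy.eq_or_lt with rfl | hy
  · simp [thermalTanh_zero]
  · rw [thermalTanh_of_ne hy.ne']
    refine (one_sub_tanh_le (by positivity)).trans_eq ?_
    field_simp; ring

theorem thermalTanh_lt_of_lt {a y y' : ℝ} (ha : 0 < a) (hy : 0 ≤ y) (h : y < y') :
    thermalTanh a y' < thermalTanh a y := by
  rw [thermalTanh_of_ne (hy.trans_lt h).ne']
  rcases hy.eq_or_lt with rfl | hy
  · rw [thermalTanh_zero]; exact Real.tanh_lt_one _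
  · rw [thermalTanh_of_ne hy.ne']
    exact strictMono_tanh (by gcongr)

theorem thermalTanh_mul {l : ℝ} (hl : l ≠ 0) (a y : ℝ) :
    thermalTanh (l * a) (l * y) = thermalTanh a y := by
  unfold thermalTanh
  simp only [mul_eq_zero, hl, false_or]
  split_ifs with h
  · rfl
  · congr 1; field_simp

theorem measurable_thermalTanh (y : ℝ) : Measurable fun a => thermalTanh a y := by
  unfold thermalTanh; split_ifs
  · exact measurable_const
  · exact continuous_tanh.measurable.comp (by fun_prop)

theorem continuous_thermalTanh (y : ℝ) : Continuous fun a => thermalTanh a y := by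
  unfold thermalTanh; split_ifs
  · exact continuous_const
  · exact continuous_tanh.comp (by fun_prop)

/-- The counterpart of `tanhDefect` for `thermalTanh`. -/
def thermalDefect (a y : ℝ) : ℝ := if y = 0 then 1 else tanhDefect (a / (2 * y))

theorem thermalDefect_nonneg {a y : ℝ} (ha : 0 ≤ a) (hy : 0 ≤ y) : 0 ≤ thermalDefect a y := by
  unfold thermalDefect; split_ifs
  · exact zero_le_one
  · exact tanhDefect_nonneg (by positivity)

theorem thermalDefect_pos {a y : ℝ} (ha : 0 < a) (hy : 0 ≤ y) : 0 < thermalDefect a y := by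
  unfold thermalDefect; split_ifs with h
  · exact zero_lt_one
  · have := hy.lt_of_ne' h
    exact tanhDefect_pos (by positivity)

theorem thermalDefect_le_one {a y : ℝ} (ha : 0 ≤ a) (hy : 0 ≤ y) : thermalDefect a y ≤ 1 := by
  unfold thermalDefect; split_ifs
  · exact le_rfl
  · exact tanhDefect_le_one (by positivity)

theorem thermalDefect_le_sq {a y : ℝ} (ha : 0 ≤ a) (hy : 0 < y) :
    thermalDefect a y ≤ a ^ 2 / (4 * y ^ 2) := by
  rw [thermalDefect, if_neg hy.ne']
  refine (tanhDefect_le_sq (by positivity)).trans_eq ?_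
  field_simp; ring

/-- Monotonicity applies because a/(2y) ≥ c/2. The bound is free of y and will keep the slope of J
away from 0 down to zero temperature. -/
theorem tanhDefect_half_le_thermalDefect {c a y : ℝ} (hc : 0 ≤ c) (hca : c ≤ a) (hy : 0 ≤ y)
    (hy1 : y ≤ 1) : tanhDefect (c / 2) ≤ thermalDefect a y := by
  unfold thermalDefect; split_ifs with h
  · exact tanhDefect_le_one (by positivity)
  · have hy := hy.lt_of_ne' h
    refine tanhDefect_strictMonoOn.monotoneOn (by simp; positivity)
      (by simp only [mem_Ici]; have := hc.trans hca; positivity) ?_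
    gcongr <;> linarith

/-- With z = a/(2y) the derivative equals (2/a) · z²(1 − tanh² z) · tanh z, and z² ≤ cosh² z. The
bound therefore does not see y. -/
theorem exists_hasDerivAt_thermalDefect {a y : ℝ} (ha : 0 < a) (hy : 0 ≤ y) :
    ∃ d, HasDerivAt (fun a => thermalDefect a y) d a ∧ |d| ≤ 2 / a := by
  unfold thermalDefect
  rcases hy.eq_or_lt with rfl | hy
  · refine ⟨0, by simpa using hasDerivAt_const a (1 : ℝ), by simp; positivity⟩
  · simp only [hy.ne', if_false]
    refine ⟨_, (hasDerivAt_tanhDefect _).comp a ((hasDerivAt_id a).div_const (2 * y)), ?_⟩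
    set z := a / (2 * y) with hz
    have hz0 : 0 < z := by positivity
    have hy' : 1 / (2 * y) = z / a := by rw [hz]; field_simp
    have h1 := sq_mul_one_sub_tanh_sq_le hz0.le
    have h2 := tanh_pos hz0
    have h3 := Real.tanh_lt_one z
    have h4 := one_sub_tanh_sq_pos z
    have e : 2 * z * Real.tanh z * (1 - Real.tanh z ^ 2) * (1 / (2 * y)) =
      2 * (z ^ 2 * (1 - Real.tanh z ^ 2)) * Real.tanh z / a := by rw [hy']; ring
    rw [e, abs_of_nonneg (by positivity)]
    gcongr
    have : 0 ≤ z ^ 2 * (1 - Real.tanh z ^ 2) := by positivity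
    nlinarith

theorem hasDerivAt_thermalTanh_div {a y : ℝ} (ha : 0 < a) (hy : 0 ≤ y) :
    HasDerivAt (fun a => thermalTanh a y / a) (-(thermalDefect a y / a ^ 2)) a := by
  unfold thermalDefect
  rcases hy.eq_or_lt with rfl | hy
  · simp only [thermalTanh_zero, if_true]
    simpa [neg_div] using hasDerivAt_inv ha.ne'
  · simp only [thermalTanh_of_ne hy.ne', hy.ne', if_false]
    refine (((hasDerivAt_tanh _).comp a ((hasDerivAt_id a).div_const (2 * y))).div
      (hasDerivAt_id a) ha.ne').congr_deriv ?_
    simp only [id, Function.comp, tanhDefect]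
    field_simp
    ring

end

end HubbardAF

namespace HubbardAF

open Real Set Filter Topology MeasureTheory

noncomputable section

/-! ### The pair kernel -/

/-- The pair kernel `tanh(√(x² + ε²) / (2y)) / √(x² + ε²)`. -/
def pairKernel (x y ε : ℝ) : ℝ := thermalTanh (√(x ^ 2 + ε ^ 2)) y / √(x ^ 2 + ε ^ 2)

/-- Minus the derivative of the pair kernel with respect to the gap. -/
def pairSlope (x y ε : ℝ) : ℝ :=
  thermalDefect (√(x ^ 2 + ε ^ 2)) y * x / √(x ^ 2 + ε ^ 2) ^ 3

theorem le_sqrt_sq_add_sq (x ε : ℝ) : ε ≤ √(x ^ 2 + ε ^ 2) :=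
  Real.le_sqrt_of_sq_le (by nlinarith [sq_nonneg x])

theorem le_sqrt_sq_add_sq' (x ε : ℝ) : x ≤ √(x ^ 2 + ε ^ 2) :=
  Real.le_sqrt_of_sq_le (by nlinarith [sq_nonneg ε])

theorem sqrt_sq_add_sq_pos {ε : ℝ} (x : ℝ) (hε : 0 < ε) : 0 < √(x ^ 2 + ε ^ 2) :=
  hε.trans_le (le_sqrt_sq_add_sq x ε)

theorem pairKernel_zero_left (y : ℝ) {ε : ℝ} (hε : 0 < ε) :
    pairKernel 0 y ε = thermalTanh ε y / ε := by
  simp [pairKernel, Real.sqrt_sq hε.le]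

theorem bcsKernel_eq (x y : ℝ) {ε : ℝ} (hε : 0 < ε) :
    bcsKernel x y ε = pairKernel x y ε - pairKernel 0 1 ε := by
  rw [pairKernel_zero_left 1 hε, thermalTanh_of_ne one_ne_zero, mul_one]
  rfl

theorem pairKernel_nonneg (x : ℝ) {y : ℝ} (hy : 0 ≤ y) (ε : ℝ) : 0 ≤ pairKernel x y ε :=
  div_nonneg (thermalTanh_nonneg (Real.sqrt_nonneg _) hy) (Real.sqrt_nonneg _)

theorem pairKernel_le_inv (x y ε : ℝ) : pairKernel x y ε ≤ 1 / √(x ^ 2 + ε ^ 2) := by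
  unfold pairKernel
  gcongr
  exact thermalTanh_le_one _ _

theorem pairKernel_le_half_inv (x : ℝ) {y : ℝ} (hy : 0 < y) (ε : ℝ) :
    pairKernel x y ε ≤ 1 / (2 * y) := by
  unfold pairKernel
  rcases (Real.sqrt_nonneg (x ^ 2 + ε ^ 2)).eq_or_lt with h | h
  · rw [← h]; simp; positivity
  · rw [div_le_iff₀ h]
    refine (thermalTanh_le_div h.le hy).trans_eq (by ring)

theorem inv_sub_pairKernel_nonneg (x y ε : ℝ) :
    0 ≤ 1 / √(x ^ 2 + ε ^ 2) - pairKernel x y ε := sub_nonneg.2 (pairKernel_le_inv x y ε)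

theorem inv_sub_pairKernel_le (x : ℝ) {y ε : ℝ} (hy : 0 ≤ y) (hε : 0 < ε) :
    1 / √(x ^ 2 + ε ^ 2) - pairKernel x y ε ≤ 4 * y ^ 2 / √(x ^ 2 + ε ^ 2) ^ 3 := by
  have hs := sqrt_sq_add_sq_pos x hε
  have h := one_sub_thermalTanh_le hs hy
  unfold pairKernel
  rw [← sub_div, div_le_iff₀ hs]
  refine h.trans_eq ?_
  field_simp

/-- Homogeneity of degree −1 underlies both the passage to units of the Néel temperature and the
scaling law of J. -/
theorem pairKernel_mul {l : ℝ} (hl : 0 < l) (x y ε : ℝ) :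
    pairKernel (l * x) (l * y) (l * ε) = pairKernel x y ε / l := by
  have : √((l * x) ^ 2 + (l * ε) ^ 2) = l * √(x ^ 2 + ε ^ 2) := by
    rw [show (l * x) ^ 2 + (l * ε) ^ 2 = l ^ 2 * (x ^ 2 + ε ^ 2) by ring,
      Real.sqrt_mul (sq_nonneg l), Real.sqrt_sq hl.le]
  unfold pairKernel
  rw [this, thermalTanh_mul hl.ne', div_div, mul_comm l]

theorem measurable_pairKernel (x y : ℝ) : Measurable (pairKernel x y) := by
  unfold pairKernel
  have h : Measurable fun ε : ℝ => √(x ^ 2 + ε ^ 2) := by fun_prop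
  exact ((measurable_thermalTanh y).comp h).div h

theorem continuousOn_pairKernel (x y : ℝ) : ContinuousOn (pairKernel x y) (Ioi 0) := by
  unfold pairKernel
  have h : Continuous fun ε : ℝ => √(x ^ 2 + ε ^ 2) := by fun_prop
  exact ((continuous_thermalTanh y).comp h).continuousOn.div h.continuousOn
    fun ε hε => (sqrt_sq_add_sq_pos x hε).ne'

theorem measurable_bcsKernel (x y : ℝ) : Measurable (bcsKernel x y) := by
  unfold bcsKernel
  exact (measurable_pairKernel x y).sub
    ((continuous_tanh.measurable.comp (by fun_prop)).div measurable_id)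

theorem measurable_thermalDefect (y : ℝ) : Measurable fun a => thermalDefect a y := by
  unfold thermalDefect; split_ifs
  · exact measurable_const
  · have : Continuous tanhDefect :=
      continuous_iff_continuousAt.2 fun z => (hasDerivAt_tanhDefect z).continuousAt
    exact this.measurable.comp (by fun_prop)

theorem measurable_pairSlope (x y : ℝ) : Measurable (pairSlope x y) := by
  unfold pairSlope
  have h : Measurable fun ε : ℝ => √(x ^ 2 + ε ^ 2) := by fun_prop
  exact (((measurable_thermalDefect y).comp h).mul_const x).div (h.pow_const 3)

theorem pairKernel_lt_of_temp_lt (x : ℝ) {y y' ε : ℝ} (hε : 0 < ε) (hy : 0 ≤ y) (h : y < y') :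
    pairKernel x y' ε < pairKernel x y ε := by
  have hs := sqrt_sq_add_sq_pos x hε
  unfold pairKernel
  have := thermalTanh_lt_of_lt hs hy h
  gcongr

theorem hasDerivAt_sqrt_sq_add_sq (x : ℝ) {ε : ℝ} (hε : 0 < ε) :
    HasDerivAt (fun x => √(x ^ 2 + ε ^ 2)) (x / √(x ^ 2 + ε ^ 2)) x := by
  have h0 : x ^ 2 + ε ^ 2 ≠ 0 := by positivity
  refine (((hasDerivAt_id x).pow 2).add_const (ε ^ 2)).sqrt h0 |>.congr_deriv ?_
  have := (sqrt_sq_add_sq_pos x hε).ne'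
  simp
  field_simp

theorem hasDerivAt_pairKernel (x : ℝ) {y ε : ℝ} (hy : 0 ≤ y) (hε : 0 < ε) :
    HasDerivAt (fun x => pairKernel x y ε) (-pairSlope x y ε) x := by
  have hs := sqrt_sq_add_sq_pos x hε
  refine ((hasDerivAt_thermalTanh_div hs hy).comp x (hasDerivAt_sqrt_sq_add_sq x hε)).congr_deriv ?_
  unfold pairSlope
  field_simp

theorem pairSlope_nonneg {x y : ℝ} (hx : 0 ≤ x) (hy : 0 ≤ y) (ε : ℝ) : 0 ≤ pairSlope x y ε := by
  have := thermalDefect_nonneg (Real.sqrt_nonneg (x ^ 2 + ε ^ 2)) hy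
  unfold pairSlope; positivity

theorem pairSlope_pos {x y ε : ℝ} (hx : 0 < x) (hy : 0 ≤ y) (hε : 0 < ε) :
    0 < pairSlope x y ε := by
  have hs := sqrt_sq_add_sq_pos x hε
  have := thermalDefect_pos hs hy
  unfold pairSlope; positivity

theorem pairSlope_le {x y ε : ℝ} (hx : 0 ≤ x) (hy : 0 ≤ y) (hε : 0 < ε) :
    pairSlope x y ε ≤ x / √(x ^ 2 + ε ^ 2) ^ 3 := by
  have hs := sqrt_sq_add_sq_pos x hε
  unfold pairSlope
  gcongr
  exact mul_le_of_le_one_left hx (thermalDefect_le_one hs.le hy)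

theorem pairSlope_le_inv_sq {x y ε : ℝ} (hx : 0 ≤ x) (hy : 0 ≤ y) (hε : 0 < ε) :
    pairSlope x y ε ≤ 1 / √(x ^ 2 + ε ^ 2) ^ 2 := by
  have hs := sqrt_sq_add_sq_pos x hε
  refine (pairSlope_le hx hy hε).trans ?_
  rw [div_le_div_iff₀ (by positivity) (by positivity)]
  have := le_sqrt_sq_add_sq' x ε
  have : x * √(x ^ 2 + ε ^ 2) ^ 2 ≤ √(x ^ 2 + ε ^ 2) * √(x ^ 2 + ε ^ 2) ^ 2 := by gcongr
  linarith

theorem pairSlope_le_of_temp_pos {x y ε : ℝ} (hx : 0 ≤ x) (hy : 0 < y) (hε : 0 < ε) :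
    pairSlope x y ε ≤ 1 / (4 * y ^ 2) := by
  have hs := sqrt_sq_add_sq_pos x hε
  have h1 := thermalDefect_le_sq hs.le hy
  have h2 := le_sqrt_sq_add_sq' x ε
  unfold pairSlope
  set s := √(x ^ 2 + ε ^ 2)
  calc thermalDefect s y * x / s ^ 3 ≤ (s ^ 2 / (4 * y ^ 2)) * s / s ^ 3 := by gcongr
    _ = 1 / (4 * y ^ 2) := by field_simp

theorem pairKernel_lt_of_lt {x x' y ε : ℝ} (hx : 0 ≤ x) (h : x < x') (hy : 0 ≤ y) (hε : 0 < ε) :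
    pairKernel x' y ε < pairKernel x y ε := by
  have hd := fun t => hasDerivAt_pairKernel t hy hε
  refine strictAntiOn_of_deriv_neg (convex_Ici (0 : ℝ)) (f := fun x => pairKernel x y ε)
    (fun z _ => (hd z).continuousAt.continuousWithinAt) (fun z hz => ?_) hx
    (hx.trans h.le) h
  rw [interior_Ici] at hz
  rw [(hd z).deriv]
  linarith [pairSlope_pos hz hy hε]

theorem pairKernel_le_of_le {x x' y ε : ℝ} (hx : 0 ≤ x) (h : x ≤ x') (hy : 0 ≤ y) (hε : 0 < ε) :
    pairKernel x' y ε ≤ pairKernel x y ε := by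
  rcases h.eq_or_lt with rfl | h
  · exact le_rfl
  · exact (pairKernel_lt_of_lt hx h hy hε).le

/-- With s the square root, u = x/s in [0, 1], W the thermal defect and w its derivative, the
derivative is (ws · u² + W(1 − 3u²))/s³. Here |ws| ≤ 2, 0 ≤ W ≤ 1 and |1 − 3u²| ≤ 4, whence 6 = 2 +
4. -/
theorem exists_hasDerivAt_pairSlope {x y ε : ℝ} (hx : 0 ≤ x) (hy : 0 ≤ y) (hε : 0 < ε) :
    ∃ d, HasDerivAt (fun x => pairSlope x y ε) d x ∧ |d| ≤ 6 / √(x ^ 2 + ε ^ 2) ^ 3 := by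
  have hs := sqrt_sq_add_sq_pos x hε
  obtain ⟨w, hw, hw'⟩ := exists_hasDerivAt_thermalDefect hs hy
  have hr := hasDerivAt_sqrt_sq_add_sq x hε
  have hD := ((hw.comp x hr).mul (hasDerivAt_id x)).div (hr.pow 3) (pow_ne_zero 3 hs.ne')
  refine ⟨_, hD, ?_⟩
  have h0 := thermalDefect_nonneg hs.le hy
  have h1 := thermalDefect_le_one hs.le hy
  have hxs := le_sqrt_sq_add_sq' x ε
  simp only [Function.comp, id, Pi.pow_apply, Pi.mul_apply]
  set s := √(x ^ 2 + ε ^ 2)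
  set W := thermalDefect s y
  have hu0 : 0 ≤ x / s := by positivity
  have hu1 : x / s ≤ 1 := (div_le_one hs).2 hxs
  have e : ((w * (x / s) * x + W * 1) * s ^ 3 - W * x * ((3 : ℕ) * s ^ (3 - 1) * (x / s))) /
      (s ^ 3) ^ 2 = ((w * s) * (x / s) ^ 2 + W * (1 - 3 * (x / s) ^ 2)) / s ^ 3 := by
    push_cast; field_simp; ring
  rw [e, abs_div, abs_of_pos (pow_pos hs 3)]
  gcongr
  have hws : |w * s| ≤ 2 := by
    rw [abs_mul, abs_of_pos hs]
    calc |w| * s ≤ 2 / s * s := by gcongr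
      _ = 2 := by field_simp
  have hu2 : (x / s) ^ 2 ≤ 1 := pow_le_one₀ hu0 hu1
  calc |(w * s) * (x / s) ^ 2 + W * (1 - 3 * (x / s) ^ 2)|
      ≤ |w * s| * |(x / s) ^ 2| + |W| * |1 - 3 * (x / s) ^ 2| := by
        rw [← abs_mul, ← abs_mul]; exact abs_add_le _ _
    _ ≤ 2 * 1 + 1 * 4 := by
        gcongr
        · rwa [abs_of_nonneg (sq_nonneg _)]
        · rwa [abs_of_nonneg h0]
        · rw [abs_le]; constructor <;> nlinarith [sq_nonneg (x / s)]
    _ = 6 := by norm_num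

theorem abs_pairKernel_sub_le {x x' y ε M : ℝ} (hx : 0 ≤ x) (hx' : 0 ≤ x') (hy : 0 ≤ y)
    (hε : 0 < ε) (hM : ∀ t ∈ uIcc x' x, pairSlope t y ε ≤ M) :
    |pairKernel x y ε - pairKernel x' y ε| ≤ M * |x - x'| := by
  have h := (convex_uIcc x' x).norm_image_sub_le_of_norm_hasDerivWithin_le
    (f := fun x => pairKernel x y ε) (f' := fun x => -pairSlope x y ε) (C := M)
    (fun t _ => (hasDerivAt_pairKernel t hy hε).hasDerivWithinAt) ?_ left_mem_uIcc right_mem_uIcc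
  · simpa [Real.norm_eq_abs] using h
  · intro t ht
    have ht0 : 0 ≤ t := (le_min hx' hx).trans ht.1
    rw [norm_neg, Real.norm_eq_abs, abs_of_nonneg (pairSlope_nonneg ht0 hy ε)]
    exact hM t ht

theorem abs_pairSlope_sub_le {c x x' y ε : ℝ} (hc : 0 ≤ c) (hx : c ≤ x) (hx' : c ≤ x')
    (hy : 0 ≤ y) (hε : 0 < ε) :
    |pairSlope x y ε - pairSlope x' y ε| ≤ 6 / √(c ^ 2 + ε ^ 2) ^ 3 * |x - x'| := by
  choose! d hd hd' using fun t (ht : t ∈ Ici (0 : ℝ)) => exists_hasDerivAt_pairSlope ht hy hε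
  have hsub : Ici c ⊆ Ici 0 := Ici_subset_Ici.2 hc
  have hs := sqrt_sq_add_sq_pos c hε
  have h := (convex_Ici c).norm_image_sub_le_of_norm_hasDerivWithin_le
    (f := fun x => pairSlope x y ε) (f' := d) (C := 6 / √(c ^ 2 + ε ^ 2) ^ 3)
    (fun t ht => (hd t (hsub ht)).hasDerivWithinAt) ?_ hx' hx
  · simpa [Real.norm_eq_abs] using h
  · intro t ht
    refine (hd' t (hsub ht)).trans ?_
    have : c ≤ t := ht
    gcongr

/-- Second-order Taylor estimate for the pair kernel in the gap variable. -/
theorem abs_pairKernel_taylor_le {c x x' y ε : ℝ} (hc : 0 ≤ c) (hx : c ≤ x) (hx' : c ≤ x')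
    (hy : 0 ≤ y) (hε : 0 < ε) :
    |pairKernel x y ε - pairKernel x' y ε + pairSlope x' y ε * (x - x')| ≤
      6 / √(c ^ 2 + ε ^ 2) ^ 3 * (x - x') ^ 2 := by
  have hs := sqrt_sq_add_sq_pos c hε
  have hsub : uIcc x' x ⊆ Ici c := fun t ht => (le_min hx' hx).trans ht.1
  -- Mean value inequality for the kernel minus its tangent at x': the derivative is a difference of
  -- slopes, already controlled by |x − x'|.
  have h := (convex_uIcc x' x).norm_image_sub_le_of_norm_hasDerivWithin_le
    (f := fun x => pairKernel x y ε + pairSlope x' y ε * x)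
    (f' := fun x => -pairSlope x y ε + pairSlope x' y ε)
    (C := 6 / √(c ^ 2 + ε ^ 2) ^ 3 * |x - x'|)
    (fun t _ => (((hasDerivAt_pairKernel t hy hε).add
        ((hasDerivAt_id t).const_mul (pairSlope x' y ε))).congr_deriv
          (by simp)).hasDerivWithinAt) ?_
    left_mem_uIcc right_mem_uIcc
  · simp only [Real.norm_eq_abs] at h
    rw [mul_assoc, ← abs_mul, ← sq, abs_of_nonneg (sq_nonneg (x - x'))] at h
    convert h using 2
    ring
  · intro t ht
    have h1 := abs_pairSlope_sub_le hc hx' (hsub ht) hy hε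
    rw [Real.norm_eq_abs, neg_add_eq_sub]
    refine h1.trans (mul_le_mul_of_nonneg_left ?_ (by positivity))
    rw [abs_sub_comm]
    exact abs_sub_left_of_mem_uIcc ht

end

end HubbardAF

namespace HubbardAF

open Real Set Filter Topology MeasureTheory

noncomputable section

/-! ### Decay of the kernel in the energy variable -/

theorem hasDerivAt_neg_inv_one_add_pow (n : ℕ) {t : ℝ} (ht : 0 ≤ t) :
    HasDerivAt (fun t : ℝ => -((1 + t) ^ (n + 1))⁻¹ / (n + 1)) (((1 + t) ^ (n + 2))⁻¹) t := by
  have h0 : (1 + t) ≠ 0 := by positivity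
  have h := ((((hasDerivAt_id t).const_add 1).pow (n + 1)).inv (pow_ne_zero _ h0)).neg.div_const
    ((n : ℝ) + 1)
  refine h.congr_deriv ?_
  have : (n : ℝ) + 1 ≠ 0 := by positivity
  simp only [id, Pi.pow_apply]
  push_cast
  field_simp
  ring

theorem tendsto_neg_inv_one_add_pow (n : ℕ) :
    Tendsto (fun t : ℝ => -((1 + t) ^ (n + 1))⁻¹ / (n + 1)) atTop (𝓝 0) := by
  have h : Tendsto (fun t : ℝ => (1 + t) ^ (n + 1)) atTop atTop :=
    (tendsto_pow_atTop (Nat.succ_ne_zero n)).comp (tendsto_atTop_add_const_left _ 1 tendsto_id)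
  simpa using (h.inv_tendsto_atTop.neg).div_const ((n : ℝ) + 1)

theorem integrableOn_inv_one_add_pow (n : ℕ) {a : ℝ} (ha : 0 ≤ a) :
    IntegrableOn (fun t : ℝ => ((1 + t) ^ (n + 2))⁻¹) (Ioi a) :=
  integrableOn_Ioi_deriv_of_nonneg
    (hasDerivAt_neg_inv_one_add_pow n ha).continuousAt.continuousWithinAt
    (fun _ ht => hasDerivAt_neg_inv_one_add_pow n (ha.trans (le_of_lt ht)))
    (fun t ht => by
      have : 0 < t := ha.trans_lt ht
      positivity) (tendsto_neg_inv_one_add_pow n)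

theorem integral_inv_one_add_pow (n : ℕ) {a : ℝ} (ha : 0 ≤ a) :
    ∫ t in Ioi a, ((1 + t) ^ (n + 2))⁻¹ = ((1 + a) ^ (n + 1))⁻¹ / (n + 1) := by
  rw [integral_Ioi_of_hasDerivAt_of_tendsto
    (hasDerivAt_neg_inv_one_add_pow n ha).continuousAt.continuousWithinAt
    (fun _ ht => hasDerivAt_neg_inv_one_add_pow n (ha.trans (le_of_lt ht)))
    (integrableOn_inv_one_add_pow n ha) (tendsto_neg_inv_one_add_pow n)]
  ring

theorem integrableOn_of_abs_le_inv_one_add_pow {f : ℝ → ℝ} (hf : Measurable f) {C : ℝ} (n : ℕ)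
    (h : ∀ t, 0 < t → |f t| ≤ C * ((1 + t) ^ (n + 2))⁻¹) : IntegrableOn f (Ioi 0) :=
  ((integrableOn_inv_one_add_pow n le_rfl).const_mul C).mono' hf.aestronglyMeasurable
    ((ae_restrict_iff' measurableSet_Ioi).2 (ae_of_all _ fun t ht => h t ht))

theorem abs_integral_le_of_abs_le_inv_one_add_pow {f : ℝ → ℝ} {C : ℝ} (n : ℕ)
    (h : ∀ t, 0 < t → |f t| ≤ C * ((1 + t) ^ (n + 2))⁻¹) :
    |∫ t in Ioi 0, f t| ≤ C / (n + 1) := by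
  have h1 := norm_integral_le_of_norm_le (f := f)
    ((integrableOn_inv_one_add_pow n le_rfl).const_mul C)
    ((ae_restrict_iff' measurableSet_Ioi).2 (ae_of_all _ fun t ht => h t ht))
  rw [Real.norm_eq_abs] at h1
  refine h1.trans_eq ?_
  rw [integral_const_mul, integral_inv_one_add_pow n le_rfl]
  simp
  ring

theorem integral_Ioi_pos {f : ℝ → ℝ} (hf : IntegrableOn f (Ioi 0)) (h : ∀ t, 0 < t → 0 < f t) :
    0 < ∫ t in Ioi 0, f t := by
  rw [setIntegral_pos_iff_support_of_nonneg_ae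
    ((ae_restrict_iff' measurableSet_Ioi).2 (ae_of_all _ fun t ht => (h t ht).le)) hf]
  have : Function.support f ∩ Ioi 0 = Ioi 0 :=
    inter_eq_right.2 fun t ht => (h t ht).ne'
  rw [this]; simp

theorem inv_sqrt_cube_le {c ε : ℝ} (hc : 0 < c) (hε : 0 < ε) :
    1 / √(c ^ 2 + ε ^ 2) ^ 3 ≤ (2 * (1 + 1 / c)) ^ 3 * ((1 + ε) ^ 3)⁻¹ := by
  have hs := sqrt_sq_add_sq_pos c hε
  have h1 := le_sqrt_sq_add_sq c ε
  have h2 := le_sqrt_sq_add_sq' c ε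
  have h3 : 1 + ε ≤ 2 * (1 + 1 / c) * √(c ^ 2 + ε ^ 2) := by
    calc 1 + ε ≤ (1 + 1 / c) * (c + ε) := by
          have : (1 + 1 / c) * (c + ε) = 1 + ε + c + ε / c := by field_simp; ring
          have : 0 < ε / c := by positivity
          linarith
      _ ≤ (1 + 1 / c) * (2 * √(c ^ 2 + ε ^ 2)) := by gcongr; linarith
      _ = _ := by ring
  rw [div_le_iff₀ (by positivity), mul_right_comm, ← mul_pow, ← div_eq_mul_inv,
    le_div_iff₀ (by positivity), one_mul]
  gcongr

/-- Both terms of the kernel are 1/ε + O(ε⁻³), so the divergent tails cancel; for ε ≤ 1 crude bounds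
suffice. M only has to bound the pair kernel at the given ε, which later permits M = 1/ε at x = 0.
-/
theorem abs_bcsKernel_le {x y ε X Y M : ℝ} (hx : 0 ≤ x) (hxX : x ≤ X) (hy : 0 ≤ y) (hyY : y ≤ Y)
    (hε : 0 < ε) (hM : pairKernel x y ε ≤ M) :
    |bcsKernel x y ε| ≤ 8 * (M + 4 * Y ^ 2 + X ^ 2 + 4) * ((1 + ε) ^ 3)⁻¹ := by
  rw [bcsKernel_eq x y hε, ← div_eq_mul_inv, le_div_iff₀ (by positivity)]
  have h0 := pairKernel_nonneg x hy ε
  have h0' := pairKernel_nonneg 0 zero_le_one ε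
  have hM0 : 0 ≤ M := h0.trans hM
  rcases le_total ε 1 with h1 | h1
  · have h2 := pairKernel_le_half_inv 0 one_pos ε
    have h3 : |pairKernel x y ε - pairKernel 0 1 ε| ≤ M + 4 * Y ^ 2 + X ^ 2 + 4 := by
      rw [abs_le]; constructor <;> nlinarith [sq_nonneg Y, sq_nonneg X]
    have h4 : (1 + ε) ^ 3 ≤ 8 := by
      calc (1 + ε) ^ 3 ≤ 2 ^ 3 := by gcongr; linarith
        _ = 8 := by norm_num
    calc _ ≤ (M + 4 * Y ^ 2 + X ^ 2 + 4) * 8 := by gcongr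
      _ = _ := by ring
  · have hs := sqrt_sq_add_sq_pos x hε
    have hsε := le_sqrt_sq_add_sq x ε
    have a1 := inv_sub_pairKernel_nonneg x y ε
    have a2 := inv_sub_pairKernel_le x hy hε
    have b1 := inv_sub_pairKernel_nonneg 0 1 ε
    have b2 := inv_sub_pairKernel_le 0 zero_le_one hε
    have e0 : √(0 ^ 2 + ε ^ 2) = ε := by simp [Real.sqrt_sq hε.le]
    rw [e0] at b1 b2
    have hsq : √(x ^ 2 + ε ^ 2) ^ 2 = x ^ 2 + ε ^ 2 := Real.sq_sqrt (by positivity)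
    set s := √(x ^ 2 + ε ^ 2)
    have c1 : 1 / s ≤ 1 / ε := by gcongr
    have c2 : 1 / ε - 1 / s ≤ X ^ 2 / ε ^ 3 := by
      have e1 : 1 / ε - 1 / s = x ^ 2 / ((s + ε) * (s * ε)) := by
        rw [eq_div_iff (by positivity)]
        field_simp
        linear_combination hsq
      rw [e1]
      gcongr
      calc ε ^ 3 = ε * (ε * ε) := by ring
        _ ≤ (s + ε) * (s * ε) := by gcongr; linarith
    have a3 : 4 * y ^ 2 / s ^ 3 ≤ 4 * Y ^ 2 / ε ^ 3 := by gcongr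
    have h3 : |pairKernel x y ε - pairKernel 0 1 ε| ≤ (4 * Y ^ 2 + X ^ 2 + 4) / ε ^ 3 := by
      have : (4 * Y ^ 2 + X ^ 2 + 4) / ε ^ 3 =
        4 * Y ^ 2 / ε ^ 3 + X ^ 2 / ε ^ 3 + 4 * 1 ^ 2 / ε ^ 3 := by ring
      have : 0 ≤ X ^ 2 / ε ^ 3 := by positivity
      have : 0 ≤ 4 * Y ^ 2 / ε ^ 3 := by positivity
      have : 0 ≤ 4 * 1 ^ 2 / ε ^ 3 := by positivity
      rw [abs_le]; constructor <;> linarith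
    have h4 : (1 + ε) ^ 3 ≤ 8 * ε ^ 3 := by
      calc (1 + ε) ^ 3 ≤ (2 * ε) ^ 3 := by gcongr; linarith
        _ = _ := by ring
    calc _ ≤ (4 * Y ^ 2 + X ^ 2 + 4) / ε ^ 3 * (8 * ε ^ 3) := by gcongr
      _ = 8 * (4 * Y ^ 2 + X ^ 2 + 4) := by field_simp
      _ ≤ _ := by linarith

theorem pairKernel_le_inv_left {x : ℝ} (hx : 0 < x) (y ε : ℝ) : pairKernel x y ε ≤ 1 / x :=
  (pairKernel_le_inv x y ε).trans (by gcongr; exact le_sqrt_sq_add_sq' x ε)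

theorem exists_pairKernel_le {x y : ℝ} (h : 0 < x ∨ 0 < y) : ∃ M, ∀ ε, pairKernel x y ε ≤ M := by
  rcases h with h | h
  · exact ⟨_, pairKernel_le_inv_left h y⟩
  · exact ⟨_, pairKernel_le_half_inv x h⟩

theorem integrableOn_bcsKernel {x y : ℝ} (hx : 0 ≤ x) (hy : 0 ≤ y) (h : 0 < x ∨ 0 < y) :
    IntegrableOn (bcsKernel x y) (Ioi 0) := by
  obtain ⟨M, hM⟩ := exists_pairKernel_le h
  exact integrableOn_of_abs_le_inv_one_add_pow (measurable_bcsKernel x y) 1 fun ε hε =>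
    abs_bcsKernel_le hx le_rfl hy le_rfl hε (hM ε)

/-- `J(x, y)`, the integral of the kernel. -/
def bcsIntegral (x y : ℝ) : ℝ := ∫ ε in Ioi (0 : ℝ), bcsKernel x y ε

/-- Minus the derivative of `J(x, y)` in `x`. -/
def bcsSlope (x y : ℝ) : ℝ := ∫ ε in Ioi (0 : ℝ), pairSlope x y ε

/-! ### Monotonicity, regularity and scaling of J -/

theorem integrableOn_pairKernel_sub {x x' y y' : ℝ} (hx : 0 ≤ x) (hy : 0 ≤ y) (h : 0 < x ∨ 0 < y)
    (hx' : 0 ≤ x') (hy' : 0 ≤ y') (h' : 0 < x' ∨ 0 < y') :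
    IntegrableOn (fun ε => pairKernel x y ε - pairKernel x' y' ε) (Ioi 0) := by
  refine ((integrableOn_bcsKernel hx hy h).sub (integrableOn_bcsKernel hx' hy' h')).congr_fun
    (fun ε hε => ?_) measurableSet_Ioi
  simp only [Pi.sub_apply, bcsKernel_eq _ _ hε, sub_sub_sub_cancel_right]

theorem bcsIntegral_sub {x x' y y' : ℝ} (hx : 0 ≤ x) (hy : 0 ≤ y) (h : 0 < x ∨ 0 < y)
    (hx' : 0 ≤ x') (hy' : 0 ≤ y') (h' : 0 < x' ∨ 0 < y') :
    bcsIntegral x y - bcsIntegral x' y' =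
      ∫ ε in Ioi (0 : ℝ), (pairKernel x y ε - pairKernel x' y' ε) := by
  unfold bcsIntegral
  rw [← integral_sub (integrableOn_bcsKernel hx hy h) (integrableOn_bcsKernel hx' hy' h')]
  refine setIntegral_congr_fun measurableSet_Ioi fun ε hε => ?_
  simp only [bcsKernel_eq _ _ hε, sub_sub_sub_cancel_right]

theorem bcsIntegral_lt_of_lt {x x' y : ℝ} (hx : 0 ≤ x) (hlt : x < x') (hy : 0 ≤ y)
    (h : 0 < x ∨ 0 < y) : bcsIntegral x' y < bcsIntegral x y := by
  have hx' : 0 < x' := hx.trans_lt hlt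
  rw [← sub_pos, bcsIntegral_sub hx hy h hx'.le hy (.inl hx')]
  exact integral_Ioi_pos (integrableOn_pairKernel_sub hx hy h hx'.le hy (.inl hx'))
    fun ε hε => sub_pos.2 (pairKernel_lt_of_lt hx hlt hy hε)

theorem bcsIntegral_lt_of_temp_lt {x y y' : ℝ} (hx : 0 ≤ x) (hy : 0 ≤ y) (hlt : y < y')
    (h : 0 < x ∨ 0 < y) : bcsIntegral x y' < bcsIntegral x y := by
  have hy' : 0 < y' := hy.trans_lt hlt
  rw [← sub_pos, bcsIntegral_sub hx hy h hx hy'.le (.inr hy')]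
  exact integral_Ioi_pos (integrableOn_pairKernel_sub hx hy h hx hy'.le (.inr hy'))
    fun ε hε => sub_pos.2 (pairKernel_lt_of_temp_lt x hε hy hlt)

theorem bcsIntegral_zero_one : bcsIntegral 0 1 = 0 := by
  unfold bcsIntegral
  rw [setIntegral_congr_fun measurableSet_Ioi
    (g := fun _ => (0 : ℝ)) fun ε hε => by simp [bcsKernel_eq _ _ hε]]
  simp

theorem inv_sq_min_le {M ε : ℝ} (hM : 0 ≤ M) (hε : 0 < ε) {v : ℝ} (h1 : v ≤ M)
    (h2 : v ≤ 1 / ε ^ 2) : v ≤ 4 * (M + 1) * ((1 + ε) ^ 2)⁻¹ := by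
  rw [← div_eq_mul_inv, le_div_iff₀ (by positivity)]
  rcases le_total ε 1 with h | h
  · calc v * (1 + ε) ^ 2 ≤ M * (1 + 1) ^ 2 := by gcongr
      _ ≤ _ := by linarith
  · calc v * (1 + ε) ^ 2 ≤ (1 / ε ^ 2) * (ε + ε) ^ 2 := by gcongr
      _ = 4 := by field_simp; ring
      _ ≤ _ := by linarith

/-- For y > 0 the slope is at most 1/(4y²) and at most ε⁻², uniformly in x ≥ 0. This gives
continuity up to x = 0, where the intermediate value argument for the gap starts. -/
theorem bcsIntegral_lipschitz {y : ℝ} (hy : 0 < y) {x x' : ℝ} (hx : 0 ≤ x) (hx' : 0 ≤ x') :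
    |bcsIntegral x y - bcsIntegral x' y| ≤ 4 * (1 / (4 * y ^ 2) + 1) * |x - x'| := by
  rw [bcsIntegral_sub hx hy.le (.inr hy) hx' hy.le (.inr hy)]
  have := abs_integral_le_of_abs_le_inv_one_add_pow 0
    (f := fun ε => pairKernel x y ε - pairKernel x' y ε)
    (C := 4 * (1 / (4 * y ^ 2) + 1) * |x - x'|) fun ε hε => by
      refine (abs_pairKernel_sub_le hx hx' hy.le hε fun t ht => ?_).trans_eq (mul_right_comm _ _ _)
      have ht0 : 0 ≤ t := (le_min hx' hx).trans ht.1
      refine inv_sq_min_le (by positivity) hε (pairSlope_le_of_temp_pos ht0 hy hε)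
        ((pairSlope_le_inv_sq ht0 hy.le hε).trans ?_)
      gcongr
      exact le_sqrt_sq_add_sq t ε
  simpa using this

theorem continuousOn_bcsIntegral {y : ℝ} (hy : 0 < y) :
    ContinuousOn (fun x => bcsIntegral x y) (Ici 0) := by
  refine LipschitzOnWith.continuousOn (K := (4 * (1 / (4 * y ^ 2) + 1)).toNNReal)
    (LipschitzOnWith.of_dist_le_mul fun x hx x' hx' => ?_)
  rw [Real.dist_eq, Real.dist_eq, Real.coe_toNNReal _ (by positivity)]
  exact bcsIntegral_lipschitz hy hx hx'

theorem pairSlope_le_decay {x y ε : ℝ} (hx : 0 < x) (hy : 0 ≤ y) (hε : 0 < ε) :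
    |pairSlope x y ε| ≤ x * (2 * (1 + 1 / x)) ^ 3 * ((1 + ε) ^ 3)⁻¹ := by
  rw [abs_of_nonneg (pairSlope_nonneg hx.le hy ε)]
  calc _ ≤ x * (1 / √(x ^ 2 + ε ^ 2) ^ 3) := by
        rw [mul_one_div]; exact pairSlope_le hx.le hy hε
    _ ≤ x * ((2 * (1 + 1 / x)) ^ 3 * ((1 + ε) ^ 3)⁻¹) := by gcongr; exact inv_sqrt_cube_le hx hε
    _ = _ := by ring

theorem integrableOn_pairSlope {x y : ℝ} (hx : 0 < x) (hy : 0 ≤ y) :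
    IntegrableOn (pairSlope x y) (Ioi 0) :=
  integrableOn_of_abs_le_inv_one_add_pow (measurable_pairSlope x y) 1 fun _ hε =>
    pairSlope_le_decay hx hy hε

theorem bcsSlope_pos {x y : ℝ} (hx : 0 < x) (hy : 0 ≤ y) : 0 < bcsSlope x y :=
  integral_Ioi_pos (integrableOn_pairSlope hx hy) fun _ hε => pairSlope_pos hx hy hε

theorem abs_pairKernel_taylor_le_decay {c x x' y ε : ℝ} (hc : 0 < c) (hx : c ≤ x) (hx' : c ≤ x')
    (hy : 0 ≤ y) (hε : 0 < ε) :
    |pairKernel x y ε - pairKernel x' y ε + pairSlope x' y ε * (x - x')| ≤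
      6 * (2 * (1 + 1 / c)) ^ 3 * (x - x') ^ 2 * ((1 + ε) ^ 3)⁻¹ := by
  calc _ ≤ 6 * (1 / √(c ^ 2 + ε ^ 2) ^ 3) * (x - x') ^ 2 := by
        rw [mul_one_div]; exact abs_pairKernel_taylor_le hc.le hx hx' hy hε
    _ ≤ 6 * ((2 * (1 + 1 / c)) ^ 3 * ((1 + ε) ^ 3)⁻¹) * (x - x') ^ 2 := by
        gcongr; exact inv_sqrt_cube_le hc hε
    _ = _ := by ring

/-- The pointwise second-order remainder has an integrable cubic majorant depending only on the
lower bound c of the two gaps. The constant is independent of y, so y = 0 is included. -/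
theorem bcsIntegral_taylor {c x x' y : ℝ} (hc : 0 < c) (hx : c ≤ x) (hx' : c ≤ x')
    (hy : 0 ≤ y) :
    |bcsIntegral x y - bcsIntegral x' y + bcsSlope x' y * (x - x')| ≤
      3 * (2 * (1 + 1 / c)) ^ 3 * (x - x') ^ 2 := by
  have hx0 := hc.trans_le hx
  have hx0' := hc.trans_le hx'
  rw [bcsIntegral_sub hx0.le hy (.inl hx0) hx0'.le hy (.inl hx0'), bcsSlope, ← integral_mul_const,
    ← integral_add (integrableOn_pairKernel_sub hx0.le hy (.inl hx0) hx0'.le hy (.inl hx0'))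
      ((integrableOn_pairSlope hx0' hy).mul_const _)]
  refine (abs_integral_le_of_abs_le_inv_one_add_pow 1 fun ε hε =>
    abs_pairKernel_taylor_le_decay hc hx hx' hy hε).trans_eq ?_
  norm_num
  ring

theorem hasDerivAt_bcsIntegral {x y : ℝ} (hx : 0 < x) (hy : 0 ≤ y) :
    HasDerivAt (fun x => bcsIntegral x y) (-bcsSlope x y) x := by
  rw [hasDerivAt_iff_isLittleO]
  have hO : (fun t => bcsIntegral t y - bcsIntegral x y - (t - x) • (-bcsSlope x y)) =O[𝓝 x]
      fun t => (t - x) ^ 2 := by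
    refine Asymptotics.IsBigO.of_bound (3 * (2 * (1 + 1 / (x / 2))) ^ 3) ?_
    filter_upwards [lt_mem_nhds (half_lt_self hx)] with t ht
    have := bcsIntegral_taylor (half_pos hx) ht.le (half_lt_self hx).le hy
    rw [Real.norm_eq_abs, Real.norm_eq_abs, abs_of_nonneg (sq_nonneg (t - x))]
    convert this using 2
    rw [smul_eq_mul]; ring
  refine hO.trans_isLittleO ?_
  have : Tendsto (fun t => t - x) (𝓝 x) (𝓝 0) := by
    simpa using (tendsto_id (x := 𝓝 x)).sub_const x
  have h2 := (Asymptotics.isLittleO_pow_id (𝕜 := ℝ) one_lt_two).comp_tendsto this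
  exact h2

/-- The scaling law of `J`, an instance of Frullani's integral. -/
theorem bcsIntegral_mul {l x y : ℝ} (hl : 0 < l) (hx : 0 ≤ x) (hy : 0 ≤ y) (h : 0 < x ∨ 0 < y) :
    bcsIntegral (l * x) (l * y) = bcsIntegral x y - log l := by
  have hlx : 0 ≤ l * x := by positivity
  have hly : 0 ≤ l * y := by positivity
  have hl' : 0 < l * x ∨ 0 < l * y := h.imp (fun h => by positivity) (fun h => by positivity)
  have hint := integrableOn_pairKernel_sub hlx hly hl' hx hy h
  -- By homogeneity the difference of the two kernels is (G(ε/l) − G(ε))/ε. As G tends to 0 at 0 and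
  -- to 1 at infinity, Frullani's integral equals −log l.
  set G : ℝ → ℝ := fun ε => ε * pairKernel x y ε with hG
  have hGe : EqOn (fun ε => pairKernel (l * x) (l * y) ε - pairKernel x y ε)
      (fun ε => ε⁻¹ • (G (l⁻¹ * ε) - G (1 * ε))) (Ioi 0) := by
    intro ε hε
    have hε' : ε ≠ 0 := ne_of_gt hε
    have := pairKernel_mul hl x y (l⁻¹ * ε)
    rw [mul_inv_cancel_left₀ hl.ne'] at this
    simp only [this, hG, smul_eq_mul, one_mul]
    field_simp
  have hcont : ContinuousOn G (Ioi 0) := continuousOn_id.mul (continuousOn_pairKernel x y)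
  obtain ⟨M, hM⟩ := exists_pairKernel_le h
  have h0 : Tendsto G (𝓝[>] 0) (𝓝 0) := by
    refine squeeze_zero' (g := fun ε => ε * M) ?_ ?_ ?_
    · filter_upwards [self_mem_nhdsWithin] with ε hε
      exact mul_nonneg (le_of_lt hε) (pairKernel_nonneg x hy ε)
    · filter_upwards [self_mem_nhdsWithin] with ε hε
      exact mul_le_mul_of_nonneg_left (hM ε) (le_of_lt hε)
    · have : Tendsto (fun ε : ℝ => ε * M) (𝓝 0) (𝓝 (0 * M)) := tendsto_id.mul_const M
      rw [zero_mul] at this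
      exact this.mono_left nhdsWithin_le_nhds
  have hinf : Tendsto G atTop (𝓝 1) := by
    -- The pair kernel differs from 1/ε by O(ε⁻²): the decay of `bcsKernel` is combined with the
    -- tail of the reference term tanh(ε/2)/ε.
    have hK : Tendsto (fun ε : ℝ => ε * (1 / ε - pairKernel x y ε)) atTop (𝓝 0) := by
      refine squeeze_zero_norm' (a := fun ε => (8 * (M + 4 * y ^ 2 + x ^ 2 + 4) + 4) / ε)
        ?_ (tendsto_const_nhds.div_atTop tendsto_id)
      filter_upwards [eventually_gt_atTop 1] with ε h1
      have hε : 0 < ε := by linarith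
      have a := abs_bcsKernel_le hx le_rfl hy le_rfl hε (hM ε)
      have b1 := inv_sub_pairKernel_nonneg 0 1 ε
      have b2 := inv_sub_pairKernel_le 0 zero_le_one hε
      have e0 : √(0 ^ 2 + ε ^ 2) = ε := by simp [Real.sqrt_sq hε.le]
      rw [e0] at b1 b2
      rw [bcsKernel_eq _ _ hε] at a
      set B := 8 * (M + 4 * y ^ 2 + x ^ 2 + 4) with hB
      have hM0 : 0 ≤ M := (pairKernel_nonneg x hy ε).trans (hM ε)
      have hB0 : 0 ≤ B := by positivity
      have h3 : ((1 + ε) ^ 3)⁻¹ ≤ 1 / ε ^ 2 := by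
        rw [← one_div]; gcongr
        nlinarith [pow_pos hε 3]
      have h4 : 4 * 1 ^ 2 / ε ^ 3 ≤ 4 / ε ^ 2 := by
        rw [one_pow, mul_one]; gcongr
        · exact h1.le
        · norm_num
      have h5 : |1 / ε - pairKernel x y ε| ≤ (B + 4) / ε ^ 2 := by
        have h6 : B * ((1 + ε) ^ 3)⁻¹ ≤ B * (1 / ε ^ 2) := by gcongr
        have h7 : (B + 4) / ε ^ 2 = B * (1 / ε ^ 2) + 4 / ε ^ 2 := by ring
        rw [abs_le] at a ⊢
        constructor <;> linarith [a.1, a.2]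
      rw [norm_mul, Real.norm_eq_abs, Real.norm_eq_abs, abs_of_pos hε]
      calc ε * |1 / ε - pairKernel x y ε| ≤ ε * ((B + 4) / ε ^ 2) := by gcongr
        _ = (B + 4) / ε := by field_simp
    have := hK.const_sub 1
    rw [sub_zero] at this
    refine this.congr' ?_
    filter_upwards [eventually_gt_atTop 0] with ε hε
    simp only [hG]
    field_simp
    ring
  have hF := Frullani.integral_Ioi_eq (hcont.locallyIntegrableOn measurableSet_Ioi)
    (inv_pos.2 hl) one_pos h0 hinf (hint.congr_fun hGe measurableSet_Ioi)
  rw [← setIntegral_congr_fun measurableSet_Ioi hGe,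
    ← bcsIntegral_sub hlx hly hl' hx hy h] at hF
  simp at hF
  linarith

theorem bcsIntegral_zero_temp {x : ℝ} (hx : 0 < x) :
    bcsIntegral x 0 = bcsIntegral 1 0 - log x := by
  simpa using bcsIntegral_mul hx zero_le_one le_rfl (.inl one_pos)

end

end HubbardAF

namespace HubbardAF

open Real Set Filter Topology MeasureTheory

noncomputable section

/-! ### The value of `J(1, 0)` -/

/-- With u = t/n, Bernoulli's inequality gives 1 − t²/n ≤ (1 − u²)ⁿ, and 1 + u ≤ eᵘ gives (1 − u²)ⁿ
≤ eᵗ(1 − u)ⁿ. -/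
theorem exp_neg_sub_pow_bounds {n : ℕ} (hn : 0 < n) {t : ℝ} (ht : 0 ≤ t) (htn : t ≤ n) :
    0 ≤ exp (-t) - (1 - t / n) ^ n ∧ exp (-t) - (1 - t / n) ^ n ≤ t ^ 2 * exp (-t) / n := by
  have hn' : (0 : ℝ) < n := by exact_mod_cast hn
  refine ⟨sub_nonneg.2 (Real.one_sub_div_pow_le_exp_neg htn), ?_⟩
  have hu : t / n ≤ 1 := (div_le_one hn').2 htn
  have hu0 : 0 ≤ t / n := by positivity
  have h1 : (1 : ℝ) + n * (-(t / n) ^ 2) ≤ (1 + -(t / n) ^ 2) ^ n :=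
    one_add_mul_le_pow (by nlinarith) n
  have h2 : (1 + -(t / n) ^ 2) ^ n ≤ exp t * (1 - t / n) ^ n := by
    have e : exp t = exp (t / n) ^ n := by
      rw [← Real.exp_nat_mul]; congr 1; field_simp
    rw [e, ← mul_pow]
    refine pow_le_pow_left₀ (by nlinarith) ?_ n
    have := Real.add_one_le_exp (t / n)
    nlinarith
  have h3 : (1 - t ^ 2 / n) ≤ exp t * (1 - t / n) ^ n := by
    refine le_trans (le_of_eq ?_) (h1.trans h2)
    field_simp
    ring
  have h4 : exp (-t) * (1 - t ^ 2 / n) ≤ exp (-t) * (exp t * (1 - t / n) ^ n) := by gcongr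
  rw [← mul_assoc, ← Real.exp_add, neg_add_cancel, Real.exp_zero, one_mul] at h4
  have : t ^ 2 * exp (-t) / n = exp (-t) - exp (-t) * (1 - t ^ 2 / n) := by ring
  linarith

theorem integral_one_sub_div_pow {n : ℕ} (hn : 0 < n) (j : ℕ) :
    ∫ t in (0 : ℝ)..n, (1 - t / n) ^ j / n = 1 / (j + 1) := by
  have hn' : (0 : ℝ) < n := by exact_mod_cast hn
  have hj : (j : ℝ) + 1 ≠ 0 := by positivity
  rw [intervalIntegral.integral_eq_sub_of_hasDerivAt
    (f := fun t : ℝ => -(1 - t / n) ^ (j + 1) / (j + 1))]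
  · simp [hn'.ne', neg_div]
  · intro t _
    have := (((((hasDerivAt_id t).div_const (n : ℝ)).const_sub 1).pow (j + 1)).neg).div_const
      ((j : ℝ) + 1)
    refine this.congr_deriv ?_
    simp only [id]
    push_cast
    field_simp
  · exact Continuous.intervalIntegrable (by fun_prop) _ _

/-- The geometric sum (1 − (1 − t/n)ⁿ)/t approximates (1 − e⁻ᵗ)/t and integrates exactly to a
harmonic number. This is where Euler's constant enters. -/
theorem integral_sum_one_sub_div_pow {n : ℕ} (hn : 0 < n) :
    ∫ t in (0 : ℝ)..n, ∑ j ∈ Finset.range n, (1 - t / n) ^ j / n = harmonic n := by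
  rw [intervalIntegral.integral_finsetSum]
  · rw [Finset.sum_congr rfl fun j _ => integral_one_sub_div_pow hn j, harmonic]
    push_cast
    simp
  · exact fun j _ => Continuous.intervalIntegrable (by fun_prop) _ _

theorem sum_one_sub_div_pow {n : ℕ} (hn : 0 < n) {t : ℝ} (ht : t ≠ 0) :
    ∑ j ∈ Finset.range n, (1 - t / n) ^ j / n = (1 - (1 - t / n) ^ n) / t := by
  have hn' : (0 : ℝ) < n := by exact_mod_cast hn
  rw [← Finset.sum_div, geom_sum_eq (by simp [ht, hn'.ne'])]
  generalize (1 - t / n) ^ n = P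
  rw [show 1 - t / n - 1 = -(t / n) by ring]
  field_simp
  ring

/-! ### The contribution log(π/2): Frullani integrals and Wallis' product -/

theorem one_sub_exp_neg_div_le {t : ℝ} (ht : 0 < t) : (1 - exp (-t)) / t ≤ 1 := by
  rw [div_le_one ht]; linarith [Real.add_one_le_exp (-t)]

theorem one_sub_exp_neg_nonneg {t : ℝ} (ht : 0 < t) : 0 ≤ 1 - exp (-t) := by
  linarith [Real.exp_le_one_iff.2 (neg_nonpos.2 ht.le)]

theorem integrableOn_exp_neg_mul {c : ℝ} (hc : 0 < c) :
    IntegrableOn (fun t : ℝ => exp (-(c * t))) (Ioi 0) := by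
  simpa using integrableOn_exp_mul_Ioi (neg_neg_of_pos hc) 0

theorem integral_exp_neg_mul {c : ℝ} (hc : 0 < c) :
    ∫ t in Ioi (0 : ℝ), exp (-(c * t)) = 1 / c := by
  have := integral_exp_mul_Ioi (neg_neg_of_pos hc) 0
  simpa using this

theorem integrableOn_frullani_exp {c : ℝ} (hc : 0 < c) :
    IntegrableOn (fun t : ℝ => t⁻¹ • (exp (-(c * t)) - exp (-((c + 1) * t)))) (Ioi 0) := by
  refine (integrableOn_exp_neg_mul hc).mono' (by fun_prop)
    ((ae_restrict_iff' measurableSet_Ioi).2 (ae_of_all _ fun t ht => ?_))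
  have ht : 0 < t := ht
  have e : t⁻¹ • (exp (-(c * t)) - exp (-((c + 1) * t))) =
      exp (-(c * t)) * ((1 - exp (-t)) / t) := by
    rw [show -((c + 1) * t) = -(c * t) + -t by ring, Real.exp_add, smul_eq_mul]
    field_simp
  have h0 := one_sub_exp_neg_nonneg ht
  rw [e, Real.norm_eq_abs, abs_of_nonneg (by positivity)]
  exact mul_le_of_le_one_right (Real.exp_pos _).le (one_sub_exp_neg_div_le ht)

theorem integral_frullani_exp {c : ℝ} (hc : 0 < c) :
    ∫ t in Ioi (0 : ℝ), t⁻¹ • (exp (-(c * t)) - exp (-((c + 1) * t))) = log ((c + 1) / c) := by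
  have hf : Continuous fun t : ℝ => exp (-t) := by fun_prop
  have := Frullani.integral_Ioi_eq (f := fun t : ℝ => exp (-t)) (L := 1) (R := 0)
    (hf.continuousOn.locallyIntegrableOn measurableSet_Ioi) hc (by linarith : 0 < c + 1)
    (by simpa using (hf.tendsto 0).mono_left nhdsWithin_le_nhds)
    Real.tendsto_exp_neg_atTop_nhds_zero (integrableOn_frullani_exp hc)
  simpa using this

/-- The difference of `(1 - e⁻ᵗ) / t` and `tanh (t / 2) / t`. -/
def expTanhDiff (t : ℝ) : ℝ := exp (-t) * ((1 - exp (-t)) / t) / (1 + exp (-t))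

theorem tanh_half_eq (t : ℝ) : Real.tanh (t / 2) = (1 - exp (-t)) / (1 + exp (-t)) := by
  have h : exp (-t) = exp (-(t / 2)) * exp (-(t / 2)) := by rw [← Real.exp_add]; ring_nf
  have h2 : exp (t / 2) * exp (-(t / 2)) = 1 := by rw [← Real.exp_add]; simp
  rw [Real.tanh_eq, div_eq_div_iff (by positivity) (by positivity), h]
  linear_combination (2 * exp (-(t / 2))) * h2

theorem expTanhDiff_eq {t : ℝ} (ht : t ≠ 0) :
    expTanhDiff t = (1 - exp (-t)) / t - Real.tanh (t / 2) / t := by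
  rw [tanh_half_eq, expTanhDiff]
  have : 1 + exp (-t) ≠ 0 := by positivity
  field_simp
  ring

theorem expTanhDiff_nonneg {t : ℝ} (ht : 0 < t) : 0 ≤ expTanhDiff t := by
  have := one_sub_exp_neg_nonneg ht
  unfold expTanhDiff; positivity

theorem expTanhDiff_le {t : ℝ} (ht : 0 < t) : expTanhDiff t ≤ exp (-t) := by
  have := one_sub_exp_neg_nonneg ht
  unfold expTanhDiff
  rw [div_le_iff₀ (by positivity)]
  gcongr
  linarith [one_sub_exp_neg_div_le ht, Real.exp_pos (-t)]

theorem integrableOn_expTanhDiff : IntegrableOn expTanhDiff (Ioi 0) := by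
  refine (integrableOn_exp_neg_mul one_pos).mono' ?_
    ((ae_restrict_iff' measurableSet_Ioi).2 (ae_of_all _ fun t ht => ?_))
  · unfold expTanhDiff; exact Measurable.aestronglyMeasurable (by fun_prop)
  · rw [Real.norm_eq_abs, abs_of_nonneg (expTanhDiff_nonneg ht), one_mul]
    exact expTanhDiff_le ht

/-- Writing 1/(1 + e⁻ᵗ) = (1 − e⁻ᵗ)/(1 − e⁻²ᵗ) and expanding geometrically in e⁻²ᵗ turns
`expTanhDiff` into second differences of exponentials over t, each a difference of two Frullani
integrands. -/
theorem sum_frullani_exp (k : ℕ) {t : ℝ} (ht : 0 < t) :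
    ∑ i ∈ Finset.range k,
      (t⁻¹ • (exp (-((2 * i + 1 : ℝ) * t)) - exp (-((2 * i + 1 + 1 : ℝ) * t))) -
        t⁻¹ • (exp (-((2 * i + 2 : ℝ) * t)) - exp (-((2 * i + 2 + 1 : ℝ) * t)))) =
      expTanhDiff t - expTanhDiff t * exp (-(2 * k * t)) := by
  have h1 : (1 + exp (-t)) ≠ 0 := by positivity
  induction k with
  | zero => simp
  | succ k ih =>
    rw [Finset.sum_range_succ, ih]
    have a1 : exp (-((2 * k + 1 : ℝ) * t)) = exp (-(2 * k * t)) * exp (-t) := by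
      rw [← Real.exp_add]; ring_nf
    have a2 : exp (-((2 * k + 1 + 1 : ℝ) * t)) = exp (-(2 * k * t)) * exp (-t) ^ 2 := by
      rw [← Real.exp_nat_mul, ← Real.exp_add]; push_cast; ring_nf
    have a3 : exp (-((2 * k + 2 : ℝ) * t)) = exp (-(2 * k * t)) * exp (-t) ^ 2 := by
      rw [← Real.exp_nat_mul, ← Real.exp_add]; push_cast; ring_nf
    have a4 : exp (-((2 * k + 2 + 1 : ℝ) * t)) = exp (-(2 * k * t)) * exp (-t) ^ 3 := by
      rw [← Real.exp_nat_mul, ← Real.exp_add]; push_cast; ring_nf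
    have a5 : exp (-(2 * ((k + 1 : ℕ) : ℝ) * t)) = exp (-(2 * k * t)) * exp (-t) ^ 2 := by
      rw [← Real.exp_nat_mul, ← Real.exp_add]; push_cast; ring_nf
    rw [a1, a2, a3, a4, a5]
    simp only [expTanhDiff, smul_eq_mul]
    field_simp
    ring

/-- The i-th summand integrates to log((2i+2)/(2i+1)) − log((2i+3)/(2i+2)), the logarithm of a
Wallis factor. The remainder after k terms is at most the integral of e^{−(2k+1)t}, that is
1/(2k+1). -/
theorem integral_expTanhDiff : ∫ t in Ioi (0 : ℝ), expTanhDiff t = log (π / 2) := by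
  have hW := (Real.continuousAt_log (by positivity)).tendsto.comp Real.tendsto_prod_pi_div_two
  refine tendsto_nhds_unique ?_ hW
  rw [tendsto_iff_norm_sub_tendsto_zero]
  refine squeeze_zero (g := fun k : ℕ => 1 / ((k : ℝ) + 1)) (fun _ => norm_nonneg _) (fun k => ?_)
    tendsto_one_div_add_atTop_nhds_zero_nat
  have hi1 : ∀ i : ℕ, (0 : ℝ) < 2 * i + 1 := fun i => by positivity
  have hi2 : ∀ i : ℕ, (0 : ℝ) < 2 * i + 2 := fun i => by positivity
  have hsum : log (∏ i ∈ Finset.range k, (2 * (i : ℝ) + 2) / (2 * i + 1) *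
      ((2 * i + 2) / (2 * i + 3))) =
      ∫ t in Ioi (0 : ℝ), (expTanhDiff t - expTanhDiff t * exp (-(2 * k * t))) := by
    rw [Real.log_prod fun i _ => by positivity,
      ← setIntegral_congr_fun measurableSet_Ioi fun t ht => sum_frullani_exp k ht,
      integral_finsetSum]
    · refine Finset.sum_congr rfl fun i _ => ?_
      rw [integral_sub (integrableOn_frullani_exp (hi1 i)) (integrableOn_frullani_exp (hi2 i)),
        integral_frullani_exp (hi1 i), integral_frullani_exp (hi2 i),
        ← Real.log_div (by positivity) (by positivity)]
      congr 1
      field_simp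
      ring
    · exact fun i _ => (integrableOn_frullani_exp (hi1 i)).sub (integrableOn_frullani_exp (hi2 i))
  have hint : IntegrableOn (fun t => expTanhDiff t * exp (-(2 * k * t))) (Ioi 0) := by
    refine integrableOn_expTanhDiff.mono'
      (integrableOn_expTanhDiff.aestronglyMeasurable.mul (by fun_prop))
      ((ae_restrict_iff' measurableSet_Ioi).2 (ae_of_all _ fun t ht => ?_))
    have ht : 0 < t := ht
    have := expTanhDiff_nonneg ht
    rw [Real.norm_eq_abs, abs_of_nonneg (by positivity)]
    refine mul_le_of_le_one_right this (Real.exp_le_one_iff.2 ?_)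
    have : 0 ≤ 2 * k * t := by positivity
    linarith
  simp only [Function.comp]
  rw [hsum, integral_sub integrableOn_expTanhDiff hint, sub_sub_cancel_left, norm_neg,
    Real.norm_eq_abs, abs_of_nonneg (setIntegral_nonneg measurableSet_Ioi fun t ht =>
      mul_nonneg (expTanhDiff_nonneg ht) (Real.exp_pos _).le)]
  calc _ ≤ ∫ t in Ioi (0 : ℝ), exp (-((2 * k + 1) * t)) := by
        refine setIntegral_mono_on hint (integrableOn_exp_neg_mul (hi1 k)) measurableSet_Ioi
          fun t ht => ?_
        rw [show -((2 * k + 1) * t) = -t + -(2 * k * t) by ring, Real.exp_add]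
        exact mul_le_mul_of_nonneg_right (expTanhDiff_le ht) (Real.exp_pos _).le
    _ = 1 / (2 * k + 1) := integral_exp_neg_mul (hi1 k)
    _ ≤ 1 / (k + 1) := by gcongr; linarith [(Nat.cast_nonneg k : (0 : ℝ) ≤ k)]

/-- The difference of `1 / √(1 + t²)` and `(1 - e⁻ᵗ) / t`. -/
def invSqrtExpDiff (t : ℝ) : ℝ := 1 / √(1 + t ^ 2) - (1 - exp (-t)) / t

theorem bcsKernel_one_zero {t : ℝ} (ht : 0 < t) :
    bcsKernel 1 0 t = invSqrtExpDiff t + expTanhDiff t := by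
  rw [expTanhDiff_eq ht.ne', invSqrtExpDiff, bcsKernel, thermalTanh_zero, one_pow]
  ring

theorem integrableOn_invSqrtExpDiff : IntegrableOn invSqrtExpDiff (Ioi 0) := by
  refine ((integrableOn_bcsKernel zero_le_one le_rfl (.inl one_pos)).sub
    integrableOn_expTanhDiff).congr_fun (fun t ht => ?_) measurableSet_Ioi
  simp [bcsKernel_one_zero ht]

/-! ### The contribution log 2 − γ: arsinh against harmonic numbers -/

theorem hasDerivAt_arsinh' (t : ℝ) : HasDerivAt Real.arsinh (1 / √(1 + t ^ 2)) t := by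
  simpa using Real.hasDerivAt_arsinh t

theorem tendsto_arsinh_sub_log :
    Tendsto (fun n : ℕ => Real.arsinh n - log n) atTop (𝓝 (log 2)) := by
  have h1 : Tendsto (fun n : ℕ => 1 + √(((n : ℝ) ^ 2)⁻¹ + 1)) atTop (𝓝 (1 + √(0 + 1))) := by
    refine (Tendsto.sqrt (Tendsto.add_const 1 ?_)).const_add 1
    exact ((tendsto_pow_atTop two_ne_zero).comp tendsto_natCast_atTop_atTop).inv_tendsto_atTop
  have h2 := (Real.continuousAt_log (by norm_num : (1 + √(0 + 1) : ℝ) ≠ 0)).tendsto.comp h1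
  rw [show (1 : ℝ) + √(0 + 1) = 2 by norm_num] at h2
  refine h2.congr' ?_
  filter_upwards [eventually_gt_atTop 0] with n hn
  have hn' : (0 : ℝ) < n := by exact_mod_cast hn
  simp only [Function.comp, Real.arsinh]
  rw [← Real.log_div (by positivity) hn'.ne']
  congr 1
  have : √(1 + (n : ℝ) ^ 2) = n * √(((n : ℝ) ^ 2)⁻¹ + 1) := by
    rw [← Real.sqrt_sq hn'.le, ← Real.sqrt_mul (by positivity), Real.sqrt_sq hn'.le]
    congr 1
    field_simp
  rw [this]
  field_simp

/-- Replacing e⁻ᵗ by (1 − t/n)ⁿ on [0, n] makes the integral exactly arsinh n minus the harmonic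
number, and changes the integrand by at most t e⁻ᵗ/n. -/
theorem abs_integral_invSqrtExpDiff_sub_le {n : ℕ} (hn : 0 < n) :
    |(∫ t in (0 : ℝ)..n, invSqrtExpDiff t) - (Real.arsinh n - harmonic n)| ≤
      (∫ t in Ioi (0 : ℝ), t * exp (-t)) / n := by
  have hn' : (0 : ℝ) < n := by exact_mod_cast hn
  have hI : IntegrableOn (fun t : ℝ => t * exp (-t)) (Ioi 0) := by
    refine (Real.GammaIntegral_convergent two_pos).congr_fun (fun t _ => ?_) measurableSet_Ioi
    norm_num
    ring
  have hc1 : Continuous fun t : ℝ => 1 / √(1 + t ^ 2) :=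
    continuous_const.div (by fun_prop) fun t => by positivity
  have hi1 : IntervalIntegrable (fun t : ℝ => 1 / √(1 + t ^ 2)) volume 0 n :=
    hc1.intervalIntegrable _ _
  have hi2 : IntervalIntegrable (fun t : ℝ => ∑ j ∈ Finset.range n, (1 - t / n) ^ j / n)
      volume 0 n := Continuous.intervalIntegrable (by fun_prop) _ _
  have hi3 : IntervalIntegrable invSqrtExpDiff volume 0 n :=
    (intervalIntegrable_iff_integrableOn_Ioc_of_le hn'.le).2
      (integrableOn_invSqrtExpDiff.mono_set Ioc_subset_Ioi_self)
  have e1 : ∫ t in (0 : ℝ)..n, 1 / √(1 + t ^ 2) = Real.arsinh n := by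
    rw [intervalIntegral.integral_eq_sub_of_hasDerivAt (fun t _ => hasDerivAt_arsinh' t) hi1]
    simp
  rw [← e1, ← integral_sum_one_sub_div_pow hn, ← intervalIntegral.integral_sub hi1 hi2,
    ← intervalIntegral.integral_sub hi3 (hi1.sub hi2), intervalIntegral.integral_of_le hn'.le,
    ← integral_div]
  have hbound : ∀ t ∈ Ioc (0 : ℝ) n, ‖invSqrtExpDiff t - (1 / √(1 + t ^ 2) -
      ∑ j ∈ Finset.range n, (1 - t / n) ^ j / n)‖ ≤ t * exp (-t) / n := by
    intro t ht
    obtain ⟨h1, h2⟩ := exp_neg_sub_pow_bounds hn ht.1.le ht.2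
    have ht0 := ht.1
    rw [sum_one_sub_div_pow hn ht.1.ne', invSqrtExpDiff]
    rw [show 1 / √(1 + t ^ 2) - (1 - exp (-t)) / t - (1 / √(1 + t ^ 2) - (1 - (1 - t / n) ^ n) / t)
      = (exp (-t) - (1 - t / n) ^ n) / t by ring, Real.norm_eq_abs,
      abs_of_nonneg (div_nonneg h1 ht.1.le), div_le_iff₀ ht.1]
    refine h2.trans_eq (by ring)
  refine (norm_integral_le_of_norm_le ((hI.mono_set Ioc_subset_Ioi_self).div_const _)
    ((ae_restrict_iff' measurableSet_Ioc).2 (ae_of_all _ hbound))).trans ?_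
  refine setIntegral_mono_set (hI.div_const _) ?_ Ioc_subset_Ioi_self.eventuallyLE
  refine (ae_restrict_iff' measurableSet_Ioi).2 (ae_of_all _ fun t ht => ?_)
  have : 0 < t := ht
  simp only [Pi.zero_apply]
  positivity

theorem integral_invSqrtExpDiff :
    ∫ t in Ioi (0 : ℝ), invSqrtExpDiff t = log 2 - eulerMascheroniConstant := by
  have h1 := intervalIntegral_tendsto_integral_Ioi 0 integrableOn_invSqrtExpDiff
    (tendsto_natCast_atTop_atTop (R := ℝ))
  have h2 := tendsto_arsinh_sub_log.sub Real.tendsto_harmonic_sub_log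
  have h3 : Tendsto (fun n : ℕ => (∫ t in (0 : ℝ)..n, invSqrtExpDiff t) -
      (Real.arsinh n - harmonic n)) atTop (𝓝 0) := by
    refine squeeze_zero_norm' ?_ (tendsto_const_div_atTop_nhds_zero_nat
      (∫ t in Ioi (0 : ℝ), t * exp (-t)))
    filter_upwards [eventually_gt_atTop 0] with n hn
    exact abs_integral_invSqrtExpDiff_sub_le hn
  refine tendsto_nhds_unique h1 ?_
  have := h3.add h2
  rw [zero_add] at this
  refine this.congr fun n => ?_
  ring

theorem bcsIntegral_one_zero : bcsIntegral 1 0 = log (π * exp (-eulerMascheroniConstant)) := by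
  unfold bcsIntegral
  rw [setIntegral_congr_fun measurableSet_Ioi fun t ht => bcsKernel_one_zero ht,
    integral_add integrableOn_invSqrtExpDiff integrableOn_expTanhDiff, integral_invSqrtExpDiff,
    integral_expTanhDiff, Real.log_mul (by positivity) (by positivity), Real.log_exp,
    Real.log_div (by positivity) (by positivity)]
  ring

end

end HubbardAF

namespace HubbardAF

open Real Set Filter Topology MeasureTheory

noncomputable section

/-! ### The BCS gap function -/

/-- The value `π e^{-γ}` of the BCS gap function at zero temperature. -/
def zeroTempGap : ℝ := π * exp (-eulerMascheroniConstant)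

theorem zeroTempGap_pos : 0 < zeroTempGap := by unfold zeroTempGap; positivity

theorem bcsIntegral_zero_temp_eq {x : ℝ} (hx : 0 < x) :
    bcsIntegral x 0 = log zeroTempGap - log x := by
  rw [bcsIntegral_zero_temp hx, bcsIntegral_one_zero, zeroTempGap]

/-- Near 0 the kernel is 1/ε minus a bounded function. A divergent integral has the default value 0,
so without the integrability clause x = 0 would be a spurious solution at y = 0. -/
theorem not_integrableOn_bcsKernel_zero_zero : ¬ IntegrableOn (bcsKernel 0 0) (Ioi 0) := by
  intro h
  have h1 := h.mono_set (Ioc_subset_Ioi_self : Ioc (0 : ℝ) 1 ⊆ Ioi 0)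
  have h2 : IntegrableOn (pairKernel 0 1) (Ioc 0 1) := by
    refine Measure.integrableOn_of_bounded (M := 1 / (2 * 1)) (by simp)
      (measurable_pairKernel 0 1).aestronglyMeasurable (ae_of_all _ fun ε => ?_)
    rw [Real.norm_eq_abs, abs_of_nonneg (pairKernel_nonneg 0 zero_le_one ε)]
    exact pairKernel_le_half_inv 0 one_pos ε
  have h3 : IntegrableOn (fun ε : ℝ => ε⁻¹) (Ioc 0 1) := by
    refine (h1.add h2).congr_fun (fun ε hε => ?_) measurableSet_Ioc
    simp only [Pi.add_apply]
    rw [bcsKernel_eq 0 0 hε.1, pairKernel_zero_left 0 hε.1, thermalTanh_zero]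
    ring
  rw [← intervalIntegrable_iff_integrableOn_Ioc_of_le zero_le_one,
    intervalIntegrable_inv_iff] at h3
  simp at h3

theorem IsBCSGap.pos_or_pos {x y : ℝ} (h : IsBCSGap y x) (hy : 0 ≤ y) : 0 < x ∨ 0 < y := by
  by_contra! hc
  obtain rfl := le_antisymm hc.1 h.1
  obtain rfl := le_antisymm hc.2 hy
  exact not_integrableOn_bcsKernel_zero_zero h.2.1

theorem IsBCSGap.bcsIntegral_eq {x y : ℝ} (h : IsBCSGap y x) : bcsIntegral x y = 0 := h.2.2

theorem isBCSGap_of_bcsIntegral_eq {x y : ℝ} (hx : 0 ≤ x) (hy : 0 ≤ y) (h : 0 < x ∨ 0 < y)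
    (h0 : bcsIntegral x y = 0) : IsBCSGap y x := ⟨hx, integrableOn_bcsKernel hx hy h, h0⟩

theorem isBCSGap_zero : IsBCSGap 0 zeroTempGap :=
  isBCSGap_of_bcsIntegral_eq zeroTempGap_pos.le le_rfl (.inl zeroTempGap_pos)
    (by rw [bcsIntegral_zero_temp_eq zeroTempGap_pos, sub_self])

/-- J decreases in both variables, so for 0 < y ≤ 1 it satisfies J(0, y) ≥ J(0, 1) = 0 and
J(πe^{−γ}, y) ≤ J(πe^{−γ}, 0) = 0; the intermediate value theorem applies between these gaps. -/
theorem exists_isBCSGap {y : ℝ} (hy : y ∈ Icc (0 : ℝ) 1) : ∃ x, IsBCSGap y x := by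
  rcases hy.1.eq_or_lt with rfl | hy0
  · exact ⟨_, isBCSGap_zero⟩
  have h0 : 0 ≤ bcsIntegral 0 y := by
    rcases hy.2.eq_or_lt with rfl | hy1
    · rw [bcsIntegral_zero_one]
    · exact bcsIntegral_zero_one.symm.le.trans
        (bcsIntegral_lt_of_temp_lt le_rfl hy.1 hy1 (.inr hy0)).le
  have h1 : bcsIntegral zeroTempGap y ≤ 0 := by
    rw [← isBCSGap_zero.bcsIntegral_eq]
    exact (bcsIntegral_lt_of_temp_lt zeroTempGap_pos.le le_rfl hy0 (.inl zeroTempGap_pos)).le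
  obtain ⟨x, hx, hx'⟩ := intermediate_value_Icc' zeroTempGap_pos.le
    ((continuousOn_bcsIntegral hy0).mono Icc_subset_Ici_self) ⟨h1, h0⟩
  exact ⟨x, isBCSGap_of_bcsIntegral_eq hx.1 hy.1 (.inr hy0) hx'⟩

theorem IsBCSGap.unique {y x x' : ℝ} (hy : 0 ≤ y) (h : IsBCSGap y x) (h' : IsBCSGap y x') :
    x = x' := by
  by_contra hne
  rcases lt_or_gt_of_ne hne with hlt | hlt
  · have := bcsIntegral_lt_of_lt h.1 hlt hy (h.pos_or_pos hy)
    rw [h.bcsIntegral_eq, h'.bcsIntegral_eq] at this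
    exact this.false
  · have := bcsIntegral_lt_of_lt h'.1 hlt hy (h'.pos_or_pos hy)
    rw [h.bcsIntegral_eq, h'.bcsIntegral_eq] at this
    exact this.false

theorem existsUnique_isBCSGap {y : ℝ} (hy : y ∈ Icc (0 : ℝ) 1) : ∃! x, IsBCSGap y x := by
  obtain ⟨x, hx⟩ := exists_isBCSGap hy
  exact ⟨x, hx, fun x' hx' => hx'.unique hy.1 hx⟩

theorem isBCSGap_fBCS {y : ℝ} (hy : y ∈ Icc (0 : ℝ) 1) : IsBCSGap y (fBCS y) :=
  Classical.epsilon_spec (exists_isBCSGap hy)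

theorem fBCS_zero : fBCS 0 = zeroTempGap :=
  (isBCSGap_fBCS (by simp)).unique le_rfl isBCSGap_zero

theorem fBCS_pos {y : ℝ} (hy : y ∈ Ico (0 : ℝ) 1) : 0 < fBCS y := by
  have h := isBCSGap_fBCS (Ico_subset_Icc_self hy)
  refine h.1.lt_of_ne' fun h0 => ?_
  have hy0 : 0 < y := by simpa [h0] using h.pos_or_pos hy.1
  have := bcsIntegral_lt_of_temp_lt le_rfl hy.1 hy.2 (.inr hy0)
  have h1 := h.bcsIntegral_eq
  rw [h0] at h1
  rw [bcsIntegral_zero_one, h1] at this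
  exact this.false

theorem bcsIntegral_fBCS {y : ℝ} (hy : y ∈ Icc (0 : ℝ) 1) : bcsIntegral (fBCS y) y = 0 :=
  (isBCSGap_fBCS hy).bcsIntegral_eq

theorem fBCS_antitoneOn : AntitoneOn fBCS (Icc 0 1) := by
  intro y hy y' hy' hle
  rcases hle.eq_or_lt with rfl | hlt
  · exact le_rfl
  by_contra! hc
  have h := isBCSGap_fBCS hy
  have h' := isBCSGap_fBCS hy'
  have h1 := bcsIntegral_lt_of_lt h.1 hc hy'.1 (.inr (hy.1.trans_lt hlt))
  have h2 := bcsIntegral_lt_of_temp_lt h.1 hy.1 hlt (h.pos_or_pos hy.1)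
  rw [h.bcsIntegral_eq] at h2
  rw [h'.bcsIntegral_eq] at h1
  linarith

theorem fBCS_le_zeroTempGap {y : ℝ} (hy : y ∈ Icc (0 : ℝ) 1) : fBCS y ≤ zeroTempGap := by
  rw [← fBCS_zero]
  exact fBCS_antitoneOn (by simp) hy hy.1

theorem bcsSlope_zeroTempGap : zeroTempGap * bcsSlope zeroTempGap 0 = 1 := by
  have h1 := hasDerivAt_bcsIntegral zeroTempGap_pos le_rfl
  have h2 : HasDerivAt (fun x => bcsIntegral x 0) (-zeroTempGap⁻¹) zeroTempGap := by
    refine ((Real.hasDerivAt_log zeroTempGap_pos.ne').const_sub (log zeroTempGap)).congr_of_eventuallyEq ?_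
    filter_upwards [lt_mem_nhds zeroTempGap_pos] with x hx
    exact bcsIntegral_zero_temp_eq hx
  rw [neg_injective (h1.unique h2)]
  exact mul_inv_cancel₀ zeroTempGap_pos.ne'

/-- With Z = πe^{−γ} and f the gap function, log(Z/f(y)) = J(f(y), 0) − J(f(y), y), which is O(y²)
by the thermal tail estimate, uniformly since f(y) ≥ f(1/2). Then 1 − f/Z ≤ log(Z/f). This gives
f'(0) = 0, a point that the rescaling of y used for y > 0 cannot reach. -/
theorem zeroTempGap_sub_fBCS_le {y : ℝ} (hy0 : 0 ≤ y) (hy : y ≤ 1 / 2) :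
    zeroTempGap - fBCS y ≤
      zeroTempGap * (2 * (2 * (1 + 1 / fBCS (1 / 2))) ^ 3) * y ^ 2 := by
  have hyI : y ∈ Ico (0 : ℝ) 1 := ⟨hy0, by linarith⟩
  have hc := fBCS_pos (y := 1 / 2) (by norm_num)
  have hcy := fBCS_antitoneOn (Ico_subset_Icc_self hyI) (by norm_num) hy
  set c := fBCS (1 / 2)
  have hf := fBCS_pos hyI
  have h1 := bcsIntegral_sub hf.le le_rfl (.inl hf) hf.le hy0 (.inl hf)
  rw [bcsIntegral_fBCS (Ico_subset_Icc_self hyI), sub_zero, bcsIntegral_zero_temp_eq hf] at h1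
  have h2 := abs_integral_le_of_abs_le_inv_one_add_pow 1
    (f := fun ε => pairKernel (fBCS y) 0 ε - pairKernel (fBCS y) y ε)
    (C := 4 * y ^ 2 * (2 * (1 + 1 / c)) ^ 3) fun ε hε => by
      have hs := sqrt_sq_add_sq_pos (fBCS y) hε
      have hs' := sqrt_sq_add_sq_pos c hε
      have e : pairKernel (fBCS y) 0 ε = 1 / √(fBCS y ^ 2 + ε ^ 2) := by
        rw [pairKernel, thermalTanh_zero]
      rw [e, abs_of_nonneg (inv_sub_pairKernel_nonneg _ _ _)]
      calc _ ≤ 4 * y ^ 2 / √(fBCS y ^ 2 + ε ^ 2) ^ 3 := inv_sub_pairKernel_le _ hy0 hε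
        _ ≤ 4 * y ^ 2 / √(c ^ 2 + ε ^ 2) ^ 3 := by gcongr
        _ = 4 * y ^ 2 * (1 / √(c ^ 2 + ε ^ 2) ^ 3) := by ring
        _ ≤ 4 * y ^ 2 * ((2 * (1 + 1 / c)) ^ 3 * ((1 + ε) ^ 3)⁻¹) := by
          gcongr; exact inv_sqrt_cube_le hc hε
        _ = _ := by ring
  rw [← h1] at h2
  have h3 := (le_abs_self _).trans h2
  have h4 := Real.add_one_le_exp (-(log zeroTempGap - log (fBCS y)))
  have h5 : exp (-(log zeroTempGap - log (fBCS y))) = fBCS y / zeroTempGap := by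
    rw [neg_sub, Real.exp_sub, Real.exp_log hf, Real.exp_log zeroTempGap_pos]
  rw [h5, le_div_iff₀ zeroTempGap_pos] at h4
  have hz := zeroTempGap_pos
  have h6 := mul_le_mul_of_nonneg_left h3 hz.le
  push_cast at h6
  have h7 : zeroTempGap * (4 * y ^ 2 * (2 * (1 + 1 / c)) ^ 3 / (1 + 1)) =
    zeroTempGap * (2 * (2 * (1 + 1 / c)) ^ 3) * y ^ 2 := by ring
  rw [h7] at h6
  linarith

theorem hasDerivWithinAt_fBCS_zero : HasDerivWithinAt fBCS 0 (Icc 0 1) 0 := by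
  rw [hasDerivWithinAt_iff_isLittleO]
  have hO : (fun t => fBCS t - fBCS 0 - (t - 0) • (0 : ℝ)) =O[𝓝[Icc 0 1] 0] fun t => (t - 0) ^ 2 := by
    refine Asymptotics.IsBigO.of_bound
      (zeroTempGap * (2 * (2 * (1 + 1 / fBCS (1 / 2))) ^ 3)) ?_
    filter_upwards [self_mem_nhdsWithin,
      nhdsWithin_le_nhds (gt_mem_nhds (by norm_num : (0 : ℝ) < 1 / 2))] with t ht ht'
    have h1 := zeroTempGap_sub_fBCS_le ht.1 ht'.le
    have h2 := fBCS_le_zeroTempGap ht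
    rw [fBCS_zero, smul_zero, sub_zero, sub_zero, Real.norm_eq_abs, abs_sub_comm,
      abs_of_nonneg (sub_nonneg.2 h2), Real.norm_eq_abs, abs_of_nonneg (sq_nonneg t)]
    exact h1
  refine hO.trans_isLittleO ?_
  have : Tendsto (fun t : ℝ => t - 0) (𝓝[Icc 0 1] 0) (𝓝 0) := by
    simp only [sub_zero]
    exact tendsto_id'.2 nhdsWithin_le_nhds
  exact (Asymptotics.isLittleO_pow_id (𝕜 := ℝ) one_lt_two).comp_tendsto this

/-- By the scaling law, ψ(t) = f(eᵗy)/eᵗ satisfies J(ψ(t), y) = t, so ψ locally inverts x ↦ J(x, y)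
at fixed y and ψ'(0) = −1/A with A the slope. Then f(z) = ψ(log(z/y)) · z/y is differentiated at z =
y; no derivative of J in y is needed. -/
theorem hasDerivAt_fBCS {y : ℝ} (hy : y ∈ Ioo (0 : ℝ) 1) :
    HasDerivAt fBCS ((fBCS y - (bcsSlope (fBCS y) y)⁻¹) / y) y := by
  have hyI : y ∈ Ico (0 : ℝ) 1 := Ioo_subset_Ico_self hy
  have hy0 := hy.1
  have hf := fBCS_pos hyI
  have hA := bcsSlope_pos hf hy0.le
  have hJ0 := bcsIntegral_fBCS (Ico_subset_Icc_self hyI)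
  set ψ : ℝ → ℝ := fun t => fBCS (exp t * y) / exp t with hψ
  have hψ0 : ψ 0 = fBCS y := by simp [hψ]
  have hnear : ∀ᶠ t in 𝓝 (0 : ℝ), exp t * y ∈ Ioo (0 : ℝ) 1 := by
    have hc : Continuous fun t : ℝ => exp t * y := by fun_prop
    refine hc.continuousAt.eventually_mem (Ioo_mem_nhds ?_ ?_) <;> simp [hy.1, hy.2]
  have hψpos : ∀ᶠ t in 𝓝 (0 : ℝ), 0 < ψ t := by
    filter_upwards [hnear] with t ht
    exact div_pos (fBCS_pos (Ioo_subset_Ico_self ht)) (Real.exp_pos t)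
  have hJψ : ∀ᶠ t in 𝓝 (0 : ℝ), bcsIntegral (ψ t) y = t := by
    filter_upwards [hnear, hψpos] with t ht hp
    have h1 := bcsIntegral_mul (Real.exp_pos t) hp.le hy0.le (.inl hp)
    have h2 : exp t * ψ t = fBCS (exp t * y) := by
      simp only [hψ]; field_simp
    rw [h2, bcsIntegral_fBCS (Ioo_subset_Icc_self ht), Real.log_exp] at h1
    linarith
  -- Strict monotonicity of J in x: once t lies between J(f + r, y) and J(f − r, y), the value ψ(t)
  -- is within r of f.
  have hcont : ContinuousAt ψ 0 := by
    rw [Metric.continuousAt_iff']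
    intro η hη
    set r := min η (fBCS y / 2) with hr
    have hr0 : 0 < r := by positivity
    have hrf : r ≤ fBCS y / 2 := min_le_right _ _
    have hl : 0 < bcsIntegral (fBCS y - r) y := by
      rw [← hJ0]; exact bcsIntegral_lt_of_lt (by linarith) (by linarith) hy0.le (.inr hy0)
    have hu : bcsIntegral (fBCS y + r) y < 0 := by
      rw [← hJ0]; exact bcsIntegral_lt_of_lt hf.le (by linarith) hy0.le (.inr hy0)
    filter_upwards [hJψ, hψpos, Ioo_mem_nhds hu hl] with t ht hp hI
    rw [← ht] at hI
    have h1 : fBCS y - r < ψ t := by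
      by_contra! hc
      rcases hc.eq_or_lt with he | hlt
      · rw [he] at hI; exact hI.2.false
      · exact (hI.2.trans (bcsIntegral_lt_of_lt hp.le hlt hy0.le (.inr hy0))).false
    have h2 : ψ t < fBCS y + r := by
      by_contra! hc
      rcases hc.eq_or_lt with he | hlt
      · rw [← he] at hI; exact hI.1.false
      · exact (hI.1.trans (bcsIntegral_lt_of_lt (by linarith) hlt hy0.le (.inr hy0))).false
    rw [hψ0, Real.dist_eq, abs_lt]
    have := min_le_left η (fBCS y / 2)
    constructor <;> linarith
  have hψd : HasDerivAt ψ (-bcsSlope (fBCS y) y)⁻¹ 0 :=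
    HasDerivAt.of_local_left_inverse hcont (by rw [hψ0]; exact hasDerivAt_bcsIntegral hf hy0.le)
      (neg_ne_zero.2 hA.ne') hJψ
  have hlog : HasDerivAt (fun z => log (z / y)) (1 / y) y := by
    refine (((hasDerivAt_id y).div_const y).log (by simp [hy0.ne'])).congr_deriv ?_
    simp [hy0.ne']
  have hcomp : HasDerivAt (fun z => ψ (log (z / y)) * (z / y))
      ((fBCS y - (bcsSlope (fBCS y) y)⁻¹) / y) y := by
    have h0 : log (y / y) = 0 := by simp [hy0.ne']
    have h1 : HasDerivAt (ψ ∘ fun z => log (z / y)) ((-bcsSlope (fBCS y) y)⁻¹ * (1 / y)) y :=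
      HasDerivAt.comp y (by rw [h0]; exact hψd) hlog
    refine (h1.mul ((hasDerivAt_id y).div_const y)).congr_deriv ?_
    simp only [Function.comp, h0, hψ0, id, inv_neg]
    field_simp
    ring
  refine hcomp.congr_of_eventuallyEq ?_
  filter_upwards [lt_mem_nhds hy0] with z hz
  have h1 : exp (log (z / y)) = z / y := Real.exp_log (by positivity)
  simp only [hψ, h1]
  field_simp

theorem differentiableWithinAt_fBCS {y : ℝ} (hy : y ∈ Ico (0 : ℝ) 1) :
    DifferentiableWithinAt ℝ fBCS (Icc 0 1) y := by
  rcases hy.1.eq_or_lt with rfl | h0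
  · exact hasDerivWithinAt_fBCS_zero.differentiableWithinAt
  · exact (hasDerivAt_fBCS ⟨h0, hy.2⟩).differentiableAt.differentiableWithinAt

/-- For y > 0 this rearranges the derivative formula, and at y = 0 it is the slope of log Z − log x
at Z = πe^{−γ}. It identifies the prefactor of g with the linear response of the root to a
perturbation of the gap equation. -/
theorem fBCS_sub_mul_deriv_mul_bcsSlope {y : ℝ} (hy : y ∈ Ico (0 : ℝ) 1) :
    (fBCS y - y * fBCSDeriv y) * bcsSlope (fBCS y) y = 1 := by
  rcases hy.1.eq_or_lt with rfl | h0
  · rw [fBCS_zero, zero_mul, sub_zero, bcsSlope_zeroTempGap]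
  · have hA := bcsSlope_pos (fBCS_pos hy) hy.1
    rw [fBCSDeriv, (hasDerivAt_fBCS ⟨h0, hy.2⟩).hasDerivWithinAt.derivWithin
      ((uniqueDiffOn_Icc zero_lt_one) y (Ico_subset_Icc_self hy))]
    field_simp
    ring

end

end HubbardAF

namespace HubbardAF

open Real Set Filter Topology MeasureTheory
open scoped ENNReal

noncomputable section

/-! ### Changes of variables with the cosine -/

theorem image_add_mul_cos (c : ℝ) {b : ℝ} (hb : 0 < b) :
    (fun k => c + b * cos k) '' Ioo 0 π = Ioo (c - b) (c + b) := by
  ext x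
  constructor
  · rintro ⟨k, hk, rfl⟩
    have h1 : cos k < 1 := by
      rw [← Real.cos_zero]
      exact Real.strictAntiOn_cos (by simp [pi_pos.le]) (Ioo_subset_Icc_self hk) hk.1
    have h2 : -1 < cos k := by
      rw [← Real.cos_pi]
      exact Real.strictAntiOn_cos (Ioo_subset_Icc_self hk) (by simp [pi_pos.le]) hk.2
    constructor <;> simp only <;> nlinarith
  · intro hx
    have h1 : -1 < (x - c) / b := by rw [lt_div_iff₀ hb]; linarith [hx.1]
    have h2 : (x - c) / b < 1 := by rw [div_lt_iff₀ hb]; linarith [hx.2]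
    refine ⟨arccos ((x - c) / b), ⟨Real.arccos_pos.2 h2, ?_⟩, ?_⟩
    · refine (Real.arccos_le_pi _).lt_of_ne fun h => ?_
      rw [Real.arccos_eq_pi] at h
      linarith
    · simp only
      rw [Real.cos_arccos h1.le h2.le]
      field_simp
      ring

theorem injOn_add_mul_cos (c : ℝ) {b : ℝ} (hb : 0 < b) :
    InjOn (fun k => c + b * cos k) (Ioo 0 π) := by
  intro k hk k' hk' h
  have : cos k = cos k' := by simpa [hb.ne'] using h
  exact Real.injOn_cos (Ioo_subset_Icc_self hk) (Ioo_subset_Icc_self hk') this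

theorem hasDerivWithinAt_add_mul_cos (c b : ℝ) (k : ℝ) (s : Set ℝ) :
    HasDerivWithinAt (fun k => c + b * cos k) (-(b * sin k)) s k := by
  have := ((Real.hasDerivAt_cos k).const_mul b).const_add c
  exact (this.congr_deriv (by ring)).hasDerivWithinAt

theorem sin_pos_of_mem {k : ℝ} (hk : k ∈ Ioo 0 π) : 0 < sin k :=
  Real.sin_pos_of_pos_of_lt_pi hk.1 hk.2

theorem lintegral_comp_add_mul_cos (c : ℝ) {b : ℝ} (hb : 0 < b) (g : ℝ → ℝ≥0∞) :
    ∫⁻ k in Ioo 0 π, ENNReal.ofReal (b * sin k) * g (c + b * cos k) =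
      ∫⁻ x in Ioo (c - b) (c + b), g x := by
  rw [← image_add_mul_cos c hb, lintegral_image_eq_lintegral_abs_deriv_mul measurableSet_Ioo
    (fun k _ => hasDerivWithinAt_add_mul_cos c b k _) (injOn_add_mul_cos c hb)]
  refine setLIntegral_congr_fun measurableSet_Ioo fun k hk => ?_
  have := sin_pos_of_mem hk
  simp only [abs_neg]
  rw [abs_of_nonneg (by positivity)]

theorem integral_comp_add_mul_cos (c : ℝ) {b : ℝ} (hb : 0 < b) (g : ℝ → ℝ) :
    ∫ k in Ioo 0 π, b * sin k * g (c + b * cos k) = ∫ x in Ioo (c - b) (c + b), g x := by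
  rw [← image_add_mul_cos c hb, integral_image_eq_integral_abs_deriv_smul measurableSet_Ioo
    (fun k _ => hasDerivWithinAt_add_mul_cos c b k _) (injOn_add_mul_cos c hb)]
  refine setIntegral_congr_fun measurableSet_Ioo fun k hk => ?_
  have := sin_pos_of_mem hk
  simp only [abs_neg, smul_eq_mul]
  rw [abs_of_nonneg (by positivity)]

theorem integrableOn_comp_add_mul_cos (c : ℝ) {b : ℝ} (hb : 0 < b) {g : ℝ → ℝ}
    (hg : IntegrableOn g (Ioo (c - b) (c + b))) :
    IntegrableOn (fun k => b * sin k * g (c + b * cos k)) (Ioo 0 π) := by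
  rw [← image_add_mul_cos c hb, integrableOn_image_iff_integrableOn_abs_deriv_smul
    measurableSet_Ioo (fun k _ => hasDerivWithinAt_add_mul_cos c b k _)
    (injOn_add_mul_cos c hb)] at hg
  refine hg.congr_fun (fun k hk => ?_) measurableSet_Ioo
  have := sin_pos_of_mem hk
  simp only [abs_neg, smul_eq_mul]
  rw [abs_of_nonneg (by positivity)]

theorem preimage_pi_sub_Ioo : (fun t => π - t) ⁻¹' Ioo 0 π = Ioo 0 π := by
  ext t; simp only [mem_preimage, mem_Ioo]; constructor <;> rintro ⟨h1, h2⟩ <;>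
    constructor <;> linarith

theorem integral_comp_neg_cos (h : ℝ → ℝ) :
    ∫ k in Ioo 0 π, h (-cos k) = ∫ k in Ioo 0 π, h (cos k) := by
  have := (Measure.measurePreserving_sub_left volume π).setIntegral_preimage_emb
    (Homeomorph.subLeft π).measurableEmbedding (fun k => h (cos k)) (Ioo 0 π)
  rw [preimage_pi_sub_Ioo] at this
  simpa [Real.cos_pi_sub] using this

theorem lintegral_comp_cos_Icc (h : ℝ → ℝ≥0∞) :
    ∫⁻ k in Icc (-π) π, h (cos k) = 2 * ∫⁻ k in Ioo 0 π, h (cos k) := by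
  have hneg := (Measure.measurePreserving_neg (volume : Measure ℝ)).setLIntegral_comp_preimage_emb
    (Homeomorph.neg ℝ).measurableEmbedding (fun k => h (cos k)) (Ioc 0 π)
  simp only [Real.cos_neg] at hneg
  have hpre : (Neg.neg : ℝ → ℝ) ⁻¹' Ioc 0 π = Ico (-π) 0 := by
    ext t; simp only [mem_preimage, mem_Ioc, mem_Ico]; constructor <;> rintro ⟨h1, h2⟩ <;>
      constructor <;> linarith
  rw [hpre] at hneg
  have hunion : Icc (-π) π = Ico (-π) 0 ∪ Icc 0 π := by
    rw [Ico_union_Icc_eq_Icc] <;> linarith [pi_pos]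
  rw [hunion, lintegral_union measurableSet_Icc
    (by rw [Set.disjoint_left]; intro t h1 h2; exact absurd h1.2 (not_lt.2 h2.1)), hneg,
    setLIntegral_congr Ioo_ae_eq_Icc.symm, setLIntegral_congr Ioo_ae_eq_Ioc.symm, two_mul]

/-! ### The planar density of states as a convolution -/

/-- The density of `2 cos k` for `k` distributed according to Lebesgue measure on `(0, π)`. -/
def arcsineWeight (x : ℝ) : ℝ≥0∞ := ENNReal.ofReal (√(4 - x ^ 2))⁻¹

theorem measurable_arcsineWeight : Measurable arcsineWeight := by
  unfold arcsineWeight; fun_prop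

theorem arcsineWeight_neg (x : ℝ) : arcsineWeight (-x) = arcsineWeight x := by
  simp [arcsineWeight]

/-- Off the support the radicand is nonpositive, and the default values √ = 0 and 0⁻¹ = 0 make the
weight vanish. No indicator function is needed. -/
theorem arcsineWeight_eq_zero {x : ℝ} (h : 2 ≤ |x|) : arcsineWeight x = 0 := by
  have : 4 - x ^ 2 ≤ 0 := by nlinarith [sq_abs x]
  simp [arcsineWeight, Real.sqrt_eq_zero_of_nonpos this]

theorem lintegral_comp_two_mul_cos (g : ℝ → ℝ≥0∞) :
    ∫⁻ k in Ioo 0 π, g (2 * cos k) = ∫⁻ x, arcsineWeight x * g x := by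
  have h1 := lintegral_comp_add_mul_cos 0 two_pos fun x => arcsineWeight x * g x
  have h2 : ∫⁻ x in Ioo (0 - 2 : ℝ) (0 + 2), arcsineWeight x * g x =
      ∫⁻ x, arcsineWeight x * g x := by
    refine setLIntegral_eq_of_support_subset fun x hx => ?_
    by_contra hc
    refine hx ?_
    have : 2 ≤ |x| := by
      rw [le_abs]
      simp only [mem_Ioo, not_and_or, not_lt] at hc
      rcases hc with h | h
      · right; linarith
      · left; linarith
    simp [arcsineWeight_eq_zero this]
  rw [← h2, ← h1]
  refine setLIntegral_congr_fun measurableSet_Ioo fun k hk => ?_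
  have hs := sin_pos_of_mem hk
  simp only [zero_add]
  rw [← mul_assoc, arcsineWeight, ← ENNReal.ofReal_mul (by positivity)]
  have e : √(4 - (2 * cos k) ^ 2) = 2 * sin k := by
    rw [show 4 - (2 * cos k) ^ 2 = (2 * sin k) ^ 2 by
      have := Real.sin_sq_add_cos_sq k; nlinarith, Real.sqrt_sq (by positivity)]
  rw [e, mul_inv_cancel₀ (by positivity)]
  simp

/-- The convolution of two arcsine densities. -/
def arcsineConv (E : ℝ) : ℝ≥0∞ := ∫⁻ x, arcsineWeight x * arcsineWeight (E - x)

theorem measurable_arcsineConv : Measurable arcsineConv := by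
  have := measurable_arcsineWeight
  exact Measurable.lintegral_prod_right' (f := fun p : ℝ × ℝ =>
    arcsineWeight p.2 * arcsineWeight (p.1 - p.2)) (by fun_prop)

/-- The law of a sum of two independent variables is the convolution of their densities. Values in
ℝ≥0∞ make Tonelli's theorem available without integrability conditions. -/
theorem lintegral_comp_two_cos {g : ℝ → ℝ≥0∞} (hg : Measurable g) :
    ∫⁻ k₁ in Ioo 0 π, ∫⁻ k₂ in Ioo 0 π, g (2 * cos k₁ + 2 * cos k₂) =
      ∫⁻ E, arcsineConv E * g E := by
  have hw := measurable_arcsineWeight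
  rw [lintegral_comp_two_mul_cos fun x => ∫⁻ k₂ in Ioo 0 π, g (x + 2 * cos k₂)]
  have h1 : ∀ x, arcsineWeight x * ∫⁻ k₂ in Ioo 0 π, g (x + 2 * cos k₂) =
      ∫⁻ E, arcsineWeight x * (arcsineWeight (E - x) * g E) := by
    intro x
    rw [lintegral_comp_two_mul_cos fun z => g (x + z), ← lintegral_sub_right_eq_self _ x,
      lintegral_const_mul _ (by fun_prop)]
    simp
  simp_rw [h1]
  rw [lintegral_lintegral_swap (by fun_prop)]
  refine lintegral_congr fun E => ?_
  rw [arcsineConv, ← lintegral_mul_const _ (by fun_prop)]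
  simp_rw [mul_assoc]

theorem arcsineConv_neg (E : ℝ) : arcsineConv (-E) = arcsineConv E := by
  unfold arcsineConv
  rw [← lintegral_neg_eq_self]
  refine lintegral_congr fun x => ?_
  rw [arcsineWeight_neg, ← arcsineWeight_neg (-E - -x)]
  congr 2; ring

theorem arcsineConv_eq_zero {E : ℝ} (hE : 4 ≤ |E|) : arcsineConv E = 0 := by
  unfold arcsineConv
  rw [lintegral_eq_zero_iff (by have := measurable_arcsineWeight; fun_prop)]
  refine ae_of_all _ fun x => ?_
  by_cases h : 2 ≤ |x|
  · simp [arcsineWeight_eq_zero h]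
  · have : 2 ≤ |E - x| := by
      have := abs_sub_abs_le_abs_sub E x
      push Not at h; linarith
    simp [arcsineWeight_eq_zero this]

/-- The integrand in the elliptic integral for the planar density of states. -/
def planarIntegrand (u φ : ℝ) : ℝ := (√(4 * u + (2 - u / 2) ^ 2 * sin φ ^ 2))⁻¹

/-- The substitution x = E/2 + (2 − E/2) cos φ parametrizes the common support (E − 2, 2). Of the
four linear factors of the radicand, (2 − x)(2 − E + x) is the square of the Jacobian and cancels;
(2 + x)(2 + E − x) = 4E + (2 − E/2)² sin² φ remains. -/
theorem arcsineConv_eq_lintegral {E : ℝ} (h0 : 0 < E) (h4 : E < 4) :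
    arcsineConv E = ∫⁻ φ in Ioo 0 π, ENNReal.ofReal (planarIntegrand E φ) := by
  have hb : 0 < 2 - E / 2 := by linarith
  have h1 := lintegral_comp_add_mul_cos (E / 2) hb
    fun x => arcsineWeight x * arcsineWeight (E - x)
  have h2 : ∫⁻ x in Ioo (E / 2 - (2 - E / 2)) (E / 2 + (2 - E / 2)),
      arcsineWeight x * arcsineWeight (E - x) = arcsineConv E := by
    refine setLIntegral_eq_of_support_subset fun x hx => ?_
    by_contra hc
    refine hx ?_
    simp only [mem_Ioo, not_and_or, not_lt] at hc
    rcases hc with h | h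
    · have : 2 ≤ |E - x| := by rw [le_abs]; left; linarith
      simp [arcsineWeight_eq_zero this]
    · have : 2 ≤ |x| := by rw [le_abs]; left; linarith
      simp [arcsineWeight_eq_zero this]
  rw [← h2, ← h1]
  refine setLIntegral_congr_fun measurableSet_Ioo fun φ hφ => ?_
  have hs := sin_pos_of_mem hφ
  have hsc := Real.sin_sq_add_cos_sq φ
  simp only [arcsineWeight]
  rw [← ENNReal.ofReal_mul (by positivity), ← ENNReal.ofReal_mul (by positivity), ← mul_inv,
    ← Real.sqrt_mul]
  · have e : (4 - (E / 2 + (2 - E / 2) * cos φ) ^ 2) *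
        (4 - (E - (E / 2 + (2 - E / 2) * cos φ)) ^ 2) =
        ((2 - E / 2) * sin φ) ^ 2 * (4 * E + (2 - E / 2) ^ 2 * sin φ ^ 2) := by
      have hc2 : cos φ ^ 2 = 1 - sin φ ^ 2 := by linarith
      have hc4 : cos φ ^ 4 = (1 - sin φ ^ 2) ^ 2 := by rw [← hc2]; ring
      ring_nf
      rw [hc4, hc2]
      ring
    rw [e, Real.sqrt_mul (sq_nonneg _), Real.sqrt_sq (by positivity), planarIntegrand]
    rw [mul_inv, ← mul_assoc, mul_inv_cancel₀ (by positivity), one_mul]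
  · have h1 : -1 ≤ cos φ := Real.neg_one_le_cos φ
    have h2 : cos φ ≤ 1 := Real.cos_le_one φ
    have : |E / 2 + (2 - E / 2) * cos φ| ≤ 2 := by
      rw [abs_le]; constructor <;> nlinarith
    nlinarith [sq_abs (E / 2 + (2 - E / 2) * cos φ), abs_nonneg (E / 2 + (2 - E / 2) * cos φ)]

end

end HubbardAF

namespace HubbardAF

open Real Set Filter Topology MeasureTheory
open scoped ENNReal

noncomputable section

/-! ### The planar density of states -/

/-- Jordan's inequality compares sin k with the distance to the nearer endpoint. -/
theorem integrableOn_sin_rpow {p : ℝ} (hp0 : 0 ≤ p) (hp1 : p < 1) :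
    IntegrableOn (fun k => sin k ^ (-p)) (Ioo 0 π) := by
  have h1 : IntervalIntegrable (fun k : ℝ => k ^ (-p)) volume 0 π :=
    intervalIntegral.intervalIntegrable_rpow' (by linarith)
  have h2 : IntervalIntegrable (fun k : ℝ => (π - k) ^ (-p)) volume 0 π := by
    have := (h1.comp_sub_left π).symm
    simpa using this
  have h3 : IntegrableOn (fun k : ℝ => (2 / π) ^ (-p) * (k ^ (-p) + (π - k) ^ (-p))) (Ioo 0 π) :=
    ((intervalIntegrable_iff_integrableOn_Ioo_of_le pi_pos.le).1 (h1.add h2)).const_mul _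
  refine h3.mono' (Measurable.aestronglyMeasurable (by fun_prop))
    ((ae_restrict_iff' measurableSet_Ioo).2 (ae_of_all _ fun k hk => ?_))
  have hs := sin_pos_of_mem hk
  have hk1 := hk.1
  have hk2 := sub_pos.2 hk.2
  have hp : 0 < 2 / π := by positivity
  rw [Real.norm_eq_abs, abs_of_nonneg (by positivity), mul_add, ← Real.mul_rpow hp.le hk1.le,
    ← Real.mul_rpow hp.le hk2.le]
  rcases le_total k (π / 2) with h | h
  · have : sin k ^ (-p) ≤ (2 / π * k) ^ (-p) :=
      Real.rpow_le_rpow_of_nonpos (by positivity) (Real.mul_le_sin hk1.le h) (by linarith)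
    have : 0 ≤ (2 / π * (π - k)) ^ (-p) := by positivity
    linarith
  · have h' : 2 / π * (π - k) ≤ sin k := by
      rw [← Real.sin_pi_sub]; exact Real.mul_le_sin hk2.le (by linarith)
    have : sin k ^ (-p) ≤ (2 / π * (π - k)) ^ (-p) :=
      Real.rpow_le_rpow_of_nonpos (by positivity) h' (by linarith)
    have : 0 ≤ (2 / π * k) ^ (-p) := by positivity
    linarith

/-- The radicand of the elliptic integral. -/
def planarRadicand (u φ : ℝ) : ℝ := 4 * u + (2 - u / 2) ^ 2 * sin φ ^ 2

theorem planarIntegrand_eq (u φ : ℝ) : planarIntegrand u φ = (√(planarRadicand u φ))⁻¹ := rfl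

theorem four_mul_le_planarRadicand (u φ : ℝ) : 4 * u ≤ planarRadicand u φ := by
  have : 0 ≤ (2 - u / 2) ^ 2 * sin φ ^ 2 := by positivity
  unfold planarRadicand; linarith

theorem planarRadicand_pos {u : ℝ} (hu : 0 < u) (φ : ℝ) : 0 < planarRadicand u φ :=
  (by linarith : 0 < 4 * u).trans_le (four_mul_le_planarRadicand u φ)

theorem planarRadicand_le {u : ℝ} (hu : 0 ≤ u) (hu4 : u ≤ 4) (φ : ℝ) :
    planarRadicand u φ ≤ 20 := by
  have h1 := Real.sin_sq_le_one φ
  have h2 : (2 - u / 2) ^ 2 ≤ 4 := by nlinarith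
  unfold planarRadicand
  nlinarith [sq_nonneg (sin φ), sq_nonneg (2 - u / 2)]

theorem add_sq_le_planarRadicand {u : ℝ} (hu : 0 ≤ u) (φ : ℝ) :
    u + sin φ ^ 2 ≤ planarRadicand u φ := by
  have h1 := Real.sin_sq_le_one φ
  have h2 := sq_nonneg (sin φ)
  unfold planarRadicand
  have : 0 ≤ 3 * u * (1 - sin φ ^ 2) := mul_nonneg (by linarith) (by linarith)
  nlinarith [mul_nonneg h2 (sq_nonneg u), mul_nonneg h2 hu, mul_nonneg h2 (sq_nonneg (u - 1))]

theorem planarIntegrand_nonneg (u φ : ℝ) : 0 ≤ planarIntegrand u φ := by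
  unfold planarIntegrand; positivity

theorem planarIntegrand_eq_rpow {u : ℝ} (hu : 0 < u) (φ : ℝ) :
    planarIntegrand u φ = planarRadicand u φ ^ (-(1 / 2) : ℝ) := by
  rw [planarIntegrand_eq, Real.rpow_neg (planarRadicand_pos hu φ).le, ← Real.sqrt_eq_rpow]

/-- The weighted arithmetic–geometric mean inequality, with weights 1/3 on u and 2/3 on sin² φ. A
small power of u replaces the logarithmic singularity of the elliptic integral; its exponent leaves
room to raise the bound to the power 3/2 later. -/
theorem planarIntegrand_le {u : ℝ} (hu : 0 < u) {φ : ℝ} (hφ : φ ∈ Ioo 0 π) :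
    planarIntegrand u φ ≤ u ^ (-(1 / 6) : ℝ) * sin φ ^ (-(2 / 3) : ℝ) := by
  have hs := sin_pos_of_mem hφ
  have h1 := Real.geom_mean_le_arith_mean2_weighted (w₁ := 1 / 3) (w₂ := 2 / 3) (p₁ := u)
    (p₂ := sin φ ^ 2) (by norm_num) (by norm_num) hu.le (sq_nonneg _) (by norm_num)
  have h2 : u ^ (1 / 3 : ℝ) * (sin φ ^ 2) ^ (2 / 3 : ℝ) ≤ planarRadicand u φ := by
    refine h1.trans (le_trans ?_ (add_sq_le_planarRadicand hu.le φ))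
    nlinarith [sq_nonneg (sin φ)]
  rw [planarIntegrand_eq_rpow hu]
  refine (Real.rpow_le_rpow_of_nonpos (by positivity) h2 (by norm_num)).trans_eq ?_
  rw [Real.mul_rpow (by positivity) (by positivity), ← Real.rpow_mul hu.le,
    ← Real.rpow_natCast (sin φ) 2, ← Real.rpow_mul hs.le, ← Real.rpow_mul hs.le]
  norm_num

theorem continuous_planarIntegrand {u : ℝ} (hu : 0 < u) : Continuous (planarIntegrand u) := by
  unfold planarIntegrand
  refine Continuous.inv₀ (by fun_prop) fun φ => (Real.sqrt_pos.2 (planarRadicand_pos hu φ)).ne'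

theorem integrableOn_planarIntegrand {u : ℝ} (hu : 0 < u) :
    IntegrableOn (planarIntegrand u) (Ioo 0 π) :=
  ((continuous_planarIntegrand hu).integrableOn_Icc).mono_set Ioo_subset_Icc_self

open Classical in
/-- The density of states of the square lattice with hopping `1`. -/
def planarDOS (E : ℝ) : ℝ :=
  if 0 < |E| ∧ |E| < 4 then (∫ φ in Ioo 0 π, planarIntegrand |E| φ) / π ^ 2 else 0

theorem planarDOS_of_pos {u : ℝ} (h0 : 0 < u) (h4 : u < 4) :
    planarDOS u = (∫ φ in Ioo 0 π, planarIntegrand u φ) / π ^ 2 := by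
  rw [planarDOS, abs_of_pos h0, if_pos ⟨h0, h4⟩]

theorem planarDOS_neg (E : ℝ) : planarDOS (-E) = planarDOS E := by
  simp only [planarDOS, abs_neg]

theorem planarDOS_nonneg (E : ℝ) : 0 ≤ planarDOS E := by
  unfold planarDOS
  split_ifs
  · exact div_nonneg (integral_nonneg fun φ => planarIntegrand_nonneg _ _) (by positivity)
  · exact le_rfl

theorem planarDOS_eq_zero {E : ℝ} (h : 4 ≤ |E|) : planarDOS E = 0 :=
  if_neg fun hc => absurd hc.2 (not_lt.2 h)

theorem measurable_planarDOS : Measurable planarDOS := by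
  unfold planarDOS
  refine Measurable.ite ?_ (Measurable.div_const ?_ _) measurable_const
  · have h : Measurable fun E : ℝ => |E| := by fun_prop
    exact (measurableSet_lt measurable_const h).inter (measurableSet_lt h measurable_const)
  · refine StronglyMeasurable.measurable (StronglyMeasurable.integral_prod_right'
      (f := fun p : ℝ × ℝ => planarIntegrand |p.1| p.2) ?_)
    refine Measurable.stronglyMeasurable ?_
    unfold planarIntegrand
    fun_prop

/-- The constant in the bound of the planar density of states. -/
def planarConst : ℝ := (∫ φ in Ioo 0 π, sin φ ^ (-(2 / 3) : ℝ)) / π ^ 2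

theorem planarConst_nonneg : 0 ≤ planarConst := by
  refine div_nonneg (setIntegral_nonneg measurableSet_Ioo fun φ hφ => ?_) (by positivity)
  have := sin_pos_of_mem hφ
  positivity

theorem planarDOS_le (E : ℝ) : planarDOS E ≤ planarConst * |E| ^ (-(1 / 6) : ℝ) := by
  unfold planarDOS
  split_ifs with h
  · have h1 : ∫ φ in Ioo 0 π, planarIntegrand |E| φ ≤
        ∫ φ in Ioo 0 π, |E| ^ (-(1 / 6) : ℝ) * sin φ ^ (-(2 / 3) : ℝ) :=
      setIntegral_mono_on (integrableOn_planarIntegrand h.1)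
        ((integrableOn_sin_rpow (by norm_num) (by norm_num)).const_mul _) measurableSet_Ioo
        fun φ hφ => planarIntegrand_le h.1 hφ
    rw [integral_const_mul] at h1
    calc _ ≤ _ := div_le_div_of_nonneg_right h1 (by positivity)
      _ = _ := by unfold planarConst; ring
  · have := planarConst_nonneg
    positivity

theorem le_planarDOS {E : ℝ} (h0 : E ≠ 0) (h4 : |E| < 4) : 1 / (π * √20) ≤ planarDOS E := by
  have h0 := abs_pos.2 h0
  rw [planarDOS, if_pos ⟨h0, h4⟩, le_div_iff₀ (by positivity)]
  have h1 : ∫ φ in Ioo 0 π, (√20)⁻¹ ≤ ∫ φ in Ioo 0 π, planarIntegrand |E| φ := by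
    refine setIntegral_mono_on (by simp) (integrableOn_planarIntegrand h0) measurableSet_Ioo
      fun φ _ => ?_
    have := planarRadicand_pos h0 φ
    rw [planarIntegrand_eq]
    gcongr
    exact planarRadicand_le h0.le h4.le φ
  refine le_trans (le_of_eq ?_) h1
  simp [pi_pos.le]
  field_simp

/-- E = 0 is excluded because the elliptic integral diverges there while `planarDOS` takes the
default value 0. This single point is negligible under all later integrals. -/
theorem arcsineConv_eq {E : ℝ} (hE : E ≠ 0) :
    arcsineConv E = ENNReal.ofReal (π ^ 2 * planarDOS E) := by
  have h0 := abs_pos.2 hE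
  rcases lt_or_ge |E| 4 with h | h
  · have h1 : arcsineConv E = arcsineConv |E| := by
      rcases abs_choice E with h | h <;> rw [h]
      rw [arcsineConv_neg]
    rw [h1, arcsineConv_eq_lintegral h0 h, planarDOS, if_pos ⟨h0, h⟩,
      ← ofReal_integral_eq_lintegral_ofReal (integrableOn_planarIntegrand h0)
        (ae_of_all _ fun φ => planarIntegrand_nonneg _ _)]
    congr 1
    field_simp
  · rw [arcsineConv_eq_zero h, planarDOS_eq_zero h]; simp

theorem continuousAt_planarDOS {E : ℝ} (h0 : E ≠ 0) (h4 : |E| ≠ 4) : ContinuousAt planarDOS E := by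
  have h0' := abs_pos.2 h0
  rcases lt_or_gt_of_ne h4 with h | h
  · have h1 : ContinuousAt (fun u => (∫ φ in Ioo 0 π, planarIntegrand u φ) / π ^ 2) |E| := by
      refine ContinuousAt.div_const (continuousAt_of_dominated
        (bound := fun _ => (√(4 * (|E| / 2)))⁻¹) ?_ ?_
        (integrable_const _) ?_) _
      · filter_upwards [lt_mem_nhds h0'] with u hu
        exact (continuous_planarIntegrand hu).aestronglyMeasurable
      · filter_upwards [lt_mem_nhds (half_lt_self h0')] with u hu
        refine ae_of_all _ fun φ => ?_
        rw [Real.norm_eq_abs, abs_of_nonneg (planarIntegrand_nonneg _ _), planarIntegrand_eq]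
        gcongr
        exact (by linarith : 4 * (|E| / 2) ≤ 4 * u).trans (four_mul_le_planarRadicand u φ)
      · refine ae_of_all _ fun φ => ?_
        unfold planarIntegrand
        refine ContinuousAt.inv₀ (by fun_prop)
          (Real.sqrt_pos.2 (planarRadicand_pos h0' φ)).ne'
    have h2 : ContinuousAt (fun E => (∫ φ in Ioo 0 π, planarIntegrand |E| φ) / π ^ 2) E :=
      ContinuousAt.comp (g := fun u => (∫ φ in Ioo 0 π, planarIntegrand u φ) / π ^ 2)
        (f := fun E => |E|) h1 continuous_abs.continuousAt
    refine h2.congr ?_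
    filter_upwards [continuous_abs.continuousAt.eventually_mem (Ioo_mem_nhds h0' h)] with x hx
    exact (if_pos hx).symm
  · refine (continuousAt_const (y := (0 : ℝ))).congr ?_
    filter_upwards [continuous_abs.continuousAt.eventually_mem (Ioi_mem_nhds h)] with x hx
    exact (planarDOS_eq_zero (le_of_lt hx)).symm

/-! ### Smoothness of the planar density of states away from the singularity -/

/-- The derivative of t ↦ h(c + t) + h(c − t) is h'(c + t) − h'(c − t), at most 2Mt; a second mean
value inequality then gives the bound. -/
theorem abs_second_difference_le {h h' h'' : ℝ → ℝ} {c e M : ℝ} (he : 0 ≤ e)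
    (h1 : ∀ u ∈ Icc (c - e) (c + e), HasDerivAt h (h' u) u)
    (h2 : ∀ u ∈ Icc (c - e) (c + e), HasDerivAt h' (h'' u) u)
    (hM : ∀ u ∈ Icc (c - e) (c + e), |h'' u| ≤ M) :
    |h (c + e) + h (c - e) - 2 * h c| ≤ 2 * M * e ^ 2 := by
  have hmem : ∀ t ∈ Icc 0 e, c + t ∈ Icc (c - e) (c + e) ∧ c - t ∈ Icc (c - e) (c + e) := by
    intro t ht
    refine ⟨⟨?_, ?_⟩, ⟨?_, ?_⟩⟩ <;> linarith [ht.1, ht.2]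
  have hM0 : 0 ≤ M := (abs_nonneg _).trans (hM (c + 0) (hmem 0 ⟨le_rfl, he⟩).1)
  have hd : ∀ t ∈ Icc 0 e, HasDerivAt (fun t => h (c + t) + h (c - t)) (h' (c + t) - h' (c - t)) t := by
    intro t ht
    have a := (h1 _ (hmem t ht).1).comp_const_add c t
    have b := (h1 _ (hmem t ht).2).comp_const_sub c t
    exact (a.add b).congr_deriv (by ring)
  have hb : ∀ t ∈ Icc 0 e, ‖h' (c + t) - h' (c - t)‖ ≤ 2 * M * e := by
    intro t ht
    have := (convex_Icc (c - e) (c + e)).norm_image_sub_le_of_norm_hasDerivWithin_le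
      (fun u hu => (h2 u hu).hasDerivWithinAt) (fun u hu => hM u hu) (hmem t ht).2 (hmem t ht).1
    refine this.trans ?_
    rw [show c + t - (c - t) = 2 * t by ring, Real.norm_eq_abs, abs_of_nonneg (by linarith [ht.1])]
    nlinarith [ht.2]
  have := (convex_Icc 0 e).norm_image_sub_le_of_norm_hasDerivWithin_le
    (fun t ht => (hd t ht).hasDerivWithinAt) hb ⟨le_rfl, he⟩ ⟨he, le_rfl⟩
  rw [add_zero, sub_zero, sub_zero, Real.norm_eq_abs, Real.norm_eq_abs, abs_of_nonneg he] at this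
  rw [two_mul (h c)]
  exact this.trans_eq (by ring)

/-- The derivative of the radicand. -/
def planarRadicandDeriv (u φ : ℝ) : ℝ := 4 - (2 - u / 2) * sin φ ^ 2

theorem hasDerivAt_planarRadicand (u φ : ℝ) :
    HasDerivAt (fun u => planarRadicand u φ) (planarRadicandDeriv u φ) u := by
  have h1 := (((hasDerivAt_id u).div_const 2).const_sub 2).pow 2
  refine (((hasDerivAt_id u).const_mul 4).add (h1.mul_const (sin φ ^ 2))).congr_deriv ?_
  simp only [planarRadicandDeriv, id]
  push_cast
  ring

theorem hasDerivAt_planarRadicandDeriv (u φ : ℝ) :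
    HasDerivAt (fun u => planarRadicandDeriv u φ) (sin φ ^ 2 / 2) u := by
  have h1 := ((hasDerivAt_id u).div_const 2).const_sub 2
  exact ((h1.mul_const (sin φ ^ 2)).const_sub 4).congr_deriv (by ring)

theorem planarRadicandDeriv_mem {u : ℝ} (hu : 0 ≤ u) (hu4 : u ≤ 4) (φ : ℝ) :
    0 ≤ planarRadicandDeriv u φ ∧ planarRadicandDeriv u φ ≤ 4 := by
  have h1 := Real.sin_sq_le_one φ
  have h2 := sq_nonneg (sin φ)
  unfold planarRadicandDeriv
  constructor <;> nlinarith

theorem hasDerivAt_planarIntegrand {u : ℝ} (hu : 0 < u) (φ : ℝ) :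
    HasDerivAt (fun u => planarIntegrand u φ)
      (-(1 / 2) * planarRadicand u φ ^ (-(3 / 2) : ℝ) * planarRadicandDeriv u φ) u := by
  have hD := planarRadicand_pos hu φ
  have := (hasDerivAt_planarRadicand u φ).rpow_const (p := (-(1 / 2) : ℝ)) (.inl hD.ne')
  refine (this.congr_of_eventuallyEq ?_).congr_deriv ?_
  · filter_upwards [lt_mem_nhds hu] with v hv
    exact planarIntegrand_eq_rpow hv φ
  · norm_num
    ring

theorem hasDerivAt_planarIntegrand_deriv {u : ℝ} (hu : 0 < u) (φ : ℝ) :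
    HasDerivAt (fun u => -(1 / 2) * planarRadicand u φ ^ (-(3 / 2) : ℝ) * planarRadicandDeriv u φ)
      (3 / 4 * planarRadicand u φ ^ (-(5 / 2) : ℝ) * planarRadicandDeriv u φ ^ 2 -
        1 / 4 * planarRadicand u φ ^ (-(3 / 2) : ℝ) * sin φ ^ 2) u := by
  have hD := planarRadicand_pos hu φ
  have := (((hasDerivAt_planarRadicand u φ).rpow_const (p := (-(3 / 2) : ℝ)) (.inl hD.ne')).const_mul
    (-(1 / 2))).mul (hasDerivAt_planarRadicandDeriv u φ)
  refine this.congr_deriv ?_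
  norm_num
  ring

theorem planarRadicand_rpow_le {u : ℝ} (hu : 0 < u) (φ : ℝ) {p : ℝ} (hp : 0 ≤ p) :
    planarRadicand u φ ^ (-p) ≤ 4 ^ (-p) * u ^ (-p) := by
  rw [← Real.mul_rpow (by norm_num) hu.le]
  exact Real.rpow_le_rpow_of_nonpos (by positivity) (four_mul_le_planarRadicand u φ) (by linarith)

theorem abs_planarIntegrand_deriv_le {u : ℝ} (hu : 0 < u) (hu4 : u ≤ 4) (φ : ℝ) :
    |-(1 / 2) * planarRadicand u φ ^ (-(3 / 2) : ℝ) * planarRadicandDeriv u φ| ≤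
      u ^ (-(3 / 2) : ℝ) := by
  have hD := planarRadicand_pos hu φ
  obtain ⟨h1, h2⟩ := planarRadicandDeriv_mem hu.le hu4 φ
  have h3 := planarRadicand_rpow_le hu φ (p := 3 / 2) (by norm_num)
  have h4 : (4 : ℝ) ^ (-(3 / 2) : ℝ) = 1 / 8 := by
    rw [show (4 : ℝ) = 2 ^ (2 : ℝ) by norm_num, ← Real.rpow_mul (by norm_num)]
    norm_num [Real.rpow_neg]
  rw [h4] at h3
  have h5 : 0 ≤ planarRadicand u φ ^ (-(3 / 2) : ℝ) := by positivity
  have h6 : 0 ≤ u ^ (-(3 / 2) : ℝ) := by positivity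
  rw [abs_mul, abs_mul, abs_of_nonneg h5, abs_of_nonneg h1]
  norm_num
  nlinarith

theorem abs_planarIntegrand_deriv2_le {u : ℝ} (hu : 0 < u) (hu4 : u ≤ 4) (φ : ℝ) :
    |3 / 4 * planarRadicand u φ ^ (-(5 / 2) : ℝ) * planarRadicandDeriv u φ ^ 2 -
        1 / 4 * planarRadicand u φ ^ (-(3 / 2) : ℝ) * sin φ ^ 2| ≤ u ^ (-(5 / 2) : ℝ) := by
  have hD := planarRadicand_pos hu φ
  have hD20 := planarRadicand_le hu.le hu4 φ
  obtain ⟨h1, h2⟩ := planarRadicandDeriv_mem hu.le hu4 φ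
  have h3 := planarRadicand_rpow_le hu φ (p := 5 / 2) (by norm_num)
  have h4 : (4 : ℝ) ^ (-(5 / 2) : ℝ) = 1 / 32 := by
    rw [show (4 : ℝ) = 2 ^ (2 : ℝ) by norm_num, ← Real.rpow_mul (by norm_num)]
    norm_num [Real.rpow_neg]
  rw [h4] at h3
  have e : planarRadicand u φ ^ (-(3 / 2) : ℝ) =
      planarRadicand u φ ^ (-(5 / 2) : ℝ) * planarRadicand u φ := by
    rw [← Real.rpow_add_one hD.ne']; norm_num
  rw [e]
  have h5 : 0 ≤ planarRadicand u φ ^ (-(5 / 2) : ℝ) := by positivity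
  have hs1 := Real.sin_sq_le_one φ
  have hs0 := sq_nonneg (sin φ)
  set Q := planarRadicand u φ ^ (-(5 / 2) : ℝ)
  set D := planarRadicand u φ
  set D' := planarRadicandDeriv u φ
  have a1 : D' ^ 2 ≤ 16 := by nlinarith
  have a2 : D * sin φ ^ 2 ≤ 20 := by nlinarith
  have a3 : 0 ≤ D * sin φ ^ 2 := by positivity
  have e2 : 3 / 4 * Q * D' ^ 2 - 1 / 4 * (Q * D) * sin φ ^ 2 =
    Q * (3 / 4 * D' ^ 2 - 1 / 4 * (D * sin φ ^ 2)) := by ring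
  rw [e2, abs_mul, abs_of_nonneg h5]
  have a4 : |3 / 4 * D' ^ 2 - 1 / 4 * (D * sin φ ^ 2)| ≤ 32 := by
    rw [abs_le]; constructor <;> nlinarith [sq_nonneg D']
  calc _ ≤ Q * 32 := by gcongr
    _ ≤ (1 / 32 * u ^ (-(5 / 2) : ℝ)) * 32 := by gcongr
    _ = _ := by ring

theorem abs_setIntegral_Ioo_pi_le {f : ℝ → ℝ} {M : ℝ} (h : ∀ φ ∈ Ioo 0 π, |f φ| ≤ M) :
    |(∫ φ in Ioo 0 π, f φ) / π ^ 2| ≤ M := by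
  have hM : 0 ≤ M := (abs_nonneg _).trans (h 1 ⟨one_pos, by linarith [pi_gt_three]⟩)
  have h1 := norm_setIntegral_le_of_norm_le_const (μ := volume) (s := Ioo 0 π) (f := f) (C := M)
    (by simp) h
  simp only [Real.norm_eq_abs, Real.volume_real_Ioo_of_le pi_pos.le, sub_zero] at h1
  rw [abs_div, abs_of_pos (pow_pos pi_pos 2), div_le_iff₀ (by positivity)]
  refine h1.trans ?_
  have := pi_gt_three
  gcongr
  nlinarith

theorem abs_planarDOS_sub_le {a u v : ℝ} (ha : 0 < a) (hu : a ≤ u) (hv : a ≤ v) (hu4 : u < 4)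
    (hv4 : v < 4) : |planarDOS u - planarDOS v| ≤ a ^ (-(3 / 2) : ℝ) * |u - v| := by
  have hu0 := ha.trans_le hu
  have hv0 := ha.trans_le hv
  rw [planarDOS_of_pos hu0 hu4, planarDOS_of_pos hv0 hv4, ← sub_div,
    ← integral_sub (integrableOn_planarIntegrand hu0) (integrableOn_planarIntegrand hv0)]
  refine abs_setIntegral_Ioo_pi_le fun φ _ => ?_
  have hsub : Ico a 4 ⊆ Ioo 0 4 := fun x hx => ⟨ha.trans_le hx.1, hx.2⟩
  refine (convex_Ico a 4).norm_image_sub_le_of_norm_hasDerivWithin_le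
    (fun x hx => (hasDerivAt_planarIntegrand (hsub hx).1 φ).hasDerivWithinAt) (fun x hx => ?_)
    ⟨hv, hv4⟩ ⟨hu, hu4⟩
  refine (abs_planarIntegrand_deriv_le (hsub hx).1 hx.2.le φ).trans ?_
  exact Real.rpow_le_rpow_of_nonpos ha hx.1 (by norm_num)

/-- As e ≤ c/2, energies stay above c/2, where the second derivative of the integrand is at most
(c/2)^{−5/2} ≤ 6c^{−5/2}, because 2^{5/2} = √32 ≤ 6. The second difference doubles this, and the
factor π/π² from the angular integral is below 1. -/
theorem abs_planarDOS_second_difference_le {c e : ℝ} (he : 0 ≤ e) (hec : e ≤ c / 2) (hc : 0 < c)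
    (h4 : c + e < 4) :
    |planarDOS (c + e) + planarDOS (c - e) - 2 * planarDOS c| ≤
      12 * c ^ (-(5 / 2) : ℝ) * e ^ 2 := by
  have h1 : 0 < c - e := by linarith
  have h2 : 0 < c + e := by linarith
  have i1 := integrableOn_planarIntegrand h1
  have i2 := integrableOn_planarIntegrand h2
  have i3 := (integrableOn_planarIntegrand hc).const_mul 2
  rw [planarDOS_of_pos h1 (by linarith), planarDOS_of_pos h2 h4, planarDOS_of_pos hc (by linarith),
    ← add_div, mul_div_assoc', ← sub_div, ← integral_const_mul, ← integral_add i2 i1,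
    ← integral_sub (f := fun φ => planarIntegrand (c + e) φ + planarIntegrand (c - e) φ)
      (i2.add i1) i3]
  refine abs_setIntegral_Ioo_pi_le fun φ _ => ?_
  have hmem : ∀ u ∈ Icc (c - e) (c + e), 0 < u ∧ u ≤ 4 ∧ c / 2 ≤ u := fun u hu =>
    ⟨by linarith [hu.1], by linarith [hu.2], by linarith [hu.1]⟩
  have key := abs_second_difference_le he
    (fun u hu => hasDerivAt_planarIntegrand (hmem u hu).1 φ)
    (fun u hu => hasDerivAt_planarIntegrand_deriv (hmem u hu).1 φ)
    (M := 6 * c ^ (-(5 / 2) : ℝ)) fun u hu => by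
      refine (abs_planarIntegrand_deriv2_le (hmem u hu).1 (hmem u hu).2.1 φ).trans ?_
      refine (Real.rpow_le_rpow_of_nonpos (by positivity) (hmem u hu).2.2 (by norm_num)).trans ?_
      rw [Real.div_rpow hc.le (by norm_num), Real.rpow_neg (by norm_num : (0 : ℝ) ≤ 2),
        div_inv_eq_mul, mul_comm]
      gcongr
      have e1 : (2 : ℝ) ^ (5 / 2 : ℝ) = √32 := by
        rw [Real.sqrt_eq_rpow, show (32 : ℝ) = 2 ^ (5 : ℝ) by norm_num,
          ← Real.rpow_mul (by norm_num)]
        norm_num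
      rw [e1, Real.sqrt_le_left (by norm_num)]
      norm_num
  refine key.trans_eq (by ring)

end

end HubbardAF

namespace HubbardAF

open Real Set Filter Topology MeasureTheory
open scoped ENNReal

noncomputable section

/-! ### The density of states of the layered lattice -/

theorem integrableOn_abs_rpow {p : ℝ} (hp : -1 < p) :
    IntegrableOn (fun x : ℝ => |x| ^ p) (Ioo (-1) 1) := by
  have h1 : IntervalIntegrable (fun x : ℝ => |x| ^ p) volume 0 1 := by
    refine (intervalIntegral.intervalIntegrable_rpow' hp).congr fun x hx => ?_
    rw [uIoc_of_le zero_le_one] at hx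
    simp only [abs_of_pos hx.1]
  have h2 : IntervalIntegrable (fun x : ℝ => |x| ^ p) volume (-1) 0 := by
    have := (h1.comp_sub_left 0).symm
    simpa using this
  exact (intervalIntegrable_iff_integrableOn_Ioo_of_le (by norm_num)).1 (h2.trans h1)

/-- The integral of `|x| ^ (-3/4)` near its singularity. -/
def absRpowConst : ℝ := ∫ x in Ioo (-1 : ℝ) 1, |x| ^ (-(3 / 4) : ℝ)

theorem abs_rpow_le_indicator_add_one (x : ℝ) :
    |x| ^ (-(3 / 4) : ℝ) ≤ (Ioo (-1 : ℝ) 1).indicator (fun x => |x| ^ (-(3 / 4) : ℝ)) x + 1 := by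
  by_cases hx : x ∈ Ioo (-1 : ℝ) 1
  · rw [indicator_of_mem hx]; linarith
  · rw [indicator_of_notMem hx, zero_add]
    refine Real.rpow_le_one_of_one_le_of_nonpos ?_ (by norm_num)
    by_contra! h
    exact hx (abs_lt.1 h)

theorem integrableOn_abs_rpow_Ioo (E b : ℝ) :
    IntegrableOn (fun x : ℝ => |x| ^ (-(3 / 4) : ℝ)) (Ioo (E - b) (E + b)) := by
  have h0 : Integrable ((Ioo (-1 : ℝ) 1).indicator fun x => |x| ^ (-(3 / 4) : ℝ)) :=
    (integrable_indicator_iff measurableSet_Ioo).2 (integrableOn_abs_rpow (by norm_num))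
  refine (h0.integrableOn.add (integrable_const (1 : ℝ))).mono'
    (Measurable.aestronglyMeasurable (by fun_prop)) (ae_of_all _ fun x => ?_)
  rw [Real.norm_eq_abs, abs_of_nonneg (by positivity)]
  exact abs_rpow_le_indicator_add_one x

theorem integral_abs_rpow_Ioo_le (E : ℝ) {b : ℝ} (hb : 0 < b) :
    ∫ x in Ioo (E - b) (E + b), |x| ^ (-(3 / 4) : ℝ) ≤ absRpowConst + 2 * b := by
  have h0 : Integrable ((Ioo (-1 : ℝ) 1).indicator fun x => |x| ^ (-(3 / 4) : ℝ)) :=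
    (integrable_indicator_iff measurableSet_Ioo).2 (integrableOn_abs_rpow (by norm_num))
  calc _ ≤ ∫ x in Ioo (E - b) (E + b),
        ((Ioo (-1 : ℝ) 1).indicator (fun x => |x| ^ (-(3 / 4) : ℝ)) x + 1) :=
        setIntegral_mono (integrableOn_abs_rpow_Ioo E b)
          (h0.integrableOn.add (integrable_const (1 : ℝ))) abs_rpow_le_indicator_add_one
    _ = (∫ x in Ioo (E - b) (E + b),
        (Ioo (-1 : ℝ) 1).indicator (fun x => |x| ^ (-(3 / 4) : ℝ)) x) + 2 * b := by
      rw [integral_add h0.integrableOn (integrable_const (1 : ℝ))]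
      congr 1
      rw [setIntegral_const, Real.volume_real_Ioo_of_le (by linarith), smul_eq_mul]
      ring
    _ ≤ _ := by
      gcongr
      rw [absRpowConst, ← integral_indicator (measurableSet_Ioo : MeasurableSet (Ioo (-1 : ℝ) 1))]
      refine setIntegral_le_integral h0 (ae_of_all _ fun x => ?_)
      exact indicator_nonneg (fun x _ => by positivity) x

/-- Either √t ≤ s and t^{−1/4} = t^{−3/4}√t, or √t ≥ s and t^{−1/4} = (√t)^{−1/2}. With t = |E + b
cos k| and s = sin k, the first term carries the Jacobian needed to integrate in energy and the
second is integrable in k; both bounds are uniform in E. -/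
theorem rpow_neg_quarter_le {t s : ℝ} (ht : 0 ≤ t) (hs : 0 < s) :
    t ^ (-(1 / 4) : ℝ) ≤ t ^ (-(3 / 4) : ℝ) * s + s ^ (-(1 / 2) : ℝ) := by
  rcases ht.eq_or_lt with rfl | ht
  · rw [Real.zero_rpow (by norm_num)]; positivity
  rcases le_total (t ^ (1 / 2 : ℝ)) s with h | h
  · have h1 : t ^ (-(1 / 4) : ℝ) = t ^ (-(3 / 4) : ℝ) * t ^ (1 / 2 : ℝ) := by
      rw [← Real.rpow_add ht]; norm_num
    have h2 : t ^ (-(3 / 4) : ℝ) * t ^ (1 / 2 : ℝ) ≤ t ^ (-(3 / 4) : ℝ) * s := by gcongr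
    have h3 : 0 ≤ s ^ (-(1 / 2) : ℝ) := by positivity
    linarith
  · have h1 : (t ^ (1 / 2 : ℝ)) ^ (-(1 / 2) : ℝ) ≤ s ^ (-(1 / 2) : ℝ) :=
      Real.rpow_le_rpow_of_nonpos hs h (by norm_num)
    rw [← Real.rpow_mul ht.le] at h1
    norm_num at h1 ⊢
    have h3 : 0 ≤ t ^ (-(3 / 4) : ℝ) * s := by positivity
    linarith

/-- The constant bounding `∫ |E + b cos k| ^ (-1/4)`. -/
def cosRpowConst (b : ℝ) : ℝ :=
  (absRpowConst + 2 * b) / b + ∫ k in Ioo 0 π, sin k ^ (-(1 / 2) : ℝ)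

theorem absRpowConst_nonneg : 0 ≤ absRpowConst := by
  unfold absRpowConst
  exact integral_nonneg fun x => by positivity

theorem cosRpowConst_anti {a b : ℝ} (ha : 0 < a) (hab : a ≤ b) :
    cosRpowConst b ≤ cosRpowConst a := by
  have hb := ha.trans_le hab
  unfold cosRpowConst
  rw [add_div, add_div, mul_div_cancel_right₀ _ ha.ne', mul_div_cancel_right₀ _ hb.ne']
  have := absRpowConst_nonneg
  gcongr

theorem integrableOn_and_integral_abs_cos_rpow_le (E : ℝ) {b : ℝ} (hb : 0 < b) :
    IntegrableOn (fun k => |E + b * cos k| ^ (-(1 / 4) : ℝ)) (Ioo 0 π) ∧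
      ∫ k in Ioo 0 π, |E + b * cos k| ^ (-(1 / 4) : ℝ) ≤ cosRpowConst b := by
  have h1 := (integrableOn_comp_add_mul_cos E hb (integrableOn_abs_rpow_Ioo E b)).div_const b
  have h2 := integrableOn_sin_rpow (p := 1 / 2) (by norm_num) (by norm_num)
  have hle : ∀ k ∈ Ioo 0 π, |E + b * cos k| ^ (-(1 / 4) : ℝ) ≤
      b * sin k * |E + b * cos k| ^ (-(3 / 4) : ℝ) / b + sin k ^ (-(1 / 2) : ℝ) := by
    intro k hk
    refine (rpow_neg_quarter_le (abs_nonneg _) (sin_pos_of_mem hk)).trans_eq ?_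
    field_simp
  have hi : IntegrableOn (fun k => |E + b * cos k| ^ (-(1 / 4) : ℝ)) (Ioo 0 π) := by
    refine (h1.add h2).mono' (Measurable.aestronglyMeasurable (by fun_prop))
      ((ae_restrict_iff' measurableSet_Ioo).2 (ae_of_all _ fun k hk => ?_))
    rw [Real.norm_eq_abs, abs_of_nonneg (by positivity)]
    exact hle k hk
  refine ⟨hi, (setIntegral_mono_on hi (h1.add h2) measurableSet_Ioo hle).trans ?_⟩
  rw [integral_add' h1 h2, integral_div, integral_comp_add_mul_cos E hb fun x => |x| ^ (-(3 / 4) : ℝ),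
    cosRpowConst]
  have := integral_abs_rpow_Ioo_le E hb
  gcongr

theorem planarDOS_le_quarter (x : ℝ) :
    planarDOS x ≤ planarConst * (1 + |x| ^ (-(1 / 4) : ℝ)) := by
  refine (planarDOS_le x).trans (mul_le_mul_of_nonneg_left ?_ planarConst_nonneg)
  have h0 : 0 ≤ |x| ^ (-(1 / 4) : ℝ) := by positivity
  rcases (abs_nonneg x).eq_or_lt with h | h
  · rw [← h, Real.zero_rpow (by norm_num), Real.zero_rpow (by norm_num)]; norm_num
  rcases le_total |x| 1 with h1 | h1
  · have := Real.rpow_le_rpow_of_exponent_ge h h1 (by norm_num : (-(1 / 4) : ℝ) ≤ -(1 / 6))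
    linarith
  · have := Real.rpow_le_one_of_one_le_of_nonpos h1 (by norm_num : (-(1 / 6) : ℝ) ≤ 0)
    linarith

theorem measurable_planarDOS_comp (E b : ℝ) : Measurable fun k => planarDOS (E + b * cos k) :=
  measurable_planarDOS.comp (by fun_prop)

theorem integrableOn_planarDOS_comp (E : ℝ) {b : ℝ} (hb : 0 < b) :
    IntegrableOn (fun k => planarDOS (E + b * cos k)) (Ioo 0 π) := by
  have h1 := (integrableOn_and_integral_abs_cos_rpow_le E hb).1
  refine (((integrable_const (1 : ℝ)).add h1).const_mul planarConst).mono'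
    (measurable_planarDOS_comp E b).aestronglyMeasurable (ae_of_all _ fun k => ?_)
  rw [Real.norm_eq_abs, abs_of_nonneg (planarDOS_nonneg _)]
  exact planarDOS_le_quarter _

/-- The density of states of the layered lattice with bandwidth parameter `b = 2 t_z`. -/
def layeredDOS (b E : ℝ) : ℝ := (∫ k in Ioo 0 π, planarDOS (E + b * cos k)) / π

theorem layeredDOS_nonneg (b E : ℝ) : 0 ≤ layeredDOS b E :=
  div_nonneg (integral_nonneg fun _ => planarDOS_nonneg _) pi_pos.le

theorem layeredDOS_le (E : ℝ) {b : ℝ} (hb : 0 < b) :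
    layeredDOS b E ≤ planarConst * (π + cosRpowConst b) / π := by
  obtain ⟨h1, h2⟩ := integrableOn_and_integral_abs_cos_rpow_le E hb
  unfold layeredDOS
  have hc := planarConst_nonneg
  gcongr
  calc _ ≤ ∫ k in Ioo 0 π, planarConst * (1 + |E + b * cos k| ^ (-(1 / 4) : ℝ)) :=
        setIntegral_mono (integrableOn_planarDOS_comp E hb)
          (((integrable_const (1 : ℝ)).add h1).const_mul planarConst)
          fun k => planarDOS_le_quarter _
    _ = planarConst * (π + ∫ k in Ioo 0 π, |E + b * cos k| ^ (-(1 / 4) : ℝ)) := by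
      rw [integral_const_mul, integral_add (integrable_const (1 : ℝ)) h1]
      simp [pi_pos.le]
    _ ≤ _ := by gcongr

theorem layeredDOS_neg (b E : ℝ) : layeredDOS b (-E) = layeredDOS b E := by
  unfold layeredDOS
  congr 1
  rw [← integral_comp_neg_cos fun t => planarDOS (E + b * t)]
  refine integral_congr_ae (ae_of_all _ fun k => ?_)
  simp only
  rw [← planarDOS_neg]
  congr 1; ring

theorem layeredDOS_abs (b E : ℝ) : layeredDOS b |E| = layeredDOS b E := by
  rcases abs_choice E with h | h <;> rw [h]
  rw [layeredDOS_neg]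

theorem layeredDOS_eq_zero {b E : ℝ} (hb : 0 ≤ b) (hE : 4 + b ≤ |E|) : layeredDOS b E = 0 := by
  unfold layeredDOS
  have : ∀ k, planarDOS (E + b * cos k) = 0 := fun k => by
    refine planarDOS_eq_zero ?_
    have h1 : |b * cos k| ≤ b := by
      rw [abs_mul, abs_of_nonneg hb]
      exact mul_le_of_le_one_right hb (Real.abs_cos_le_one k)
    have h2 := abs_sub_abs_le_abs_sub E (-(b * cos k))
    rw [abs_neg, sub_neg_eq_add] at h2
    linarith
  simp [this]

theorem ae_add_mul_cos_ne (E : ℝ) {b : ℝ} (hb : 0 < b) (v : ℝ) :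
    ∀ᵐ k ∂volume.restrict (Ioo 0 π), E + b * cos k ≠ v := by
  rw [ae_restrict_iff' measurableSet_Ioo, ae_iff]
  refine Set.Subsingleton.measure_zero (fun k hk k' hk' => ?_) _
  simp only [ne_eq, Classical.not_imp, not_not, mem_ofPred_eq] at hk hk'
  exact injOn_add_mul_cos E hb hk.1 hk'.1 (hk.2.trans hk'.2.symm)

theorem le_layeredDOS_zero {b : ℝ} (hb : 0 < b) (hb4 : b < 4) :
    1 / (π * √20) ≤ layeredDOS b 0 := by
  unfold layeredDOS
  rw [le_div_iff₀ pi_pos]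
  calc 1 / (π * √20) * π = ∫ k in Ioo 0 π, 1 / (π * √20) := by
        simp [pi_pos.le]; field_simp
    _ ≤ _ := by
      refine setIntegral_mono_ae_restrict (integrable_const _)
        (integrableOn_planarDOS_comp 0 hb) ?_
      filter_upwards [ae_add_mul_cos_ne 0 hb 0] with k hk
      refine le_planarDOS hk ?_
      rw [zero_add, abs_mul, abs_of_pos hb]
      exact (mul_le_of_le_one_right hb.le (Real.abs_cos_le_one k)).trans_lt hb4

/-! ### Continuity -/

/-- The density of states with the planar density of states truncated at height `n`. -/
def truncatedDOS (b : ℝ) (n : ℕ) (E : ℝ) : ℝ :=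
  (∫ k in Ioo 0 π, min (planarDOS (E + b * cos k)) n) / π

theorem continuous_truncatedDOS {b : ℝ} (hb : 0 < b) (n : ℕ) : Continuous (truncatedDOS b n) := by
  rw [continuous_iff_continuousAt]
  intro E
  refine ContinuousAt.div_const (continuousAt_of_dominated (bound := fun _ => (n : ℝ))
    (Eventually.of_forall fun E' =>
      ((measurable_planarDOS_comp E' b).min measurable_const).aestronglyMeasurable)
    (Eventually.of_forall fun E' => ae_of_all _ fun k => ?_) (integrable_const _) ?_) _
  · rw [Real.norm_eq_abs, abs_of_nonneg (le_min (planarDOS_nonneg _) (Nat.cast_nonneg n))]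
    exact min_le_right _ _
  · filter_upwards [ae_add_mul_cos_ne E hb 0, ae_add_mul_cos_ne E hb 4,
      ae_add_mul_cos_ne E hb (-4)] with k h0 h1 h2
    have h4 : |E + b * cos k| ≠ 4 := fun h => by
      rcases (abs_eq (by norm_num : (0 : ℝ) ≤ 4)).1 h with h | h
      · exact h1 h
      · exact h2 h
    have hc : ContinuousAt (fun E => planarDOS (E + b * cos k)) E :=
      ContinuousAt.comp (g := planarDOS) (f := fun E => E + b * cos k)
        (continuousAt_planarDOS h0 h4) (by fun_prop)
    exact hc.min continuousAt_const

/-- Where the truncation acts, P ≥ n, so P = P^{3/2}P^{−1/2} ≤ P^{3/2}n^{−1/2}, and P^{3/2} has a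
singularity of order (1/6)(3/2) = 1/4. -/
theorem planarDOS_sub_min_le (x : ℝ) {n : ℕ} (hn : 0 < n) :
    planarDOS x - min (planarDOS x) n ≤
      planarConst ^ (3 / 2 : ℝ) * |x| ^ (-(1 / 4) : ℝ) * (n : ℝ) ^ (-(1 / 2) : ℝ) := by
  have hn' : (0 : ℝ) < n := by exact_mod_cast hn
  have hc := planarConst_nonneg
  rcases le_total (planarDOS x) n with h | h
  · rw [min_eq_left h, sub_self]; positivity
  · have hP : 0 < planarDOS x := hn'.trans_le h
    rw [min_eq_right h]
    have h1 : planarDOS x ^ (3 / 2 : ℝ) ≤ planarConst ^ (3 / 2 : ℝ) * |x| ^ (-(1 / 4) : ℝ) := by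
      refine (Real.rpow_le_rpow hP.le (planarDOS_le x) (by norm_num)).trans_eq ?_
      rw [Real.mul_rpow hc (by positivity), ← Real.rpow_mul (abs_nonneg x)]
      norm_num
    calc planarDOS x - n ≤ planarDOS x := by linarith
      _ = planarDOS x ^ (3 / 2 : ℝ) * planarDOS x ^ (-(1 / 2) : ℝ) := by
        rw [← Real.rpow_add hP]; norm_num
      _ ≤ _ := by
        have := Real.rpow_le_rpow_of_nonpos hn' h (by norm_num : (-(1 / 2) : ℝ) ≤ 0)
        gcongr

theorem abs_layeredDOS_sub_truncatedDOS_le {b : ℝ} (hb : 0 < b) (E : ℝ) {n : ℕ} (hn : 0 < n) :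
    |layeredDOS b E - truncatedDOS b n E| ≤
      planarConst ^ (3 / 2 : ℝ) * cosRpowConst b / π * (n : ℝ) ^ (-(1 / 2) : ℝ) := by
  obtain ⟨h1, h2⟩ := integrableOn_and_integral_abs_cos_rpow_le E hb
  have hi := integrableOn_planarDOS_comp E hb
  have him : IntegrableOn (fun k => min (planarDOS (E + b * cos k)) n) (Ioo 0 π) :=
    hi.inf (integrable_const (n : ℝ))
  have hc := planarConst_nonneg
  rw [layeredDOS, truncatedDOS, ← sub_div, ← integral_sub hi him, abs_of_nonneg
    (div_nonneg (integral_nonneg fun k => sub_nonneg.2 (min_le_left _ _)) pi_pos.le),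
    div_mul_eq_mul_div]
  gcongr
  calc _ ≤ ∫ k in Ioo 0 π, planarConst ^ (3 / 2 : ℝ) * |E + b * cos k| ^ (-(1 / 4) : ℝ) *
          (n : ℝ) ^ (-(1 / 2) : ℝ) :=
        setIntegral_mono (hi.sub him) ((h1.const_mul _).mul_const _)
          fun k => planarDOS_sub_min_le _ hn
    _ = planarConst ^ (3 / 2 : ℝ) * (∫ k in Ioo 0 π, |E + b * cos k| ^ (-(1 / 4) : ℝ)) *
          (n : ℝ) ^ (-(1 / 2) : ℝ) := by rw [integral_mul_const, integral_const_mul]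
    _ ≤ _ := by gcongr

/-- The truncated densities are continuous by dominated convergence and converge uniformly, since
the bound on the integral of |E + b cos k|^{−1/4} does not involve E. -/
theorem continuous_layeredDOS {b : ℝ} (hb : 0 < b) : Continuous (layeredDOS b) := by
  have hlim : Tendsto (fun n : ℕ => planarConst ^ (3 / 2 : ℝ) * cosRpowConst b / π *
      (n : ℝ) ^ (-(1 / 2) : ℝ)) atTop (𝓝 0) := by
    have := ((tendsto_rpow_neg_atTop (by norm_num : (0 : ℝ) < 1 / 2)).comp
      tendsto_natCast_atTop_atTop).const_mul (planarConst ^ (3 / 2 : ℝ) * cosRpowConst b / π)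
    rwa [mul_zero] at this
  refine TendstoUniformly.continuous (F := truncatedDOS b) (p := atTop) ?_
    (Frequently.of_forall fun n => continuous_truncatedDOS hb n)
  rw [Metric.tendstoUniformly_iff]
  intro ε hε
  filter_upwards [hlim.eventually (gt_mem_nhds hε), eventually_gt_atTop 0] with n hn hn0 E
  exact (abs_layeredDOS_sub_truncatedDOS_le hb E hn0).trans_lt hn

/-! ### Quadratic behaviour at the centre of the band -/

theorem integrable_planarDOS : Integrable planarDOS := by
  have h1 := lintegral_comp_two_cos (g := fun _ => 1) measurable_const
  have h2 : ∫⁻ E, ENNReal.ofReal (π ^ 2 * planarDOS E) = ∫⁻ E, arcsineConv E * 1 := by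
    refine lintegral_congr_ae ?_
    filter_upwards [compl_mem_ae_iff.2 (measure_singleton (0 : ℝ))] with E hE
    rw [mul_one, arcsineConv_eq hE]
  rw [← h1] at h2
  have h3 : Integrable fun E => π ^ 2 * planarDOS E := by
    refine ⟨(measurable_planarDOS.const_mul _).aestronglyMeasurable, ?_⟩
    rw [hasFiniteIntegral_iff_ofReal (ae_of_all _ fun E =>
      mul_nonneg (by positivity) (planarDOS_nonneg E)), h2]
    simp [ENNReal.mul_lt_top]
  have := h3.const_mul (π ^ 2)⁻¹
  refine this.congr (ae_of_all _ fun E => ?_)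
  field_simp

/-- The symmetric second difference of the planar density of states. -/
def planarSecondDiff (e c : ℝ) : ℝ := planarDOS (c + e) + planarDOS (c - e) - 2 * planarDOS c

theorem planarSecondDiff_abs (e c : ℝ) : planarSecondDiff e |c| = planarSecondDiff e c := by
  rcases abs_choice c with h | h <;> rw [h]
  unfold planarSecondDiff
  rw [show -c + e = -(c - e) by ring, show -c - e = -(c + e) by ring, planarDOS_neg, planarDOS_neg,
    planarDOS_neg]
  ring

/-- After shifting the intervals of integration and using evenness, everything cancels except strips
next to ±b. The singularity at 0 drops out. -/
theorem integral_planarSecondDiff {b e : ℝ} (hb : 0 < b) :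
    ∫ x in Ioo (0 - b) (0 + b), planarSecondDiff e x =
      2 * ∫ v in (0 : ℝ)..e, (planarDOS (b + v) - planarDOS (b - v)) := by
  have hP := integrable_planarDOS
  have hii : ∀ u v, IntervalIntegrable planarDOS volume u v := fun u v => hP.intervalIntegrable
  have hia : ∀ u v c, IntervalIntegrable (fun x => planarDOS (x + c)) volume u v := fun u v c =>
    (hP.comp_add_right c).intervalIntegrable
  have his : ∀ u v c, IntervalIntegrable (fun x => planarDOS (x - c)) volume u v := fun u v c =>
    (hP.comp_sub_right c).intervalIntegrable
  have hla : ∀ u v c, IntervalIntegrable (fun x => planarDOS (c + x)) volume u v := fun u v c =>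
    (hP.comp_add_left c).intervalIntegrable
  have hls : ∀ u v c, IntervalIntegrable (fun x => planarDOS (c - x)) volume u v := fun u v c =>
    (hP.comp_sub_left c).intervalIntegrable
  have heven : ∀ u v, ∫ x in u..v, planarDOS x = ∫ x in (-v)..(-u), planarDOS x := fun u v => by
    rw [← intervalIntegral.integral_comp_neg]
    simp_rw [planarDOS_neg]
  rw [← integral_Ioc_eq_integral_Ioo, ← intervalIntegral.integral_of_le (by linarith)]
  unfold planarSecondDiff
  rw [intervalIntegral.integral_sub ((hia _ _ _).add (his _ _ _)) ((hii _ _).const_mul 2),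
    intervalIntegral.integral_add (hia _ _ _) (his _ _ _), intervalIntegral.integral_const_mul,
    intervalIntegral.integral_comp_add_right, intervalIntegral.integral_comp_sub_right,
    intervalIntegral.integral_sub (hla _ _ _) (hls _ _ _),
    intervalIntegral.integral_comp_add_left, intervalIntegral.integral_comp_sub_left]
  have e1 := intervalIntegral.integral_add_adjacent_intervals (hii (-b) (-b + e)) (hii (-b + e) (b + e))
  have e2 := intervalIntegral.integral_add_adjacent_intervals (hii (-b) b) (hii b (b + e))
  have e3 := intervalIntegral.integral_add_adjacent_intervals (hii (-b - e) (-b)) (hii (-b) (b - e))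
  have e4 := intervalIntegral.integral_add_adjacent_intervals (hii (-b) (b - e)) (hii (b - e) b)
  have e5 := heven (-b) (-b + e)
  have e6 := heven (-b - e) (-b)
  rw [show -(-b + e) = b - e by ring, neg_neg] at e5
  rw [show -(-b - e) = b + e by ring, neg_neg] at e6
  simp only [zero_sub, zero_add, add_zero, sub_zero]
  linarith

theorem abs_integral_planarSecondDiff_le {a b e : ℝ} (ha : 0 < a) (he : 0 ≤ e) (h1 : a ≤ b - e)
    (h2 : b + e < 4) :
    |∫ x in Ioo (0 - b) (0 + b), planarSecondDiff e x| ≤ 4 * a ^ (-(3 / 2) : ℝ) * e ^ 2 := by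
  rw [integral_planarSecondDiff (by linarith : 0 < b), abs_mul, abs_two]
  have := intervalIntegral.norm_integral_le_of_norm_le_const (a := 0) (b := e)
    (f := fun v => planarDOS (b + v) - planarDOS (b - v))
    (C := a ^ (-(3 / 2) : ℝ) * (2 * e)) fun v hv => by
      rw [uIoc_of_le he] at hv
      have := abs_planarDOS_sub_le ha (u := b + v) (v := b - v) (by linarith [hv.1])
        (by linarith [hv.2]) (by linarith [hv.2]) (by linarith [hv.1])
      refine this.trans ?_
      rw [show b + v - (b - v) = 2 * v by ring, abs_of_pos (by linarith [hv.1])]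
      have := hv.2
      gcongr
  rw [sub_zero, abs_of_nonneg he, Real.norm_eq_abs] at this
  linarith

/-- For e ≤ |c|/2 the smooth bound |c|^{−5/2}e² times c² leaves the integrable |c|^{−1/2}. Otherwise
c² ≤ 4e², and no cancellation in the second difference is needed. -/
theorem abs_planarSecondDiff_mul_sq_le {c e : ℝ} (he : 0 ≤ e) (hc : c ≠ 0) (h4 : |c| + e < 4) :
    |planarSecondDiff e c| * c ^ 2 ≤ e ^ 2 * (12 * (1 + |c| ^ (-(3 / 4) : ℝ)) +
      4 * (planarDOS (c + e) + planarDOS (c - e) + 2 * planarDOS c)) := by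
  have hc0 := abs_pos.2 hc
  have p1 := planarDOS_nonneg (c + e)
  have p2 := planarDOS_nonneg (c - e)
  have p3 := planarDOS_nonneg c
  rcases le_or_gt e (|c| / 2) with h | h
  · have h1 : |planarSecondDiff e c| ≤ 12 * |c| ^ (-(5 / 2) : ℝ) * e ^ 2 := by
      rw [← planarSecondDiff_abs]
      exact abs_planarDOS_second_difference_le he h hc0 h4
    have h2 : |c| ^ (-(5 / 2) : ℝ) * c ^ 2 = |c| ^ (-(1 / 2) : ℝ) := by
      rw [← sq_abs, ← Real.rpow_natCast, ← Real.rpow_add hc0]; norm_num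
    have h3 : |c| ^ (-(1 / 2) : ℝ) ≤ 1 + |c| ^ (-(3 / 4) : ℝ) := by
      have h0 : 0 ≤ |c| ^ (-(3 / 4) : ℝ) := by positivity
      rcases le_total |c| 1 with h1 | h1
      · have := Real.rpow_le_rpow_of_exponent_ge hc0 h1 (by norm_num : (-(3 / 4) : ℝ) ≤ -(1 / 2))
        linarith
      · have := Real.rpow_le_one_of_one_le_of_nonpos h1 (by norm_num : (-(1 / 2) : ℝ) ≤ 0)
        linarith
    calc _ ≤ 12 * |c| ^ (-(5 / 2) : ℝ) * e ^ 2 * c ^ 2 := by gcongr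
      _ = e ^ 2 * (12 * (|c| ^ (-(5 / 2) : ℝ) * c ^ 2)) := by ring
      _ ≤ _ := by rw [h2]; gcongr; linarith
  · have h1 : |planarSecondDiff e c| ≤ planarDOS (c + e) + planarDOS (c - e) + 2 * planarDOS c := by
      unfold planarSecondDiff; rw [abs_le]; constructor <;> linarith
    have h2 : c ^ 2 ≤ 4 * e ^ 2 := by rw [← sq_abs c]; nlinarith
    have h3 : 0 ≤ |c| ^ (-(3 / 4) : ℝ) := by positivity
    calc _ ≤ (planarDOS (c + e) + planarDOS (c - e) + 2 * planarDOS c) * (4 * e ^ 2) := by gcongr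
      _ = e ^ 2 * (4 * (planarDOS (c + e) + planarDOS (c - e) + 2 * planarDOS c)) := by ring
      _ ≤ _ := by gcongr; linarith

/-- The constant bounding `∫ |b cos k| ^ (-3/4)`. -/
def cosRpowConst' (b : ℝ) : ℝ :=
  2 * ((absRpowConst + 2 * b) / b) + (b / 2) ^ (-(3 / 4) : ℝ) * π

theorem cosRpowConst'_anti {a b : ℝ} (ha : 0 < a) (hab : a ≤ b) :
    cosRpowConst' b ≤ cosRpowConst' a := by
  have hb := ha.trans_le hab
  unfold cosRpowConst'
  rw [add_div, add_div, mul_div_cancel_right₀ _ ha.ne', mul_div_cancel_right₀ _ hb.ne']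
  have := absRpowConst_nonneg
  have : (b / 2) ^ (-(3 / 4) : ℝ) ≤ (a / 2) ^ (-(3 / 4) : ℝ) :=
    Real.rpow_le_rpow_of_nonpos (by positivity) (by linarith) (by norm_num)
  gcongr

/-- Where sin k ≥ 1/2 the Jacobian can be inserted at the cost of a factor 2; elsewhere |cos k| ≥
1/2 and there is no singularity. -/
theorem integrableOn_and_integral_abs_mul_cos_rpow_le {b : ℝ} (hb : 0 < b) :
    IntegrableOn (fun k => |b * cos k| ^ (-(3 / 4) : ℝ)) (Ioo 0 π) ∧
      ∫ k in Ioo 0 π, |b * cos k| ^ (-(3 / 4) : ℝ) ≤ cosRpowConst' b := by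
  have h1 := ((integrableOn_comp_add_mul_cos 0 hb (integrableOn_abs_rpow_Ioo 0 b)).div_const
    b).const_mul 2
  simp only [zero_add] at h1
  have h2 : IntegrableOn (fun _ : ℝ => (b / 2) ^ (-(3 / 4) : ℝ)) (Ioo 0 π) := integrable_const _
  have hle : ∀ k ∈ Ioo 0 π, |b * cos k| ^ (-(3 / 4) : ℝ) ≤
      2 * (b * sin k * |b * cos k| ^ (-(3 / 4) : ℝ) / b) + (b / 2) ^ (-(3 / 4) : ℝ) := by
    intro k hk
    have hs := sin_pos_of_mem hk
    have e : b * sin k * |b * cos k| ^ (-(3 / 4) : ℝ) / b =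
      sin k * |b * cos k| ^ (-(3 / 4) : ℝ) := by field_simp
    rw [e]
    have h0 : 0 ≤ |b * cos k| ^ (-(3 / 4) : ℝ) := by positivity
    rcases le_total (1 / 2) (sin k) with h | h
    · have : 0 ≤ (b / 2) ^ (-(3 / 4) : ℝ) := by positivity
      nlinarith
    · have h3 : b / 2 ≤ |b * cos k| := by
        rw [abs_mul, abs_of_pos hb]
        have : 1 / 2 ≤ |cos k| := by
          have := Real.sin_sq_add_cos_sq k
          rw [← sq_abs (cos k)] at this
          nlinarith [abs_nonneg (cos k)]
        nlinarith
      have := Real.rpow_le_rpow_of_nonpos (by positivity) h3 (by norm_num : (-(3 / 4) : ℝ) ≤ 0)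
      have : 0 ≤ 2 * (sin k * |b * cos k| ^ (-(3 / 4) : ℝ)) := by positivity
      linarith
  have hi : IntegrableOn (fun k => |b * cos k| ^ (-(3 / 4) : ℝ)) (Ioo 0 π) := by
    refine (h1.add h2).mono' (Measurable.aestronglyMeasurable (by fun_prop))
      ((ae_restrict_iff' measurableSet_Ioo).2 (ae_of_all _ fun k hk => ?_))
    rw [Real.norm_eq_abs, abs_of_nonneg (by positivity)]
    exact hle k hk
  refine ⟨hi, (setIntegral_mono_on hi (h1.add h2) measurableSet_Ioo hle).trans ?_⟩
  have h3 := integral_comp_add_mul_cos 0 hb fun x => |x| ^ (-(3 / 4) : ℝ)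
  simp only [zero_add] at h3
  have h4 := integral_abs_rpow_Ioo_le 0 hb
  rw [zero_add] at h4
  rw [integral_add' h1 h2, integral_const_mul, integral_div, h3, cosRpowConst', setIntegral_const,
    Real.volume_real_Ioo_of_le pi_pos.le, sub_zero, smul_eq_mul, mul_comm π]
  gcongr

theorem integrableOn_planarSecondDiff (e : ℝ) {b : ℝ} (hb : 0 < b) :
    IntegrableOn (fun k => planarSecondDiff e (b * cos k)) (Ioo 0 π) := by
  have h1 := integrableOn_planarDOS_comp e hb
  have h2 := integrableOn_planarDOS_comp (-e) hb
  have h3 := integrableOn_planarDOS_comp 0 hb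
  refine ((h1.add h2).sub (h3.const_mul 2)).congr (ae_of_all _ fun k => ?_)
  simp only [Pi.add_apply, Pi.sub_apply, planarSecondDiff, zero_add]
  congr 3 <;> ring

theorem integral_planarSecondDiff_comp (e : ℝ) {b : ℝ} (hb : 0 < b) :
    ∫ k in Ioo 0 π, planarSecondDiff e (b * cos k) =
      2 * π * (layeredDOS b e - layeredDOS b 0) := by
  have h1 := integrableOn_planarDOS_comp e hb
  have h2 := integrableOn_planarDOS_comp (-e) hb
  have h3 := integrableOn_planarDOS_comp 0 hb
  have e1 : ∀ E, ∫ k in Ioo 0 π, planarDOS (E + b * cos k) = π * layeredDOS b E := fun E => by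
    unfold layeredDOS; field_simp
  calc _ = ∫ k in Ioo 0 π, ((planarDOS (e + b * cos k) + planarDOS (-e + b * cos k)) -
        2 * planarDOS (0 + b * cos k)) := by
        refine integral_congr_ae (ae_of_all _ fun k => ?_)
        simp only [planarSecondDiff, zero_add]
        congr 3 <;> ring
    _ = _ := by
      rw [integral_sub (f := fun k => planarDOS (e + b * cos k) + planarDOS (-e + b * cos k))
        (h1.add h2) (h3.const_mul 2), integral_add h1 h2, integral_const_mul, e1, e1, e1,
        layeredDOS_neg]
      ring

/-- N(e) − N(0) is 1/(2π) times the integral of the second difference at b cos k. The weight sin k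
turns it into an energy integral, which reduces to strips near ±b where P is Lipschitz. The weight 1
− sin k ≤ cos² k supplies the factor (b cos k)²/b² that tames the singular second difference. -/
theorem abs_layeredDOS_sub_le {a b e M : ℝ} (ha : 0 < a) (hab : a ≤ b) (he : 0 ≤ e)
    (h1 : a / 2 ≤ b - e) (h2 : b + e < 4) (hM : ∀ E, layeredDOS b E ≤ M) :
    |layeredDOS b e - layeredDOS b 0| ≤
      (4 * (a / 2) ^ (-(3 / 2) : ℝ) / a + (12 * (π + cosRpowConst' a) + 16 * π * M) / a ^ 2) *
        e ^ 2 := by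
  have hb := ha.trans_le hab
  have hSD := integrableOn_planarSecondDiff e hb
  have i1 : IntegrableOn (fun k => planarSecondDiff e (b * cos k) * sin k) (Ioo 0 π) := by
    refine hSD.mul_bdd (c := 1) (by fun_prop) (ae_of_all _ fun k => ?_)
    rw [Real.norm_eq_abs]; exact Real.abs_sin_le_one k
  have i2 : IntegrableOn (fun k => planarSecondDiff e (b * cos k) * (1 - sin k)) (Ioo 0 π) :=
    (hSD.sub i1).congr (ae_of_all _ fun k => by simp only [Pi.sub_apply]; ring)
  have hsplit : ∫ k in Ioo 0 π, planarSecondDiff e (b * cos k) =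
      (∫ k in Ioo 0 π, planarSecondDiff e (b * cos k) * sin k) +
        ∫ k in Ioo 0 π, planarSecondDiff e (b * cos k) * (1 - sin k) := by
    rw [← integral_add i1 i2]
    refine integral_congr_ae (ae_of_all _ fun k => ?_)
    simp only; ring
  have hA : |∫ k in Ioo 0 π, planarSecondDiff e (b * cos k) * sin k| ≤
      4 * (a / 2) ^ (-(3 / 2) : ℝ) / a * e ^ 2 := by
    have h3 := integral_comp_add_mul_cos 0 hb (planarSecondDiff e)
    simp only [zero_add] at h3
    have h4 : ∫ k in Ioo 0 π, planarSecondDiff e (b * cos k) * sin k =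
        (∫ k in Ioo 0 π, b * sin k * planarSecondDiff e (b * cos k)) / b := by
      rw [← integral_div]
      refine integral_congr_ae (ae_of_all _ fun k => ?_)
      simp only; field_simp
    have h5 := abs_integral_planarSecondDiff_le (half_pos ha) he h1 h2
    rw [zero_add] at h5
    rw [h4, h3, abs_div, abs_of_pos hb]
    calc _ ≤ 4 * (a / 2) ^ (-(3 / 2) : ℝ) * e ^ 2 / a := by gcongr
      _ = _ := by ring
  have hB : |∫ k in Ioo 0 π, planarSecondDiff e (b * cos k) * (1 - sin k)| ≤
      (12 * (π + cosRpowConst' a) + 16 * π * M) / a ^ 2 * e ^ 2 := by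
    obtain ⟨j1, j2⟩ := integrableOn_and_integral_abs_mul_cos_rpow_le hb
    have p1 := integrableOn_planarDOS_comp e hb
    have p2 := integrableOn_planarDOS_comp (-e) hb
    have p3 := integrableOn_planarDOS_comp 0 hb
    have e1 : ∀ E, ∫ k in Ioo 0 π, planarDOS (E + b * cos k) = π * layeredDOS b E := fun E => by
      unfold layeredDOS; field_simp
    have q1 : IntegrableOn (fun k => 12 * (1 + |b * cos k| ^ (-(3 / 4) : ℝ))) (Ioo 0 π) :=
      ((integrable_const (1 : ℝ)).add j1).const_mul 12
    have q2 : IntegrableOn (fun k => 4 * (planarDOS (e + b * cos k) + planarDOS (-e + b * cos k) +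
        2 * planarDOS (0 + b * cos k))) (Ioo 0 π) := ((p1.add p2).add (p3.const_mul 2)).const_mul 4
    have hbound : ∀ᵐ k ∂volume.restrict (Ioo 0 π),
        ‖planarSecondDiff e (b * cos k) * (1 - sin k)‖ ≤ e ^ 2 / b ^ 2 *
          (12 * (1 + |b * cos k| ^ (-(3 / 4) : ℝ)) + 4 * (planarDOS (e + b * cos k) +
            planarDOS (-e + b * cos k) + 2 * planarDOS (0 + b * cos k))) := by
      filter_upwards [ae_add_mul_cos_ne 0 hb 0, ae_restrict_mem measurableSet_Ioo] with k hk hkm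
      rw [zero_add] at hk
      have hs0 := sin_pos_of_mem hkm
      have hs1 := Real.sin_le_one k
      have hsc := Real.sin_sq_add_cos_sq k
      have hc4 : |b * cos k| + e < 4 := by
        rw [abs_mul, abs_of_pos hb]
        have := mul_le_of_le_one_right hb.le (Real.abs_cos_le_one k)
        linarith
      have key := abs_planarSecondDiff_mul_sq_le he hk hc4
      rw [norm_mul, Real.norm_eq_abs, Real.norm_eq_abs, abs_of_nonneg (sub_nonneg.2 hs1),
        zero_add, show e + b * cos k = b * cos k + e by ring,
        show -e + b * cos k = b * cos k - e by ring]
      calc _ ≤ |planarSecondDiff e (b * cos k)| * cos k ^ 2 := by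
            gcongr; nlinarith
        _ = |planarSecondDiff e (b * cos k)| * (b * cos k) ^ 2 / b ^ 2 := by field_simp
        _ ≤ _ := div_le_div_of_nonneg_right key (by positivity)
        _ = _ := by ring
    have h3 := norm_integral_le_of_norm_le ((q1.add q2).const_mul (e ^ 2 / b ^ 2)) hbound
    rw [Real.norm_eq_abs] at h3
    refine h3.trans ?_
    rw [integral_const_mul]
    have h4 : ∫ k in Ioo 0 π, ((fun k => 12 * (1 + |b * cos k| ^ (-(3 / 4) : ℝ))) +
        fun k => 4 * (planarDOS (e + b * cos k) + planarDOS (-e + b * cos k) +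
        2 * planarDOS (0 + b * cos k))) k ≤ 12 * (π + cosRpowConst' a) + 16 * π * M := by
      rw [integral_add' q1 q2, integral_const_mul, integral_add (integrable_const (1 : ℝ)) j1,
        integral_const_mul, integral_add (f := fun k => planarDOS (e + b * cos k) +
          planarDOS (-e + b * cos k)) (p1.add p2) (p3.const_mul 2), integral_add p1 p2,
        integral_const_mul, e1, e1, e1]
      have c1 := cosRpowConst'_anti ha hab
      have m1 := mul_le_mul_of_nonneg_left (hM e) pi_pos.le
      have m2 := mul_le_mul_of_nonneg_left (hM (-e)) pi_pos.le
      have m3 := mul_le_mul_of_nonneg_left (hM 0) pi_pos.le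
      have : ∫ k in Ioo 0 π, (1 : ℝ) = π := by simp [pi_pos.le]
      rw [this]
      linarith
    have hM0 : 0 ≤ M := (layeredDOS_nonneg b 0).trans (hM 0)
    have hc0 : 0 ≤ cosRpowConst' a := by
      have := absRpowConst_nonneg
      unfold cosRpowConst'; positivity
    calc _ ≤ e ^ 2 / b ^ 2 * (12 * (π + cosRpowConst' a) + 16 * π * M) := by gcongr
      _ ≤ e ^ 2 / a ^ 2 * (12 * (π + cosRpowConst' a) + 16 * π * M) := by gcongr
      _ = _ := by ring
  have h6 := abs_add_le (∫ k in Ioo 0 π, planarSecondDiff e (b * cos k) * sin k)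
    (∫ k in Ioo 0 π, planarSecondDiff e (b * cos k) * (1 - sin k))
  rw [← hsplit, integral_planarSecondDiff_comp e hb, abs_mul, abs_of_pos (by positivity)] at h6
  have h7 : |layeredDOS b e - layeredDOS b 0| ≤ 2 * π * |layeredDOS b e - layeredDOS b 0| := by
    have := abs_nonneg (layeredDOS b e - layeredDOS b 0)
    nlinarith [pi_gt_three]
  rw [add_mul]
  linarith

/-- Uniform bounds of the density of states for hopping parameters in a compact set. -/
theorem exists_layeredDOS_bounds {a B : ℝ} (ha : 0 < a) (hB : B < 4) :
    ∃ C > 0, ∀ b ∈ Icc a B, ∀ E, layeredDOS b E ≤ C ∧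
      |layeredDOS b E - layeredDOS b 0| ≤ C * E ^ 2 := by
  set M := planarConst * (π + cosRpowConst a) / π with hMdef
  have hM : ∀ b ∈ Icc a B, ∀ E, layeredDOS b E ≤ M := fun b hb E => by
    refine (layeredDOS_le E (ha.trans_le hb.1)).trans ?_
    have := cosRpowConst_anti ha hb.1
    have := planarConst_nonneg
    rw [hMdef]
    gcongr
  rcases lt_or_ge B a with hBa | hBa
  · exact ⟨1, one_pos, fun b hb => absurd (hb.1.trans hb.2) (not_le.2 hBa)⟩
  have hM0 : 0 ≤ M := (layeredDOS_nonneg a 0).trans (hM a ⟨le_rfl, hBa⟩ 0)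
  -- For |E| ≤ δ the strip around b stays in [a/2, 4). For |E| > δ boundedness suffices, since M ≤
  -- (M/δ²)E².
  set δ := min (a / 2) ((4 - B) / 2) with hδ
  have hδ0 : 0 < δ := lt_min (half_pos ha) (by linarith)
  set K := 4 * (a / 2) ^ (-(3 / 2) : ℝ) / a + (12 * (π + cosRpowConst' a) + 16 * π * M) / a ^ 2
    with hK
  have hK0 : 0 ≤ K := by
    have := absRpowConst_nonneg
    have : 0 ≤ cosRpowConst' a := by unfold cosRpowConst'; positivity
    positivity
  have hMδ : 0 ≤ M / δ ^ 2 := by positivity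
  refine ⟨M + K + M / δ ^ 2 + 1, by linarith, fun b hb E => ⟨by linarith [hM b hb E], ?_⟩⟩
  have hE2 := sq_nonneg E
  rcases le_or_gt |E| δ with h | h
  · have hδ1 : δ ≤ a / 2 := min_le_left _ _
    have hδ2 : δ ≤ (4 - B) / 2 := min_le_right _ _
    have := abs_layeredDOS_sub_le ha hb.1 (abs_nonneg E) (by linarith [hb.1])
      (by linarith [hb.2]) (hM b hb)
    rw [layeredDOS_abs, sq_abs] at this
    refine this.trans ?_
    rw [← hK]
    gcongr
    linarith
  · have h1 : |layeredDOS b E - layeredDOS b 0| ≤ M := by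
      rw [abs_le]
      constructor <;> linarith [hM b hb E, hM b hb 0, layeredDOS_nonneg b E, layeredDOS_nonneg b 0]
    have h2 : δ ^ 2 ≤ E ^ 2 := by rw [← sq_abs E]; gcongr
    calc _ ≤ M := h1
      _ = M / δ ^ 2 * δ ^ 2 := by field_simp
      _ ≤ M / δ ^ 2 * E ^ 2 := by gcongr
      _ ≤ _ := by gcongr; linarith

end

end HubbardAF

namespace HubbardAF

open Real Set Filter Topology MeasureTheory
open scoped ENNReal

noncomputable section

/-! ### The band density of states -/

theorem brillouinZone_eq_pi : brillouinZone = Set.pi univ fun _ : Fin 3 => Icc (-π) π :=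
  (Set.pi_univ_Icc _ _).symm

theorem lintegral_brillouinZone {F : ℝ × ℝ × ℝ → ℝ≥0∞} (hF : Measurable F) :
    ∫⁻ k in brillouinZone, F (k 2, k 0, k 1) =
      ∫⁻ x in Icc (-π) π, ∫⁻ y in Icc (-π) π, ∫⁻ z in Icc (-π) π, F (x, y, z) := by
  rw [brillouinZone_eq_pi, volume_pi, Measure.restrict_pi_pi]
  set μ : Fin 3 → Measure ℝ := fun _ => volume.restrict (Icc (-π) π)
  have h3 := measurePreserving_piFinSuccAbove μ (2 : Fin 3)
  have h2 := measurePreserving_piFinTwo (fun j => μ ((2 : Fin 3).succAbove j))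
  have hG : Measurable fun p : ℝ × (Fin 2 → ℝ) => F (p.1, p.2 0, p.2 1) := by fun_prop
  have e3 := h3.lintegral_comp hG
  refine e3.trans ?_
  rw [lintegral_prod _ hG.aemeasurable]
  refine lintegral_congr fun x => ?_
  have hH : Measurable fun p : ℝ × ℝ => F (x, p.1, p.2) := by fun_prop
  refine (h2.lintegral_comp hH).trans ?_
  rw [lintegral_prod _ hH.aemeasurable]

theorem lintegral_three_cos {g : ℝ → ℝ≥0∞} (hg : Measurable g) {b : ℝ} (hb : 0 < b) :
    ∫⁻ x in Ioo 0 π, ∫⁻ y in Ioo 0 π, ∫⁻ z in Ioo 0 π, g (2 * cos y + 2 * cos z + b * cos x) =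
      ∫⁻ E, ENNReal.ofReal (π ^ 3 * layeredDOS b (-E)) * g E := by
  have hm := measurable_arcsineConv
  have h1 : ∀ x, ∫⁻ y in Ioo 0 π, ∫⁻ z in Ioo 0 π, g (2 * cos y + 2 * cos z + b * cos x) =
      ∫⁻ E, arcsineConv (E - b * cos x) * g E := by
    intro x
    rw [lintegral_comp_two_cos (g := fun t => g (t + b * cos x)) (by fun_prop),
      ← lintegral_sub_right_eq_self _ (b * cos x)]
    simp
  simp_rw [h1]
  rw [lintegral_lintegral_swap (by fun_prop)]
  refine lintegral_congr fun E => ?_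
  rw [lintegral_mul_const _ (by fun_prop)]
  congr 1
  have hi := (integrableOn_planarDOS_comp (-E) hb).const_mul (π ^ 2)
  have h2 : π ^ 3 * layeredDOS b (-E) =
      ∫ k in Ioo 0 π, π ^ 2 * planarDOS (-E + b * cos k) := by
    rw [integral_const_mul, layeredDOS]; field_simp
  rw [h2, ofReal_integral_eq_lintegral_ofReal hi
    (ae_of_all _ fun k => mul_nonneg (by positivity) (planarDOS_nonneg _))]
  refine lintegral_congr_ae ?_
  filter_upwards [ae_add_mul_cos_ne (-E) hb 0] with k hk
  rw [← arcsineConv_eq hk, ← arcsineConv_neg]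
  congr 1; ring

/-- Folding each coordinate onto (0, π) gives the factor 2³, and a reflection of the energy absorbs
the minus sign of the band relation. -/
theorem lintegral_band {tz : ℝ} (htz : 0 < tz) {g : ℝ → ℝ≥0∞} (hg : Measurable g) :
    ∫⁻ k in brillouinZone, g (band tz k) =
      ∫⁻ E, ENNReal.ofReal ((2 * π) ^ 3 * layeredDOS (2 * tz) E) * g E := by
  have hb : 0 < 2 * tz := by linarith
  have h1 := lintegral_brillouinZone
    (F := fun p => g (-(2 * cos p.2.1 + 2 * cos p.2.2 + 2 * tz * cos p.1))) (by fun_prop)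
  have h2 : ∀ k : Fin 3 → ℝ, band tz k = -(2 * cos (k 0) + 2 * cos (k 1) + 2 * tz * cos (k 2)) :=
    fun k => by unfold band; ring
  simp_rw [h2]
  rw [h1]
  simp only
  have h3 : ∀ c d : ℝ, ∫⁻ z in Icc (-π) π, g (-(c + 2 * cos z + d)) =
      2 * ∫⁻ z in Ioo 0 π, g (-(c + 2 * cos z + d)) := fun c d =>
    lintegral_comp_cos_Icc fun t => g (-(c + 2 * t + d))
  simp_rw [h3]
  have h4 : ∀ d : ℝ, ∫⁻ y in Icc (-π) π, 2 * ∫⁻ z in Ioo 0 π, g (-(2 * cos y + 2 * cos z + d)) =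
      2 * (2 * ∫⁻ y in Ioo 0 π, ∫⁻ z in Ioo 0 π, g (-(2 * cos y + 2 * cos z + d))) := fun d => by
    rw [lintegral_comp_cos_Icc fun t => 2 * ∫⁻ z in Ioo 0 π, g (-(2 * t + 2 * cos z + d)),
      lintegral_const_mul' _ _ (by simp)]
  simp_rw [h4]
  rw [lintegral_comp_cos_Icc fun t => 2 * (2 * ∫⁻ y in Ioo 0 π, ∫⁻ z in Ioo 0 π,
    g (-(2 * cos y + 2 * cos z + 2 * tz * t))), lintegral_const_mul' _ _ (by simp),
    lintegral_const_mul' _ _ (by simp), lintegral_three_cos (g := fun E => g (-E)) (by fun_prop) hb,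
    ← lintegral_neg_eq_self (fun E => ENNReal.ofReal ((2 * π) ^ 3 * layeredDOS (2 * tz) E) * g E),
    ← mul_assoc, ← mul_assoc, ← lintegral_const_mul' _ _ (by simp [ENNReal.mul_eq_top])]
  refine lintegral_congr fun E => ?_
  rw [← mul_assoc]
  congr 1
  rw [show (2 * π) ^ 3 * layeredDOS (2 * tz) (-E) = 2 * 2 * 2 * (π ^ 3 * layeredDOS (2 * tz) (-E)) by
    ring, ENNReal.ofReal_mul (by norm_num : (0 : ℝ) ≤ 2 * 2 * 2)]
  norm_num

theorem measurable_band (tz : ℝ) : Measurable (band tz) := by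
  unfold band; fun_prop

theorem measurable_layeredDOS {b : ℝ} (hb : 0 < b) : Measurable (layeredDOS b) :=
  (continuous_layeredDOS hb).measurable

theorem map_band_eq_withDensity {tz : ℝ} (htz : 0 < tz) :
    Measure.map (band tz) (volume.restrict brillouinZone) = volume.withDensity
      fun E => ((2 * π) ^ 3 * layeredDOS (2 * tz) E).toNNReal := by
  have hm := measurable_layeredDOS (by linarith : 0 < 2 * tz)
  refine Measure.ext_of_lintegral _ fun g hg => ?_
  rw [lintegral_map hg (measurable_band tz), lintegral_band htz hg,
    lintegral_withDensity_eq_lintegral_mul _ (by fun_prop) hg]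
  rfl

theorem integral_band {tz : ℝ} (htz : 0 < tz) {h : ℝ → ℝ} (hh : Measurable h) :
    (∫ k in brillouinZone, h (band tz k)) / (2 * π) ^ 3 =
      ∫ E, layeredDOS (2 * tz) E * h E := by
  have hm := measurable_layeredDOS (by linarith : 0 < 2 * tz)
  rw [← integral_map (measurable_band tz).aemeasurable hh.aestronglyMeasurable,
    map_band_eq_withDensity htz, integral_withDensity_eq_integral_smul (by fun_prop),
    ← integral_div]
  refine integral_congr_ae (ae_of_all _ fun E => ?_)
  have := layeredDOS_nonneg (2 * tz) E
  simp only [NNReal.smul_def, smul_eq_mul]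
  rw [Real.coe_toNNReal _ (by positivity)]
  field_simp

theorem integrable_layeredDOS {b : ℝ} (hb : 0 < b) : Integrable (layeredDOS b) := by
  refine (continuous_layeredDOS hb).integrable_of_hasCompactSupport ?_
  refine HasCompactSupport.intro (isCompact_Icc (a := -(4 + b)) (b := 4 + b)) fun E hE => ?_
  refine layeredDOS_eq_zero hb.le ?_
  by_contra! h
  exact hE ⟨(abs_lt.1 h).1.le, (abs_lt.1 h).2.le⟩

theorem integratedDOS_eq {tz : ℝ} (htz : 0 < tz) (E : ℝ) :
    integratedDOS tz E = ∫ x in Iic E, layeredDOS (2 * tz) x := by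
  have h1 := integral_band htz (h := (Iic E).indicator 1)
    (measurable_one.indicator measurableSet_Iic)
  have h2 : ∫ k in brillouinZone, (Iic E).indicator (1 : ℝ → ℝ) (band tz k) =
      volume.real {k | k ∈ brillouinZone ∧ band tz k ≤ E} := by
    have hS : MeasurableSet {k | band tz k ≤ E} := measurableSet_le (measurable_band tz)
      measurable_const
    have : (fun k => (Iic E).indicator (1 : ℝ → ℝ) (band tz k)) =
        {k | band tz k ≤ E}.indicator 1 := by
      funext k; simp [indicator_apply]
    rw [this, integral_indicator_one hS, measureReal_restrict_apply hS]
    congr 1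
    ext k
    simp [and_comm]
  rw [integratedDOS, ← h2, h1, ← integral_indicator measurableSet_Iic]
  refine integral_congr_ae (ae_of_all _ fun x => ?_)
  simp only [indicator_apply]
  split_ifs <;> simp

/-- The fundamental theorem of calculus: continuity of the layered density makes the derivative
exist at every energy, not merely almost everywhere. -/
theorem hasDerivAt_integratedDOS {tz : ℝ} (htz : 0 < tz) (E : ℝ) :
    HasDerivAt (integratedDOS tz) (layeredDOS (2 * tz) E) E := by
  have hb : 0 < 2 * tz := by linarith
  have hi := integrable_layeredDOS hb
  have hc := continuous_layeredDOS hb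
  have h1 : integratedDOS tz =
      fun E => integratedDOS tz 0 + ∫ x in (0 : ℝ)..E, layeredDOS (2 * tz) x := by
    funext E
    rw [integratedDOS_eq htz, integratedDOS_eq htz,
      ← intervalIntegral.integral_Iic_sub_Iic hi.integrableOn hi.integrableOn]
    ring
  rw [h1]
  exact (intervalIntegral.integral_hasDerivAt_right (hc.intervalIntegrable _ _)
    (hc.stronglyMeasurableAtFilter _ _) hc.continuousAt).const_add _

theorem dos_eq {tz : ℝ} (htz : 0 < tz) : dos tz = layeredDOS (2 * tz) :=
  funext fun E => (hasDerivAt_integratedDOS htz E).deriv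

theorem differentiable_integratedDOS {tz : ℝ} (htz : 0 < tz) : Differentiable ℝ (integratedDOS tz) :=
  fun E => (hasDerivAt_integratedDOS htz E).differentiableAt

theorem continuous_dos {tz : ℝ} (htz : 0 < tz) : Continuous (dos tz) := by
  rw [dos_eq htz]; exact continuous_layeredDOS (by linarith)

theorem dos_nonneg {tz : ℝ} (htz : 0 < tz) (E : ℝ) : 0 ≤ dos tz E := by
  rw [dos_eq htz]; exact layeredDOS_nonneg _ _

theorem dos_abs {tz : ℝ} (htz : 0 < tz) (E : ℝ) : dos tz |E| = dos tz E := by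
  rw [dos_eq htz, layeredDOS_abs]

theorem dos_eq_zero {tz : ℝ} (htz : tz ∈ Ioo (0 : ℝ) 2) {E : ℝ} (hE : 8 ≤ E) : dos tz E = 0 := by
  rw [dos_eq htz.1]
  refine layeredDOS_eq_zero (by linarith [htz.1]) ?_
  rw [abs_of_nonneg (by linarith)]
  linarith [htz.2]

theorem integrable_dos {tz : ℝ} (htz : 0 < tz) : Integrable (dos tz) := by
  rw [dos_eq htz]; exact integrable_layeredDOS (by linarith)

theorem le_dos_zero {tz : ℝ} (htz : tz ∈ Ioo (0 : ℝ) 2) : 1 / (π * √20) ≤ dos tz 0 := by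
  rw [dos_eq htz.1]; exact le_layeredDOS_zero (by linarith [htz.1]) (by linarith [htz.2])

theorem dos_zero_pos {tz : ℝ} (htz : tz ∈ Ioo (0 : ℝ) 2) : 0 < dos tz 0 :=
  lt_of_lt_of_le (by positivity) (le_dos_zero htz)

theorem exists_dos_bounds {a B : ℝ} (ha : 0 < a) (hB : B < 2) :
    ∃ C > 0, ∀ tz ∈ Icc a B, ∀ E, dos tz E ≤ C ∧ |dos tz E - dos tz 0| ≤ C * E ^ 2 := by
  obtain ⟨C, hC, h⟩ := exists_layeredDOS_bounds (a := 2 * a) (B := 2 * B) (by linarith)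
    (by linarith)
  refine ⟨C, hC, fun tz htz E => ?_⟩
  rw [dos_eq (ha.trans_le htz.1)]
  exact h (2 * tz) ⟨by linarith [htz.1], by linarith [htz.2]⟩ E

/-- The average of an even function of the band energy as an energy integral. -/
theorem integral_band_of_even {tz : ℝ} (htz : 0 < tz) {h : ℝ → ℝ} (hh : Measurable h)
    (heven : ∀ E, h |E| = h E) :
    (∫ k in brillouinZone, h (band tz k)) / (2 * π) ^ 3 =
      2 * ∫ E in Ioi 0, dos tz E * h E := by
  rw [integral_band htz hh, ← dos_eq htz, ← integral_comp_abs]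
  refine integral_congr_ae (ae_of_all _ fun E => ?_)
  simp only [dos_abs htz, heven]

end

end HubbardAF

namespace HubbardAF

open Real Set Filter Topology MeasureTheory

noncomputable section

/-! ### The Néel temperature and the antiferromagnetic gap -/

/-- The energy integral `∫₀^∞ N(ε) tanh(√(x² + ε²) / (2T)) / √(x² + ε²) dε`. -/
def pairIntegral (tz x T : ℝ) : ℝ := ∫ ε in Ioi (0 : ℝ), dos tz ε * pairKernel x T ε

theorem integrableOn_dos_mul_of_bdd {tz : ℝ} (htz : tz ∈ Ioo (0 : ℝ) 2) {f : ℝ → ℝ}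
    (hf : Measurable f) {M : ℝ} (hM : ∀ ε, 0 < ε → |f ε| ≤ M) :
    IntegrableOn (fun ε => dos tz ε * f ε) (Ioi 0) :=
  (integrable_dos htz.1).integrableOn.mul_bdd (c := M) hf.aestronglyMeasurable
    ((ae_restrict_iff' measurableSet_Ioi).2 (ae_of_all _ fun ε hε => hM ε hε))

theorem integrableOn_dos_mul_pairKernel {tz x T : ℝ} (htz : tz ∈ Ioo (0 : ℝ) 2) (hT : 0 ≤ T)
    (h : 0 < x ∨ 0 < T) : IntegrableOn (fun ε => dos tz ε * pairKernel x T ε) (Ioi 0) := by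
  obtain ⟨M, hM⟩ := exists_pairKernel_le h
  refine integrableOn_dos_mul_of_bdd htz (measurable_pairKernel x T) (M := M) fun ε _ => ?_
  rw [abs_of_nonneg (pairKernel_nonneg x hT ε)]
  exact hM ε

/-- N vanishes beyond the band edge, so strict positivity has to come from a neighbourhood of 0,
where N is continuous with N(0) > 0. -/
theorem integral_dos_mul_pos {tz : ℝ} (htz : tz ∈ Ioo (0 : ℝ) 2) {f : ℝ → ℝ}
    (hf : ∀ ε, 0 < ε → 0 < f ε) (hi : IntegrableOn (fun ε => dos tz ε * f ε) (Ioi 0)) :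
    0 < ∫ ε in Ioi (0 : ℝ), dos tz ε * f ε := by
  rw [setIntegral_pos_iff_support_of_nonneg_ae ((ae_restrict_iff' measurableSet_Ioi).2
    (ae_of_all _ fun ε hε => mul_nonneg (dos_nonneg htz.1 ε) (hf ε hε).le)) hi]
  obtain ⟨δ, hδ, hδ'⟩ := Metric.eventually_nhds_iff.1
    ((continuous_dos htz.1).continuousAt.eventually (lt_mem_nhds (dos_zero_pos htz)))
  refine lt_of_lt_of_le ?_ (measure_mono (s := Ioo 0 δ) fun ε hε => ⟨?_, hε.1⟩)
  · simpa using hδ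
  · refine (mul_pos (hδ' ?_) (hf ε hε.1)).ne'
    rw [Real.dist_eq, sub_zero, abs_of_pos hε.1]
    exact hε.2

theorem pairIntegral_sub {tz x x' T T' : ℝ} (htz : tz ∈ Ioo (0 : ℝ) 2) (hT : 0 ≤ T)
    (h : 0 < x ∨ 0 < T) (hT' : 0 ≤ T') (h' : 0 < x' ∨ 0 < T') :
    IntegrableOn (fun ε => dos tz ε * (pairKernel x T ε - pairKernel x' T' ε)) (Ioi 0) ∧
    pairIntegral tz x T - pairIntegral tz x' T' =
      ∫ ε in Ioi (0 : ℝ), dos tz ε * (pairKernel x T ε - pairKernel x' T' ε) := by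
  have h1 := integrableOn_dos_mul_pairKernel htz hT h
  have h2 := integrableOn_dos_mul_pairKernel htz hT' h'
  simp_rw [mul_sub]
  exact ⟨h1.sub h2, (integral_sub h1 h2).symm⟩

theorem pairIntegral_lt_of_lt {tz x x' T : ℝ} (htz : tz ∈ Ioo (0 : ℝ) 2) (hx : 0 ≤ x) (hlt : x < x')
    (hT : 0 ≤ T) (h : 0 < x ∨ 0 < T) : pairIntegral tz x' T < pairIntegral tz x T := by
  obtain ⟨hi, he⟩ := pairIntegral_sub htz hT h hT (.inl (hx.trans_lt hlt))
  rw [← sub_pos, he]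
  exact integral_dos_mul_pos htz (fun ε hε => sub_pos.2 (pairKernel_lt_of_lt hx hlt hT hε)) hi

theorem pairIntegral_lt_of_temp_lt {tz x T T' : ℝ} (htz : tz ∈ Ioo (0 : ℝ) 2) (hT : 0 ≤ T)
    (hlt : T < T') (h : 0 < x ∨ 0 < T) : pairIntegral tz x T' < pairIntegral tz x T := by
  have hT' := hT.trans_lt hlt
  obtain ⟨hi, he⟩ := pairIntegral_sub htz hT h hT'.le (.inr hT')
  rw [← sub_pos, he]
  exact integral_dos_mul_pos htz (fun ε hε => sub_pos.2 (pairKernel_lt_of_temp_lt x hε hT hlt)) hi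

theorem pairIntegral_le {tz x T M : ℝ} (htz : tz ∈ Ioo (0 : ℝ) 2) (hT : 0 ≤ T) (h : 0 < x ∨ 0 < T)
    (hM : ∀ ε, pairKernel x T ε ≤ M) :
    pairIntegral tz x T ≤ (∫ ε in Ioi (0 : ℝ), dos tz ε) * M := by
  rw [← integral_mul_const]
  exact setIntegral_mono_on (integrableOn_dos_mul_pairKernel htz hT h)
    ((integrable_dos htz.1).integrableOn.mul_const M) measurableSet_Ioi
    fun ε _ => mul_le_mul_of_nonneg_left (hM ε) (dos_nonneg htz.1 ε)

theorem continuousAt_pairIntegral_of_bdd {tz : ℝ} (htz : tz ∈ Ioo (0 : ℝ) 2) {x T : ℝ → ℝ} {s M : ℝ}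
    (hT : ∀ᶠ t in 𝓝 s, 0 ≤ T t) (hM : ∀ᶠ t in 𝓝 s, ∀ ε, pairKernel (x t) (T t) ε ≤ M)
    (hc : ∀ ε, 0 < ε → ContinuousAt (fun t => pairKernel (x t) (T t) ε) s) :
    ContinuousAt (fun t => pairIntegral tz (x t) (T t)) s := by
  refine continuousAt_of_dominated (bound := fun ε => dos tz ε * M) ?_ ?_
    ((integrable_dos htz.1).integrableOn.mul_const M) ?_
  · exact Eventually.of_forall fun t =>
      ((continuous_dos htz.1).measurable.mul (measurable_pairKernel _ _)).aestronglyMeasurable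
  · filter_upwards [hT, hM] with t h1 h2
    refine ae_of_all _ fun ε => ?_
    have h3 := pairKernel_nonneg (x t) h1 ε
    have h4 := dos_nonneg htz.1 ε
    rw [Real.norm_eq_abs, abs_of_nonneg (by positivity)]
    exact mul_le_mul_of_nonneg_left (h2 ε) h4
  · exact (ae_restrict_iff' measurableSet_Ioi).2 (ae_of_all _ fun ε hε =>
      continuousAt_const.mul (hc ε hε))

theorem continuousAt_pairIntegral {tz x T : ℝ} (htz : tz ∈ Ioo (0 : ℝ) 2) (hT : 0 ≤ T)
    (h : 0 < x ∨ 0 < T) : ContinuousAt (fun x => pairIntegral tz x T) x := by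
  have hc : ∀ ε, 0 < ε → ContinuousAt (fun x => pairKernel x T ε) x := fun ε hε =>
    (hasDerivAt_pairKernel x hT hε).continuousAt
  rcases h with h | h
  · refine continuousAt_pairIntegral_of_bdd htz (T := fun _ => T) (M := 1 / (x / 2))
      (Eventually.of_forall fun _ => hT) ?_ hc
    filter_upwards [lt_mem_nhds (half_lt_self h)] with t ht ε
    refine (pairKernel_le_inv_left ((half_pos h).trans ht) T ε).trans ?_
    gcongr
  · exact continuousAt_pairIntegral_of_bdd htz (T := fun _ => T) (M := 1 / (2 * T))
      (Eventually.of_forall fun _ => hT)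
      (Eventually.of_forall fun t ε => pairKernel_le_half_inv t h ε) hc

theorem continuousAt_pairIntegral_temp {tz T : ℝ} (htz : tz ∈ Ioo (0 : ℝ) 2) (hT : 0 < T) :
    ContinuousAt (fun T => pairIntegral tz 0 T) T := by
  refine continuousAt_pairIntegral_of_bdd htz (x := fun _ => 0) (T := fun T => T)
    (M := 1 / (2 * (T / 2))) ?_ ?_ fun ε hε => ?_
  · filter_upwards [lt_mem_nhds hT] with t ht using ht.le
  · filter_upwards [lt_mem_nhds (half_lt_self hT)] with t ht ε
    refine (pairKernel_le_half_inv 0 ((half_pos hT).trans ht) ε).trans ?_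
    gcongr
  · have h1 : ContinuousAt (fun T => Real.tanh (ε / (2 * T)) / ε) T := by
      refine ContinuousAt.div_const (continuous_tanh.continuousAt.comp ?_) _
      exact continuousAt_const.div (by fun_prop) (by positivity)
    refine h1.congr ?_
    filter_upwards [lt_mem_nhds hT] with t ht
    rw [pairKernel_zero_left t hε, thermalTanh_of_ne ht.ne']

/-- The logarithmic divergence at low temperature: on (T, r) the density is at least m and
tanh(ε/(2T)) ≥ tanh(1/2), so the integral is at least c log(r/T). The chosen T makes this equal to
|v|. -/
theorem exists_le_pairIntegral {tz : ℝ} (htz : tz ∈ Ioo (0 : ℝ) 2) (v : ℝ) :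
    ∃ T, 0 < T ∧ T ≤ 1 ∧ v ≤ pairIntegral tz 0 T := by
  have hm := half_pos (dos_zero_pos htz)
  set m := dos tz 0 / 2 with hmdef
  obtain ⟨δ, hδ, hδ'⟩ := Metric.eventually_nhds_iff.1
    ((continuous_dos htz.1).continuousAt.eventually
      (lt_mem_nhds (half_lt_self (dos_zero_pos htz))))
  set r := min 1 (δ / 2) with hr
  have hr0 : 0 < r := lt_min one_pos (half_pos hδ)
  have ht : 0 < Real.tanh (1 / 2) := tanh_pos (by norm_num)
  set c := m * Real.tanh (1 / 2) with hcdef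
  have hc : 0 < c := by positivity
  set T := r * exp (-|v| / c) with hTdef
  have hT0 : 0 < T := by positivity
  have hTr : T ≤ r := by
    refine mul_le_of_le_one_right hr0.le (Real.exp_le_one_iff.2 ?_)
    exact div_nonpos_of_nonpos_of_nonneg (neg_nonpos.2 (abs_nonneg v)) hc.le
  refine ⟨T, hT0, hTr.trans (min_le_left _ _), ?_⟩
  have hi := integrableOn_dos_mul_pairKernel htz hT0.le (x := 0) (.inr hT0)
  have hinv : IntervalIntegrable (fun ε : ℝ => c * ε⁻¹) volume T r := by
    refine (intervalIntegral.intervalIntegrable_inv (fun ε hε => ?_) continuousOn_id).const_mul c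
    rw [uIcc_of_le hTr] at hε
    exact (hT0.trans_le hε.1).ne'
  calc v ≤ |v| := le_abs_self v
    _ = ∫ ε in T..r, c * ε⁻¹ := by
      rw [intervalIntegral.integral_const_mul, integral_inv_of_pos hT0 hr0, hTdef,
        div_mul_cancel_left₀ hr0.ne', ← Real.exp_neg, Real.log_exp]
      field_simp
    _ = ∫ ε in Ioc T r, c * ε⁻¹ := intervalIntegral.integral_of_le hTr
    _ ≤ ∫ ε in Ioc T r, dos tz ε * pairKernel 0 T ε := by
      refine setIntegral_mono_on ((intervalIntegrable_iff_integrableOn_Ioc_of_le hTr).1 hinv)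
        (hi.mono_set fun ε hε => hT0.trans hε.1) measurableSet_Ioc fun ε hε => ?_
      have hε0 : 0 < ε := hT0.trans hε.1
      have h1 : m ≤ dos tz ε := by
        refine (hδ' ?_).le
        rw [Real.dist_eq, sub_zero, abs_of_pos hε0]
        have := hε.2.trans (min_le_right _ _)
        linarith
      have h2 : Real.tanh (1 / 2) * ε⁻¹ ≤ pairKernel 0 T ε := by
        rw [pairKernel_zero_left T hε0, thermalTanh_of_ne hT0.ne', ← div_eq_mul_inv]
        refine div_le_div_of_nonneg_right (strictMono_tanh.monotone ?_) hε0.le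
        rw [div_le_div_iff₀ two_pos (by positivity)]
        linarith [hε.1]
      calc c * ε⁻¹ = m * (Real.tanh (1 / 2) * ε⁻¹) := by rw [hcdef]; ring
        _ ≤ _ := mul_le_mul h1 h2 (by positivity) (dos_nonneg htz.1 ε)
    _ ≤ _ := by
      refine setIntegral_mono_set hi ?_
        (show Ioc T r ⊆ Ioi 0 from fun ε hε => hT0.trans hε.1).eventuallyLE
      exact ae_of_all _ fun ε => mul_nonneg (dos_nonneg htz.1 ε) (pairKernel_nonneg 0 hT0.le ε)

theorem tanh_div_abs (T E : ℝ) : Real.tanh (|E| / T) / |E| = Real.tanh (E / T) / E := by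
  rcases abs_choice E with h | h <;> rw [h]
  rw [neg_div, Real.tanh_neg, neg_div_neg_eq]

theorem isNeelTemperature_iff {U tz T : ℝ} (htz : 0 < tz) :
    IsNeelTemperature U tz T ↔ 0 < T ∧ 1 = U * pairIntegral tz 0 T := by
  refine and_congr_right fun hT => ?_
  have hm : Measurable fun E => U * Real.tanh (E / (2 * T)) / (2 * E) :=
    ((continuous_tanh.measurable.comp (by fun_prop)).const_mul U).div (by fun_prop)
  have h1 := integral_band_of_even htz hm fun E => by
    have := tanh_div_abs (2 * T) E
    rw [mul_div_mul_comm, mul_div_mul_comm, this]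
  have h2 : 2 * ∫ E in Ioi 0, dos tz E * (U * Real.tanh (E / (2 * T)) / (2 * E)) =
      U * pairIntegral tz 0 T := by
    rw [pairIntegral, ← integral_const_mul, ← integral_const_mul]
    refine setIntegral_congr_fun measurableSet_Ioi fun E hE => ?_
    have hE : E ≠ 0 := ne_of_gt hE
    simp only [pairKernel_zero_left T (lt_of_le_of_ne (le_of_lt ‹E ∈ Ioi 0›) hE.symm),
      thermalTanh_of_ne hT.ne']
    field_simp
  rw [h1, h2]

theorem isPositiveGap_iff {U tz T Δ : ℝ} (htz : 0 < tz) :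
    IsPositiveGap U tz T Δ ↔ 0 < Δ ∧ 1 = U * pairIntegral tz Δ T := by
  refine and_congr_right fun hΔ => ?_
  have hs : Measurable fun E : ℝ => √(Δ ^ 2 + E ^ 2) := by fun_prop
  have hm : Measurable fun E => U * thermalTanh (√(Δ ^ 2 + E ^ 2)) T / (2 * √(Δ ^ 2 + E ^ 2)) :=
    (((measurable_thermalTanh T).comp hs).const_mul U).div (hs.const_mul 2)
  have h1 := integral_band_of_even htz hm fun E => by simp only [sq_abs]
  have h2 : 2 * ∫ E in Ioi 0, dos tz E *
      (U * thermalTanh (√(Δ ^ 2 + E ^ 2)) T / (2 * √(Δ ^ 2 + E ^ 2))) =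
      U * pairIntegral tz Δ T := by
    rw [pairIntegral, ← integral_const_mul, ← integral_const_mul]
    refine setIntegral_congr_fun measurableSet_Ioi fun E hE => ?_
    have := sqrt_sq_add_sq_pos Δ hE
    simp only [pairKernel]
    field_simp
  rw [h1, h2]
  constructor
  · intro h
    exact mul_left_cancel₀ hΔ.ne' (by rwa [mul_one])
  · intro h
    rw [← h, mul_one]

theorem existsUnique_isNeelTemperature {U tz : ℝ} (hU : 0 < U) (htz : tz ∈ Ioo (0 : ℝ) 2) :
    ∃! T, IsNeelTemperature U tz T := by
  obtain ⟨T₁, hT₁, hT₁', h1⟩ := exists_le_pairIntegral htz (1 / U)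
  set I := ∫ ε in Ioi (0 : ℝ), dos tz ε with hI
  have hI0 : 0 ≤ I := integral_nonneg fun ε => dos_nonneg htz.1 ε
  -- The energy integral is at most I/(2T), hence at most 1/U at T₂; the summand 1 ensures T₁ ≤ T₂.
  set T₂ := 1 + U * I with hT₂
  have hT₂1 : 1 ≤ T₂ := by have := mul_nonneg hU.le hI0; linarith
  have h2 : pairIntegral tz 0 T₂ ≤ 1 / U := by
    have hT₂0 : 0 < T₂ := by linarith
    refine (pairIntegral_le htz hT₂0.le (.inr hT₂0) (pairKernel_le_half_inv 0 hT₂0)).trans ?_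
    rw [mul_one_div, div_le_div_iff₀ (by positivity) hU]
    nlinarith [mul_nonneg hU.le hI0]
  have hc : ContinuousOn (fun T => pairIntegral tz 0 T) (Icc T₁ T₂) := fun T hT =>
    (continuousAt_pairIntegral_temp htz (hT₁.trans_le hT.1)).continuousWithinAt
  obtain ⟨T, hT, hT'⟩ := intermediate_value_Icc' (hT₁'.trans hT₂1) hc ⟨h2, h1⟩
  have hT0 := hT₁.trans_le hT.1
  refine ⟨T, (isNeelTemperature_iff htz.1).2 ⟨hT0, ?_⟩, fun T' h => ?_⟩
  · simp only at hT'
    rw [hT']; field_simp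
  · obtain ⟨hT'0, h⟩ := (isNeelTemperature_iff htz.1).1 h
    have h3 : pairIntegral tz 0 T' = pairIntegral tz 0 T := by
      simp only at hT'
      rw [hT', eq_div_iff hU.ne', mul_comm]; exact h.symm
    by_contra hne
    rcases lt_or_gt_of_ne hne with hlt | hlt
    · exact (pairIntegral_lt_of_temp_lt htz hT'0.le hlt (x := 0) (.inr hT'0)).ne h3.symm
    · exact (pairIntegral_lt_of_temp_lt htz hT0.le hlt (x := 0) (.inr hT0)).ne h3

theorem isNeelTemperature_neelTemperature {U tz : ℝ} (hU : 0 < U) (htz : tz ∈ Ioo (0 : ℝ) 2) :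
    IsNeelTemperature U tz (neelTemperature U tz) :=
  Classical.epsilon_spec (existsUnique_isNeelTemperature hU htz).exists

theorem neelTemperature_pos {U tz : ℝ} (hU : 0 < U) (htz : tz ∈ Ioo (0 : ℝ) 2) :
    0 < neelTemperature U tz := (isNeelTemperature_neelTemperature hU htz).1

theorem pairIntegral_neelTemperature {U tz : ℝ} (hU : 0 < U) (htz : tz ∈ Ioo (0 : ℝ) 2) :
    pairIntegral tz 0 (neelTemperature U tz) = 1 / U := by
  rw [eq_div_iff hU.ne', mul_comm]
  exact ((isNeelTemperature_iff htz.1).1 (isNeelTemperature_neelTemperature hU htz)).2.symm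

theorem existsUnique_isPositiveGap {U tz : ℝ} (hU : 0 < U) (htz : tz ∈ Ioo (0 : ℝ) 2) {T : ℝ}
    (hT : T ∈ Ico 0 (neelTemperature U tz)) : ∃! Δ, IsPositiveGap U tz T Δ := by
  have hN := neelTemperature_pos hU htz
  have hNe := pairIntegral_neelTemperature hU htz
  -- T may be 0, where the zero-gap integrand has a 1/ε singularity. At the positive temperature T'
  -- the integral is continuous at zero gap and exceeds 1/U; passing from T' down to T only
  -- increases it.
  set T' := max T (neelTemperature U tz / 2) with hT'
  have hT'0 : 0 < T' := lt_max_of_lt_right (half_pos hN)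
  have hT'N : T' < neelTemperature U tz := max_lt hT.2 (half_lt_self hN)
  have h1 : 1 / U < pairIntegral tz 0 T' := by
    rw [← hNe]; exact pairIntegral_lt_of_temp_lt htz hT'0.le hT'N (.inr hT'0)
  obtain ⟨δ, hδ, hδ'⟩ := Metric.eventually_nhds_iff.1
    ((continuousAt_pairIntegral htz hT'0.le (x := 0) (.inr hT'0)).eventually (lt_mem_nhds h1))
  have hδ2 := half_pos hδ
  have h2 : 1 / U ≤ pairIntegral tz (δ / 2) T := by
    refine (hδ' (by rw [Real.dist_eq, sub_zero, abs_of_pos hδ2]; linarith)).le.trans ?_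
    rcases (le_max_left T (neelTemperature U tz / 2)).eq_or_lt with he | hlt
    · exact (congrArg (pairIntegral tz (δ / 2)) he.symm).le
    · exact (pairIntegral_lt_of_temp_lt htz hT.1 hlt (.inl hδ2)).le
  set I := ∫ ε in Ioi (0 : ℝ), dos tz ε with hI
  have hI0 : 0 ≤ I := integral_nonneg fun ε => dos_nonneg htz.1 ε
  set Δ₂ := δ / 2 + U * I with hΔ₂
  have hΔ : δ / 2 ≤ Δ₂ := by have := mul_nonneg hU.le hI0; linarith
  have h3 : pairIntegral tz Δ₂ T ≤ 1 / U := by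
    have hΔ₂0 : 0 < Δ₂ := by linarith
    refine (pairIntegral_le htz hT.1 (.inl hΔ₂0) (pairKernel_le_inv_left hΔ₂0 T)).trans ?_
    rw [mul_one_div, div_le_div_iff₀ (by positivity) hU]
    nlinarith [mul_nonneg hU.le hI0]
  have hc : ContinuousOn (fun x => pairIntegral tz x T) (Icc (δ / 2) Δ₂) := fun x hx =>
    (continuousAt_pairIntegral htz hT.1 (.inl (hδ2.trans_le hx.1))).continuousWithinAt
  obtain ⟨x, hx, hx'⟩ := intermediate_value_Icc' hΔ hc ⟨h3, h2⟩
  have hx0 := hδ2.trans_le hx.1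
  simp only at hx'
  refine ⟨x, (isPositiveGap_iff htz.1).2 ⟨hx0, by rw [hx']; field_simp⟩, fun x' h => ?_⟩
  obtain ⟨hx'0, h⟩ := (isPositiveGap_iff htz.1).1 h
  have h4 : pairIntegral tz x' T = pairIntegral tz x T := by
    rw [hx', eq_div_iff hU.ne', mul_comm]; exact h.symm
  by_contra hne
  rcases lt_or_gt_of_ne hne with hlt | hlt
  · exact (pairIntegral_lt_of_lt htz hx'0.le hlt hT.1 (.inl hx'0)).ne h4.symm
  · exact (pairIntegral_lt_of_lt htz hx0.le hlt hT.1 (.inl hx0)).ne h4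

theorem isPositiveGap_gapAF {U tz : ℝ} (hU : 0 < U) (htz : tz ∈ Ioo (0 : ℝ) 2) {T : ℝ}
    (hT : T ∈ Ico 0 (neelTemperature U tz)) : IsPositiveGap U tz T (gapAF U tz T) := by
  have h := (existsUnique_isPositiveGap hU htz hT).exists
  rw [gapAF, dif_pos h]
  exact h.choose_spec

theorem integrableOn_subleadingIntegrand {U tz y : ℝ} (htz : tz ∈ Ioo (0 : ℝ) 2)
    (hy : y ∈ Ico (0 : ℝ) 1) : IntegrableOn (subleadingIntegrand U tz y) (Ioi 0) := by
  obtain ⟨C, _, hC⟩ := exists_dos_bounds htz.1 htz.2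
  have hb : ∀ E, |(dos tz E - dos tz 0) / dos tz 0| ≤ C / dos tz 0 := fun E => by
    rw [abs_div, abs_of_pos (dos_zero_pos htz)]
    have h0 := dos_zero_pos htz
    gcongr
    have := (hC tz ⟨le_rfl, le_rfl⟩ E).1
    have := (hC tz ⟨le_rfl, le_rfl⟩ 0).1
    have := dos_nonneg htz.1 E
    rw [abs_le]; constructor <;> linarith
  have hf := fBCS_pos hy
  have hm := (continuous_dos htz.1).measurable
  unfold subleadingIntegrand
  exact (integrableOn_bcsKernel hf.le hy.1 (.inl hf)).bdd_mul
    (Measurable.aestronglyMeasurable (by fun_prop)) (ae_of_all _ fun ε => hb _)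

end

end HubbardAF

namespace HubbardAF

open Real Set Filter Topology MeasureTheory

noncomputable section

/-! ### Perturbation of the BCS gap equation by a small weight -/

/-- For gaps in [c, X] the thermal defect is at least tanhDefect(c/2), uniformly in y, and the
remaining factor dominates a multiple of the zero-temperature slope at X. -/
theorem exists_le_bcsSlope {c X : ℝ} (hc : 0 < c) (hX : 0 < X) :
    ∃ a > 0, ∀ x ∈ Icc c X, ∀ y ∈ Icc (0 : ℝ) 1, a ≤ bcsSlope x y := by
  have hd := tanhDefect_pos (half_pos hc)
  refine ⟨tanhDefect (c / 2) * c / X * bcsSlope X 0,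
    mul_pos (by positivity) (bcsSlope_pos hX le_rfl), fun x hx y hy => ?_⟩
  have hx0 := hc.trans_le hx.1
  unfold bcsSlope
  rw [← integral_const_mul]
  refine setIntegral_mono_on ((integrableOn_pairSlope hX le_rfl).const_mul _)
    (integrableOn_pairSlope hx0 hy.1) measurableSet_Ioi fun ε hε => ?_
  have h1 := pairSlope_le hX.le le_rfl hε
  have hs := sqrt_sq_add_sq_pos x hε
  have h2 := tanhDefect_half_le_thermalDefect hc.le
    (hx.1.trans (le_sqrt_sq_add_sq' x ε)) hy.1 hy.2
  calc tanhDefect (c / 2) * c / X * pairSlope X 0 ε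
      ≤ tanhDefect (c / 2) * c / X * (X / √(X ^ 2 + ε ^ 2) ^ 3) := by gcongr
    _ = tanhDefect (c / 2) * c / √(X ^ 2 + ε ^ 2) ^ 3 := by field_simp
    _ ≤ thermalDefect (√(x ^ 2 + ε ^ 2)) y * x / √(x ^ 2 + ε ^ 2) ^ 3 := by
      have h3 : 0 ≤ thermalDefect (√(x ^ 2 + ε ^ 2)) y := hd.le.trans h2
      gcongr
      · exact hx.1
      · exact hx.2

variable {w : ℝ → ℝ} {B W : ℝ}

theorem integrableOn_weight_mul (hw : Measurable w) (hB : ∀ ε, 0 < ε → |w ε| ≤ B) {f : ℝ → ℝ}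
    (hf : IntegrableOn f (Ioi 0)) : IntegrableOn (fun ε => w ε * f ε) (Ioi 0) :=
  hf.bdd_mul hw.aestronglyMeasurable
    ((ae_restrict_iff' measurableSet_Ioi).2 (ae_of_all _ fun ε hε => hB ε hε))

theorem abs_integral_weight_mul_le (hw : Measurable w) (hB : ∀ ε, 0 < ε → |w ε| ≤ B)
    (hW : ∫ ε in Ioi (0 : ℝ), |w ε| * ((1 + ε) ^ 3)⁻¹ ≤ W) {f : ℝ → ℝ} {D : ℝ}
    (hf : ∀ ε, 0 < ε → |f ε| ≤ D * ((1 + ε) ^ 3)⁻¹) :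
    |∫ ε in Ioi (0 : ℝ), w ε * f ε| ≤ D * W := by
  have hD : 0 ≤ D := by
    have := (abs_nonneg _).trans (hf 1 one_pos)
    exact nonneg_of_mul_nonneg_left this (by positivity)
  have hi := integrableOn_weight_mul (w := fun ε => |w ε|) hw.abs
    (fun ε hε => (abs_abs _).trans_le (hB ε hε)) (integrableOn_inv_one_add_pow 1 le_rfl)
  have h := norm_integral_le_of_norm_le (f := fun ε => w ε * f ε) (hi.const_mul D)
    ((ae_restrict_iff' measurableSet_Ioi).2 (ae_of_all _ fun ε hε => by
      rw [Real.norm_eq_abs, abs_mul]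
      calc |w ε| * |f ε| ≤ |w ε| * (D * ((1 + ε) ^ 3)⁻¹) := by gcongr; exact hf ε hε
        _ = _ := by ring))
  rw [integral_const_mul] at h
  exact h.trans (mul_le_mul_of_nonneg_left hW hD)

/-- `J(x, y)` with the additional weight `1 + w` under the integral. -/
def weightedBcsIntegral (w : ℝ → ℝ) (x y : ℝ) : ℝ :=
  ∫ ε in Ioi (0 : ℝ), (1 + w ε) * bcsKernel x y ε

theorem weightedBcsIntegral_eq (hw : Measurable w) (hB : ∀ ε, 0 < ε → |w ε| ≤ B) {x y : ℝ}
    (hx : 0 < x) (hy : 0 ≤ y) : weightedBcsIntegral w x y =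
      bcsIntegral x y + ∫ ε in Ioi (0 : ℝ), w ε * bcsKernel x y ε := by
  have hK := integrableOn_bcsKernel hx.le hy (.inl hx)
  unfold weightedBcsIntegral bcsIntegral
  rw [← integral_add hK (integrableOn_weight_mul hw hB hK)]
  simp only [add_mul, one_mul]

/-- Nonnegativity of 1 + w preserves monotonicity. It confines the root near the unperturbed gap
without any a priori bound on the root. -/
theorem weightedBcsIntegral_antitone (hw : Measurable w) (hB : ∀ ε, 0 < ε → |w ε| ≤ B)
    (h1 : ∀ ε, 0 < ε → 0 ≤ 1 + w ε) {x x' y : ℝ} (hx : 0 < x) (h : x ≤ x') (hy : 0 ≤ y) :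
    weightedBcsIntegral w x' y ≤ weightedBcsIntegral w x y := by
  have hx' := hx.trans_le h
  have hi : ∀ {z}, 0 < z → IntegrableOn (fun ε => (1 + w ε) * bcsKernel z y ε) (Ioi 0) := by
    intro z hz
    refine integrableOn_weight_mul (B := 1 + B) (hw.const_add 1) (fun ε hε => ?_)
      (integrableOn_bcsKernel hz.le hy (.inl hz))
    exact (abs_add_le _ _).trans (by rw [abs_one]; linarith [hB ε hε])
  refine setIntegral_mono_on (hi hx') (hi hx) measurableSet_Ioi fun ε hε => ?_
  refine mul_le_mul_of_nonneg_left ?_ (h1 ε hε)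
  rw [bcsKernel_eq _ _ hε, bcsKernel_eq _ _ hε]
  exact sub_le_sub_right (pairKernel_le_of_le hx.le h hy hε) _

/-- First-order expansion of the solution of the weighted gap equation, uniformly for reduced
temperatures bounded away from `1`. -/
theorem exists_abs_sub_fBCS_sub_le {y₁ : ℝ} (hy₁ : y₁ ∈ Ico (0 : ℝ) 1) :
    ∃ C > 0, ∃ δ > 0, ∀ y ∈ Icc 0 y₁, ∀ (w : ℝ → ℝ) (B W : ℝ), Measurable w →
      (∀ ε, 0 < ε → |w ε| ≤ B) → (∀ ε, 0 < ε → 0 ≤ 1 + w ε) → 0 < W → W ≤ δ →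
      ∫ ε in Ioi (0 : ℝ), |w ε| * ((1 + ε) ^ 3)⁻¹ ≤ W →
      ∀ x, 0 < x → weightedBcsIntegral w x y = 0 →
        |x - (fBCS y + (fBCS y - y * fBCSDeriv y) *
          ∫ ε in Ioi (0 : ℝ), w ε * bcsKernel (fBCS y) y ε)| ≤ C * W ^ 2 := by
  have hf₁ := fBCS_pos hy₁
  have hZ := zeroTempGap_pos
  set c := fBCS y₁ / 2 with hc
  have hc0 : 0 < c := half_pos hf₁
  set X := zeroTempGap + 1 with hX
  obtain ⟨a, ha, hslope⟩ := exists_le_bcsSlope hc0 (X := X) (by positivity)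
  -- D, L and S bound the kernel, the Taylor remainder of J and the slope for gaps in [c, X]. With κ
  -- = 4D/a and η = κW, the perturbation is at most DW = aη/4.
  set D := 8 * (1 / c + 4 * 1 ^ 2 + X ^ 2 + 4) with hD
  set L := 3 * (2 * (1 + 1 / c)) ^ 3 with hL
  set S := X * (2 * (1 + 1 / c)) ^ 3 with hS
  set κ := 4 * D / a with hκ
  have hD0 : 0 < D := by positivity
  have hL0 : 0 < L := by positivity
  have hS0 : 0 < S := by positivity
  have hκ0 : 0 < κ := by positivity
  -- η ≤ r keeps f ± η inside [c, X] and makes the quadratic remainder Lη² at most half of the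
  -- linear term aη.
  set r := min c (min 1 (a / (2 * L))) with hr
  have hr0 : 0 < r := lt_min hc0 (lt_min one_pos (by positivity))
  refine ⟨(L * κ ^ 2 + S * κ + 2 * L * κ * r) / a, by positivity, r / κ, by positivity,
    fun y hy w B W hw hB h1 hW0 hWδ hW x hx hroot => ?_⟩
  have hyI : y ∈ Ico (0 : ℝ) 1 := ⟨hy.1, hy.2.trans_lt hy₁.2⟩
  have hyI' : y ∈ Icc (0 : ℝ) 1 := Ico_subset_Icc_self hyI
  set η := κ * W with hη
  have hη0 : 0 < η := by positivity
  have hηr : η ≤ r := by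
    rw [hη, mul_comm]; exact (le_div_iff₀ hκ0).1 hWδ
  have hηc : η ≤ c := hηr.trans (min_le_left _ _)
  have hη1 : η ≤ 1 := hηr.trans ((min_le_right _ _).trans (min_le_left _ _))
  have hηa : L * η ≤ a / 2 := by
    have : η ≤ a / (2 * L) := hηr.trans ((min_le_right _ _).trans (min_le_right _ _))
    calc L * η ≤ L * (a / (2 * L)) := by gcongr
      _ = a / 2 := by field_simp
  have hfl : 2 * c ≤ fBCS y := by
    rw [hc, mul_div_cancel₀ _ (two_ne_zero' ℝ)]
    exact fBCS_antitoneOn hyI' (Ico_subset_Icc_self hy₁) hy.2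
  have hfu : fBCS y + 1 ≤ X := by
    have := fBCS_le_zeroTempGap hyI'
    linarith
  have hJ := bcsIntegral_fBCS hyI'
  have hder := fBCS_sub_mul_deriv_mul_bcsSlope hyI
  set f := fBCS y with hf
  have hf0 : 0 < f := by linarith
  have hA : a ≤ bcsSlope f y := hslope f ⟨by linarith, by linarith⟩ y hyI'
  set A := bcsSlope f y with hAdef
  have hK : ∀ z ∈ Icc c X, ∀ ε, 0 < ε → |bcsKernel z y ε| ≤ D * ((1 + ε) ^ 3)⁻¹ := by
    intro z hz ε hε
    refine abs_bcsKernel_le (hc0.le.trans hz.1) hz.2 hyI.1 hyI.2.le hε ?_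
    refine (pairKernel_le_inv_left (hc0.trans_le hz.1) y ε).trans ?_
    have := hz.1
    gcongr
  have hR : ∀ z ∈ Icc c X, |∫ ε in Ioi (0 : ℝ), w ε * bcsKernel z y ε| ≤ D * W := fun z hz =>
    abs_integral_weight_mul_le hw hB hW (hK z hz)
  have hT : ∀ z ∈ Icc c X, |bcsIntegral z y + A * (z - f)| ≤ L * (z - f) ^ 2 := fun z hz => by
    have := bcsIntegral_taylor hc0 hz.1 (x' := f) (by linarith) hyI.1
    rwa [hJ, sub_zero] at this
  have hDW : D * W = a * η / 4 := by rw [hη, hκ]; field_simp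
  have haη : 0 < a * η := by positivity
  have hAη : a * η ≤ A * η := by gcongr
  have hLη : L * η ^ 2 ≤ a * η / 2 := by
    calc L * η ^ 2 = L * η * η := by ring
      _ ≤ a / 2 * η := by gcongr
      _ = _ := by ring
  -- At f − η the weighted integral is at least aη − aη/2 − aη/4 > 0, so by monotonicity the root
  -- cannot lie to the left; symmetrically at f + η.
  have hlow : f - η ≤ x := by
    by_contra! hlt
    have hm : f - η ∈ Icc c X := ⟨by linarith, by linarith⟩
    have h2 := weightedBcsIntegral_antitone hw hB h1 hx hlt.le hyI.1
    rw [hroot, weightedBcsIntegral_eq hw hB (hc0.trans_le hm.1) hyI.1] at h2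
    have h3 := (abs_le.1 (hT _ hm)).1
    have h4 := (abs_le.1 (hR _ hm)).1
    rw [sub_sub_cancel_left, neg_sq] at h3
    linarith
  have hupp : x ≤ f + η := by
    by_contra! hlt
    have hm : f + η ∈ Icc c X := ⟨by linarith, by linarith⟩
    have h2 := weightedBcsIntegral_antitone hw hB h1 (by linarith) hlt.le hyI.1
    rw [hroot, weightedBcsIntegral_eq hw hB (hc0.trans_le hm.1) hyI.1] at h2
    have h3 := (abs_le.1 (hT _ hm)).2
    have h4 := (abs_le.1 (hR _ hm)).2
    rw [add_sub_cancel_left] at h3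
    linarith
  have hxI : x ∈ Icc c X := ⟨by linarith, by linarith⟩
  have hfI : f ∈ Icc c X := ⟨by linarith, by linarith⟩
  have hd : |x - f| ≤ η := abs_le.2 ⟨by linarith, by linarith⟩
  have hd2 : (x - f) ^ 2 ≤ η ^ 2 := by
    rw [← sq_abs]; gcongr
  have hPs := abs_integral_weight_mul_le hw hB hW (f := pairSlope f y) (D := S) fun ε hε => by
    refine (pairSlope_le_decay hf0 hyI.1 hε).trans ?_
    have : f ≤ X := hfI.2
    have : c ≤ f := hfI.1
    rw [hS]
    gcongr
  have hTw := abs_integral_weight_mul_le hw hB hW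
    (f := fun ε => pairKernel x y ε - pairKernel f y ε + pairSlope f y ε * (x - f))
    (D := 2 * L * η ^ 2) fun ε hε => by
      refine (abs_pairKernel_taylor_le_decay hc0 hxI.1 hfI.1 hyI.1 hε).trans ?_
      rw [show 2 * L = 6 * (2 * (1 + 1 / c)) ^ 3 by rw [hL]; ring]
      gcongr
  have hKx := integrableOn_weight_mul hw hB (integrableOn_bcsKernel hx.le hyI.1 (.inl hx))
  have hKf := integrableOn_weight_mul hw hB (integrableOn_bcsKernel hf0.le hyI.1 (.inl hf0))
  have hPi := integrableOn_weight_mul hw hB (integrableOn_pairSlope hf0 hyI.1)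
  have hsplit : ∫ ε in Ioi (0 : ℝ),
        w ε * (pairKernel x y ε - pairKernel f y ε + pairSlope f y ε * (x - f)) =
      (∫ ε in Ioi (0 : ℝ), w ε * bcsKernel x y ε) - (∫ ε in Ioi (0 : ℝ), w ε * bcsKernel f y ε) +
        (∫ ε in Ioi (0 : ℝ), w ε * pairSlope f y ε) * (x - f) := by
    rw [← integral_mul_const, ← integral_sub hKx hKf,
      ← integral_add (f := fun ε => w ε * bcsKernel x y ε - w ε * bcsKernel f y ε)
        (hKx.sub hKf) (hPi.mul_const _)]
    refine setIntegral_congr_fun measurableSet_Ioi fun ε hε => ?_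
    simp only [bcsKernel_eq _ _ hε]
    ring
  rw [hsplit] at hTw
  rw [weightedBcsIntegral_eq hw hB hx hyI.1] at hroot
  have hTx := hT x hxI
  set R := ∫ ε in Ioi (0 : ℝ), w ε * bcsKernel f y ε
  set Rx := ∫ ε in Ioi (0 : ℝ), w ε * bcsKernel x y ε
  set P := ∫ ε in Ioi (0 : ℝ), w ε * pairSlope f y ε
  have hA0 : 0 < A := ha.trans_le hA
  -- With |x − f| = O(W) known, the three errors are all O(W²): the Taylor remainder of J, the
  -- weighted Taylor remainder of the kernel, and the weighted slope times x − f.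
  have hkey : |A * (x - f) - R| ≤ (L * κ ^ 2 + S * κ + 2 * L * κ * r) * W ^ 2 := by
    have e : A * (x - f) - R = (bcsIntegral x y + A * (x - f)) + (Rx - R + P * (x - f)) -
        P * (x - f) := by linear_combination (-1 : ℝ) * hroot
    have b1 : L * (x - f) ^ 2 ≤ L * η ^ 2 := by gcongr
    have b2 : |P * (x - f)| ≤ S * W * η := by
      rw [abs_mul]; gcongr
    have b3 : 2 * L * η ^ 2 * W ≤ 2 * L * (η * r) * W := by
      rw [sq]; gcongr
    calc |A * (x - f) - R| ≤ L * η ^ 2 + 2 * L * (η * r) * W + S * W * η := by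
          rw [e]
          refine (abs_sub _ _).trans (add_le_add ((abs_add_le _ _).trans (add_le_add ?_ ?_)) b2)
          · exact hTx.trans b1
          · exact hTw.trans b3
      _ = _ := by rw [hη]; ring
  have hq : f - y * fBCSDeriv y = 1 / A := (eq_div_iff hA0.ne').2 hder
  have e : x - (f + (f - y * fBCSDeriv y) * R) = (A * (x - f) - R) / A := by
    rw [hq]; field_simp; ring
  rw [e, abs_div, abs_of_pos hA0, div_mul_eq_mul_div]
  gcongr

end

end HubbardAF

namespace HubbardAF

open Real Set Filter Topology MeasureTheory

noncomputable section

/-! ### Weak-coupling asymptotics -/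

/-- The range is cut at ε = 1/τ. Below it the quadratic bound leaves τ²/(1 + ε), whose integral is
the logarithm responsible for the factor U⁻¹; above it boundedness of w and the cubic decay give
O(τ²). -/
theorem integral_weight_le {w : ℝ → ℝ} (hw : Measurable w) {C τ : ℝ} (hτ : 0 < τ) (hτ1 : τ ≤ 1)
    (h : ∀ ε, 0 < ε → |w ε| ≤ C) (h2 : ∀ ε, 0 < ε → |w ε| ≤ C * (τ * ε) ^ 2) :
    ∫ ε in Ioi (0 : ℝ), |w ε| * ((1 + ε) ^ 3)⁻¹ ≤ C * τ ^ 2 * (2 - log τ) := by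
  have hC : 0 ≤ C := (abs_nonneg _).trans (h 1 one_pos)
  have hi := integrableOn_weight_mul (w := fun ε => |w ε|) hw.abs
    (fun ε hε => (abs_abs _).trans_le (h ε hε)) (integrableOn_inv_one_add_pow 1 le_rfl)
  have hR : 0 < 1 / τ := by positivity
  have hsub1 : Ioc 0 (1 / τ) ⊆ Ioi 0 := Ioc_subset_Ioi_self
  have hsub2 : Ioi (1 / τ) ⊆ Ioi 0 := Ioi_subset_Ioi hR.le
  rw [← Ioc_union_Ioi_eq_Ioi hR.le, setIntegral_union Ioc_disjoint_Ioi_same measurableSet_Ioi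
    (hi.mono_set hsub1) (hi.mono_set hsub2)]
  have hinv : IntervalIntegrable (fun ε : ℝ => C * τ ^ 2 * (1 + ε)⁻¹) volume 0 (1 / τ) := by
    refine (ContinuousOn.intervalIntegrable ?_)
    rw [uIcc_of_le hR.le]
    refine continuousOn_const.mul (ContinuousOn.inv₀ (by fun_prop) fun ε hε => ?_)
    have := hε.1
    positivity
  have b1 : ∫ ε in Ioc 0 (1 / τ), |w ε| * ((1 + ε) ^ 3)⁻¹ ≤ C * τ ^ 2 * (1 - log τ) := by
    calc _ ≤ ∫ ε in Ioc 0 (1 / τ), C * τ ^ 2 * (1 + ε)⁻¹ := by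
          refine setIntegral_mono_on (hi.mono_set hsub1)
            ((intervalIntegrable_iff_integrableOn_Ioc_of_le hR.le).1 hinv) measurableSet_Ioc
            fun ε hε => ?_
          have hε0 := hε.1
          calc |w ε| * ((1 + ε) ^ 3)⁻¹ ≤ C * (τ * ε) ^ 2 * ((1 + ε) ^ 3)⁻¹ := by
                gcongr; exact h2 ε hε0
            _ = C * τ ^ 2 * (ε ^ 2 * ((1 + ε) ^ 3)⁻¹) := by ring
            _ ≤ C * τ ^ 2 * ((1 + ε) ^ 2 * ((1 + ε) ^ 3)⁻¹) := by gcongr; linarith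
            _ = _ := by field_simp
      _ = C * τ ^ 2 * log (1 + 1 / τ) := by
          rw [← intervalIntegral.integral_of_le hR.le, intervalIntegral.integral_const_mul,
            intervalIntegral.integral_comp_add_left (fun x : ℝ => x⁻¹),
            integral_inv_of_pos (by norm_num) (by positivity)]
          simp
      _ ≤ _ := by
          gcongr
          calc log (1 + 1 / τ) ≤ log (2 / τ) := by
                refine log_le_log (by positivity) ?_
                rw [show 2 / τ = 1 / τ + 1 / τ by ring]
                gcongr
                exact (one_le_div hτ).2 hτ1
            _ = log 2 - log τ := log_div two_ne_zero hτ.ne'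
            _ ≤ 1 - log τ := by linarith [log_two_lt_d9]
  have b2 : ∫ ε in Ioi (1 / τ), |w ε| * ((1 + ε) ^ 3)⁻¹ ≤ C * τ ^ 2 := by
    calc _ ≤ ∫ ε in Ioi (1 / τ), C * ((1 + ε) ^ (1 + 2))⁻¹ := by
          refine setIntegral_mono_on (hi.mono_set hsub2)
            ((integrableOn_inv_one_add_pow 1 hR.le).const_mul C) measurableSet_Ioi fun ε hε => ?_
          have hε0 : 0 < ε := hsub2 hε
          gcongr
          exact h ε hε0
      _ = C * (((1 + 1 / τ) ^ 2)⁻¹ / 2) := by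
          rw [integral_const_mul, integral_inv_one_add_pow 1 hR.le]; norm_num
      _ ≤ C * (((1 / τ) ^ 2)⁻¹ / 1) := by
          gcongr
          · linarith
          · norm_num
      _ = _ := by field_simp
  linarith

/-- The relative deviation of the rescaled density of states from its value at `0`. -/
def relDos (tz τ ε : ℝ) : ℝ := (dos tz (τ * ε) - dos tz 0) / dos tz 0

theorem measurable_relDos {tz : ℝ} (htz : 0 < tz) (τ : ℝ) : Measurable (relDos tz τ) :=
  ((((continuous_dos htz).comp (continuous_const_mul τ)).sub continuous_const).div_const
    _).measurable

theorem one_add_relDos {tz : ℝ} (htz : tz ∈ Ioo (0 : ℝ) 2) (τ ε : ℝ) :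
    1 + relDos tz τ ε = dos tz (τ * ε) / dos tz 0 := by
  have := (dos_zero_pos htz).ne'
  unfold relDos; field_simp; ring

/-- The gap equation in units of the Néel temperature. -/
theorem weightedBcsIntegral_gapAF {U tz T : ℝ} (hU : 0 < U) (htz : tz ∈ Ioo (0 : ℝ) 2)
    (hT : T ∈ Ico 0 (neelTemperature U tz)) :
    weightedBcsIntegral (relDos tz (neelTemperature U tz)) (gapRatio U tz T)
      (T / neelTemperature U tz) = 0 := by
  have hτ := neelTemperature_pos hU htz
  have h1 := pairIntegral_neelTemperature hU htz
  obtain ⟨hΔ, h2⟩ := (isPositiveGap_iff htz.1).1 (isPositiveGap_gapAF hU htz hT)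
  unfold gapRatio
  set Δ := gapAF U tz T
  set τ := neelTemperature U tz
  -- Both integrals equal 1/U, so their difference vanishes. Rescaling energies by τ and dividing by
  -- N(0) then gives the weighted equation.
  have h3 := (pairIntegral_sub htz hT.1 (.inl hΔ) hτ.le (x' := 0) (.inr hτ)).2
  have h2' : pairIntegral tz Δ T = 1 / U := by rw [eq_div_iff hU.ne', mul_comm, ← h2]
  rw [h1, h2', sub_self] at h3
  have h4 := integral_comp_mul_left_Ioi
    (fun ε => dos tz ε * (pairKernel Δ T ε - pairKernel 0 τ ε)) 0 hτ
  rw [mul_zero, ← h3, smul_zero] at h4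
  have hN := (dos_zero_pos htz).ne'
  refine (mul_eq_zero.1 (Eq.trans ?_ h4)).resolve_left (div_ne_zero hN hτ.ne')
  rw [weightedBcsIntegral, ← integral_const_mul]
  refine setIntegral_congr_fun measurableSet_Ioi fun ε hε => ?_
  have e1 := pairKernel_mul hτ (Δ / τ) (T / τ) ε
  have e2 := pairKernel_mul hτ 0 1 ε
  rw [mul_div_cancel₀ _ hτ.ne', mul_div_cancel₀ _ hτ.ne'] at e1
  rw [mul_zero, mul_one] at e2
  simp only [one_add_relDos htz, bcsKernel_eq _ _ hε, e1, e2]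
  field_simp

theorem abs_dos_sub_dos_zero_le {tz C : ℝ} (htz : 0 < tz) (hC : ∀ E, dos tz E ≤ C) (E : ℝ) :
    |dos tz E - dos tz 0| ≤ C :=
  abs_le.2 ⟨by linarith [dos_nonneg htz E, hC 0], by linarith [dos_nonneg htz 0, hC E]⟩

/-- The density vanishes for ε ≥ 8, so 1 + ε ≤ 9 on its support; the constant is (1/2) · 9³/2 =
182.25, rounded up. -/
theorem abs_pairIntegral_zero_one_le {tz C : ℝ} (htz : tz ∈ Ioo (0 : ℝ) 2)
    (hC : ∀ E, dos tz E ≤ C) : |pairIntegral tz 0 1| ≤ 183 * C := by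
  have hC0 : 0 ≤ C := (dos_nonneg htz.1 0).trans (hC 0)
  refine (abs_integral_le_of_abs_le_inv_one_add_pow 1 (C := C * (1 / 2) * 9 ^ 3)
    fun ε hε => ?_).trans (by norm_num; linarith)
  have h0 := dos_nonneg htz.1 ε
  have hp0 := pairKernel_nonneg 0 zero_le_one ε
  rw [abs_of_nonneg (mul_nonneg h0 hp0)]
  rcases le_total 8 ε with h | h
  · rw [dos_eq_zero htz h, zero_mul]; positivity
  · rw [← div_eq_mul_inv, le_div_iff₀ (by positivity)]
    have hp := pairKernel_le_half_inv 0 one_pos ε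
    rw [mul_one] at hp
    have := hC ε
    gcongr
    linarith

/-- Subtracting the energy integral at T = 1 and replacing N by N(0) leaves N(0)J(0, τ) = −N(0) log
τ, by the scaling law. The error is bounded because |N(ε) − N(0)|/ε is, which controls the kernel
near 0 uniformly in τ. The constant is 219 = 36 + 183. -/
theorem abs_inv_add_dos_mul_log_le {U tz C : ℝ} (hU : 0 < U) (htz : tz ∈ Ioo (0 : ℝ) 2)
    (hC : ∀ E, dos tz E ≤ C ∧ |dos tz E - dos tz 0| ≤ C * E ^ 2)
    (hτ1 : neelTemperature U tz ≤ 1) :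
    |1 / U + dos tz 0 * log (neelTemperature U tz)| ≤ 219 * C := by
  have hτ := neelTemperature_pos hU htz
  have h1 := pairIntegral_neelTemperature hU htz
  set τ := neelTemperature U tz
  have hC0 : 0 ≤ C := (dos_nonneg htz.1 0).trans (hC 0).1
  obtain ⟨hi, h3⟩ := pairIntegral_sub htz (x := 0) (x' := 0) hτ.le (.inr hτ) zero_le_one
    (.inr one_pos)
  have hK := integrableOn_bcsKernel (x := 0) le_rfl hτ.le (.inr hτ)
  have hJ : bcsIntegral 0 τ = -log τ := by
    have := bcsIntegral_mul hτ le_rfl zero_le_one (.inr one_pos)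
    rwa [mul_zero, mul_one, bcsIntegral_zero_one, zero_sub] at this
  have e : ∫ ε in Ioi (0 : ℝ), (dos tz ε - dos tz 0) * bcsKernel 0 τ ε =
      1 / U + dos tz 0 * log τ - pairIntegral tz 0 1 := by
    have : 1 / U + dos tz 0 * log τ - pairIntegral tz 0 1 =
        (∫ ε in Ioi (0 : ℝ), dos tz ε * (pairKernel 0 τ ε - pairKernel 0 1 ε)) -
          dos tz 0 * bcsIntegral 0 τ := by rw [hJ, ← h3, h1]; ring
    rw [this, bcsIntegral, ← integral_const_mul, ← integral_sub hi (hK.const_mul _)]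
    refine setIntegral_congr_fun measurableSet_Ioi fun ε hε => ?_
    simp only [bcsKernel_eq _ _ hε]
    ring
  have b : |∫ ε in Ioi (0 : ℝ), (dos tz ε - dos tz 0) * bcsKernel 0 τ ε| ≤ 36 * C := by
    refine (abs_integral_le_of_abs_le_inv_one_add_pow 1 (C := 72 * C)
      fun ε hε => ?_).trans_eq (by norm_num; ring)
    have hp : pairKernel 0 τ ε ≤ 1 / ε := by
      have := pairKernel_le_inv 0 τ ε
      rwa [zero_pow two_ne_zero, zero_add, Real.sqrt_sq hε.le] at this
    have hk := abs_bcsKernel_le le_rfl (X := 0) le_rfl hτ.le hτ1 hε hp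
    have hv := abs_dos_sub_dos_zero_le htz.1 (fun E => (hC E).1) ε
    have hv2 := (hC ε).2
    rw [abs_mul]
    set v := |dos tz ε - dos tz 0|
    have hv0 : 0 ≤ v := abs_nonneg _
    have hvε : v * (1 / ε) ≤ C := by
      rw [mul_one_div, div_le_iff₀ hε]
      rcases le_total ε 1 with h | h
      · exact hv2.trans (by rw [sq]; gcongr; exact mul_le_of_le_one_left hε.le h)
      · exact hv.trans (le_mul_of_one_le_right hC0 h)
    calc v * |bcsKernel 0 τ ε|
        ≤ v * (8 * (1 / ε + 4 * 1 ^ 2 + 0 ^ 2 + 4) * ((1 + ε) ^ 3)⁻¹) := by gcongr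
      _ = 8 * (v * (1 / ε) + 8 * v) * ((1 + ε) ^ 3)⁻¹ := by ring
      _ ≤ 8 * (C + 8 * C) * ((1 + ε) ^ 3)⁻¹ := by gcongr
      _ = _ := by ring
  have b2 := abs_pairIntegral_zero_one_le htz fun E => (hC E).1
  rw [e] at b
  calc |1 / U + dos tz 0 * log τ|
      = |(1 / U + dos tz 0 * log τ - pairIntegral tz 0 1) + pairIntegral tz 0 1| := by
        rw [sub_add_cancel]
    _ ≤ 36 * C + 183 * C := (abs_add_le _ _).trans (add_le_add b b2)
    _ = 219 * C := by ring

theorem neelTemperature_le_one {U tz C : ℝ} (hU : 0 < U) (htz : tz ∈ Ioo (0 : ℝ) 2)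
    (hC : ∀ E, dos tz E ≤ C) (h : 183 * C ≤ 1 / U) : neelTemperature U tz ≤ 1 := by
  by_contra! hlt
  have h1 := pairIntegral_lt_of_temp_lt htz zero_le_one hlt (x := 0) (.inr one_pos)
  rw [pairIntegral_neelTemperature hU htz] at h1
  linarith [(le_abs_self _).trans (abs_pairIntegral_zero_one_le htz hC)]

/-- The weight coming from the energy dependence of the density of states is of order
`U⁻¹ exp(-2 / (N(0) U))`. -/
theorem exists_integral_relDos_le {a B : ℝ} (ha : 0 < a) (hB : B < 2) :
    ∃ C > 0, ∃ U₀ > 0, ∃ N > 0, ∀ U, 0 < U → U < U₀ → ∀ tz ∈ Icc a B, dos tz 0 ≤ N ∧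
      (∀ ε, |relDos tz (neelTemperature U tz) ε| ≤ C) ∧
      ∫ ε in Ioi (0 : ℝ), |relDos tz (neelTemperature U tz) ε| * ((1 + ε) ^ 3)⁻¹ ≤
        C * (U⁻¹ * exp (-(2 / (dos tz 0 * U)))) := by
  obtain ⟨N, hN, hdos⟩ := exists_dos_bounds ha hB
  set m : ℝ := 1 / (π * √20) with hm
  have hm0 : 0 < m := by positivity
  set C₁ := 219 * N with hC₁
  set C := N / m + N / m * exp (2 * C₁ / m) * (2 + (C₁ + 1) / m) with hC
  -- U < 1/(183N) forces T_N ≤ 1, and U < 1 lets additive constants be absorbed into U⁻¹.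
  refine ⟨C, by positivity, min 1 (1 / (183 * N)), by positivity, N, hN, fun U hU hU₀ tz htz => ?_⟩
  have htz' : tz ∈ Ioo (0 : ℝ) 2 := ⟨ha.trans_le htz.1, htz.2.trans_lt hB⟩
  have hU1 : U ≤ 1 := hU₀.le.trans (min_le_left _ _)
  have hUN : 183 * N ≤ 1 / U := by
    rw [le_one_div (by positivity) hU]; exact hU₀.le.trans (min_le_right _ _)
  have hd := hdos tz htz
  have hτ1 := neelTemperature_le_one hU htz' (fun E => (hd E).1) hUN
  have hlog := abs_le.1 (abs_inv_add_dos_mul_log_le hU htz' hd hτ1)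
  have hτ := neelTemperature_pos hU htz'
  set τ := neelTemperature U tz
  have hn := le_dos_zero htz'
  set n := dos tz 0 with hn'
  have hn0 : 0 < n := hm0.trans_le hn
  have hw1 : ∀ ε, |relDos tz τ ε| ≤ N / m := fun ε => by
    rw [relDos, abs_div, abs_of_pos hn0]
    have := abs_dos_sub_dos_zero_le htz'.1 (fun E => (hd E).1) (τ * ε)
    gcongr
  have hw2 : ∀ ε, |relDos tz τ ε| ≤ N / m * (τ * ε) ^ 2 := fun ε => by
    rw [relDos, abs_div, abs_of_pos hn0, div_mul_eq_mul_div]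
    have := (hd (τ * ε)).2
    gcongr
  refine ⟨(hd 0).1, fun ε => (hw1 ε).trans ?_, ?_⟩
  · rw [hC, le_add_iff_nonneg_right]; positivity
  · have h := integral_weight_le (measurable_relDos htz'.1 τ) hτ hτ1 (fun ε _ => hw1 ε)
      fun ε _ => hw2 ε
    -- The upper bound on log τ gives the exponential factor and the lower bound gives U⁻¹. The
    -- lower bound m on N(0) makes the constants uniform in the hopping.
    have hτ2 : τ ^ 2 ≤ exp (2 * C₁ / m) * exp (-(2 / (n * U))) := by
      have e : τ ^ 2 = exp (2 * log τ) := by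
        rw [two_mul, exp_add, exp_log hτ, sq]
      rw [e, ← exp_add, exp_le_exp]
      have h1 : log τ ≤ C₁ / n - 1 / (n * U) := by
        have : C₁ / n - 1 / (n * U) = (C₁ - 1 / U) / n := by field_simp
        rw [this, le_div_iff₀ hn0]
        linarith [hlog.2]
      have h2 : 2 * C₁ / n ≤ 2 * C₁ / m := by gcongr
      have h3 : 2 * (C₁ / n - 1 / (n * U)) = 2 * C₁ / n + -(2 / (n * U)) := by ring
      linarith
    have hl : 2 - log τ ≤ (2 + (C₁ + 1) / m) * U⁻¹ := by
      have h1U : 1 ≤ U⁻¹ := (one_le_inv₀ hU).2 hU1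
      have h1 : -log τ ≤ (C₁ + 1 / U) / m := by
        calc -log τ ≤ (C₁ + 1 / U) / n := by
              rw [le_div_iff₀ hn0]; linarith [hlog.1]
          _ ≤ _ := by gcongr
      have h2 : (C₁ + 1 / U) / m ≤ (C₁ * U⁻¹ + U⁻¹) / m := by
        rw [one_div]; gcongr; exact le_mul_of_one_le_right (by positivity) h1U
      calc 2 - log τ ≤ 2 * U⁻¹ + (C₁ * U⁻¹ + U⁻¹) / m := by linarith
        _ = _ := by ring
    have hl0 : 0 ≤ 2 - log τ := by linarith [log_nonpos hτ.le hτ1]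
    calc _ ≤ N / m * τ ^ 2 * (2 - log τ) := h
      _ ≤ N / m * (exp (2 * C₁ / m) * exp (-(2 / (n * U)))) * ((2 + (C₁ + 1) / m) * U⁻¹) := by
        gcongr
      _ = N / m * exp (2 * C₁ / m) * (2 + (C₁ + 1) / m) * (U⁻¹ * exp (-(2 / (n * U)))) := by ring
      _ ≤ _ := by
        gcongr
        rw [hC, le_add_iff_nonneg_left]; positivity

theorem abs_gapRatio_sub_le {a B y₁ : ℝ} (ha : 0 < a) (hB : B < 2) (hy₁ : y₁ ∈ Ico (0 : ℝ) 1) :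
    ∃ C > 0, ∃ U₀ > 0, ∀ U : ℝ, 0 < U → U < U₀ → ∀ tz ∈ Icc a B, ∀ T : ℝ,
      T / neelTemperature U tz ∈ Icc 0 y₁ →
      |gapRatio U tz T - (fBCS (T / neelTemperature U tz) +
          subleading U tz (T / neelTemperature U tz))| ≤
        C * ((U ^ 2)⁻¹ * exp (-(4 / (dos tz 0 * U)))) := by
  obtain ⟨C₁, hC₁, δ, hδ, hmain⟩ := exists_abs_sub_fBCS_sub_le hy₁
  obtain ⟨C, hC, U₀, hU₀, N, hN, hw⟩ := exists_integral_relDos_le ha hB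
  refine ⟨C₁ * C ^ 2, by positivity, min U₀ (2 * δ / (C * N ^ 2)), by positivity,
    fun U hU hUlt tz htz T hy => ?_⟩
  have htz' : tz ∈ Ioo (0 : ℝ) 2 := ⟨ha.trans_le htz.1, htz.2.trans_lt hB⟩
  obtain ⟨hnN, hwb, hwi⟩ := hw U hU (hUlt.trans_le (min_le_left _ _)) tz htz
  have hτ := neelTemperature_pos hU htz'
  have hn0 := dos_zero_pos htz'
  have hT : T ∈ Ico 0 (neelTemperature U tz) := by
    refine ⟨by simpa [hτ.ne'] using mul_nonneg hy.1 hτ.le, ?_⟩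
    exact (div_lt_one hτ).1 (hy.2.trans_lt hy₁.2)
  have hroot := weightedBcsIntegral_gapAF hU htz' hT
  have hpos : 0 < gapRatio U tz T := div_pos (isPositiveGap_gapAF hU htz' hT).1 hτ
  set n := dos tz 0
  -- From eˢ ≥ s²/2 with s = 2/(nU), the weight is at most CUN²/2, which is at most δ by the choice
  -- of the threshold.
  have hWδ : C * (U⁻¹ * exp (-(2 / (n * U)))) ≤ δ := by
    have h1 : exp (-(2 / (n * U))) ≤ (n * U) ^ 2 / 2 := by
      have h2 := quadratic_le_exp_of_nonneg (show 0 ≤ 2 / (n * U) by positivity)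
      rw [exp_neg, inv_le_comm₀ (exp_pos _) (by positivity)]
      have h3 : ((n * U) ^ 2 / 2)⁻¹ = (2 / (n * U)) ^ 2 / 2 := by field_simp
      have : 0 ≤ 2 / (n * U) := by positivity
      linarith
    have hU' : U ≤ 2 * δ / (C * N ^ 2) := hUlt.le.trans (min_le_right _ _)
    rw [le_div_iff₀ (by positivity)] at hU'
    calc C * (U⁻¹ * exp (-(2 / (n * U)))) ≤ C * (U⁻¹ * ((n * U) ^ 2 / 2)) := by gcongr
      _ = U * (C * n ^ 2) / 2 := by field_simp
      _ ≤ U * (C * N ^ 2) / 2 := by gcongr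
      _ ≤ δ := by linarith
  have h := hmain _ hy (relDos tz (neelTemperature U tz)) C _ (measurable_relDos htz'.1 _)
    (fun ε _ => hwb ε)
    (fun ε _ => by
      rw [one_add_relDos htz']; exact div_nonneg (dos_nonneg htz'.1 _) (dos_nonneg htz'.1 _))
    (by positivity) hWδ hwi _ hpos hroot
  refine h.trans_eq ?_
  have he : exp (-(4 / (n * U))) = exp (-(2 / (n * U))) ^ 2 := by
    rw [← exp_nat_mul]; congr 1; push_cast; ring
  rw [he]; ring

theorem subleading_zero (U tz : ℝ) :
    subleading U tz 0 = π * exp (-eulerMascheroniConstant) *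
      ∫ ε in Ioi (0 : ℝ), (dos tz (neelTemperature U tz * ε) - dos tz 0) / dos tz 0 *
        (1 / √(π ^ 2 * exp (-2 * eulerMascheroniConstant) + ε ^ 2) - Real.tanh (ε / 2) / ε) := by
  have h : (π * exp (-eulerMascheroniConstant)) ^ 2 =
      π ^ 2 * exp (-2 * eulerMascheroniConstant) := by
    rw [mul_pow, ← exp_nat_mul]; congr 2; push_cast; ring
  simp only [subleading, subleadingIntegrand, bcsKernel, fBCS_zero, zeroTempGap, thermalTanh_zero,
    zero_mul, sub_zero, h]

theorem exists_Icc_of_isCompact {K : Set ℝ} {a b : ℝ} (hab : a < b) (hK : K ⊆ Ioo a b)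
    (hc : IsCompact K) : ∃ c d, a < c ∧ d < b ∧ K ⊆ Icc c d := by
  rcases K.eq_empty_or_nonempty with rfl | hne
  · obtain ⟨c, h1, h2⟩ := exists_between hab
    exact ⟨c, c, h1, h2, empty_subset _⟩
  · exact ⟨sInf K, sSup K, (hK (hc.sInf_mem hne)).1, (hK (hc.sSup_mem hne)).2,
      fun x hx => ⟨csInf_le hc.bddBelow hx, le_csSup hc.bddAbove hx⟩⟩

theorem exists_Icc_zero_of_isCompact {K : Set ℝ} (hK : K ⊆ Ico 0 1) (hc : IsCompact K) :
    ∃ y ∈ Ico (0 : ℝ) 1, K ⊆ Icc 0 y := by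
  rcases K.eq_empty_or_nonempty with rfl | hne
  · exact ⟨0, by simp, empty_subset _⟩
  · exact ⟨sSup K, hK (hc.sSup_mem hne), fun x hx => ⟨(hK hx).1, le_csSup hc.bddAbove hx⟩⟩

end

end HubbardAF

/-! ### The theorem -/

theorem theorem2p6 :
    -- all objects entering the expansion are well defined
    ((∀ tz ∈ Set.Ioo (0 : ℝ) 2, Differentiable ℝ (integratedDOS tz) ∧ 0 < dos tz 0) ∧
      (∀ U : ℝ, 0 < U → ∀ tz ∈ Set.Ioo (0 : ℝ) 2,
        (∃! T, IsNeelTemperature U tz T) ∧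
        ∀ T ∈ Set.Ico 0 (neelTemperature U tz), ∃! Δ, IsPositiveGap U tz T Δ) ∧
      (∀ y ∈ Set.Icc (0 : ℝ) 1, ∃! x, IsBCSGap y x) ∧
      (∀ y ∈ Set.Ico (0 : ℝ) 1, DifferentiableWithinAt ℝ fBCS (Set.Icc 0 1) y) ∧
      (∀ U : ℝ, 0 < U → ∀ tz ∈ Set.Ioo (0 : ℝ) 2, ∀ y ∈ Set.Ico (0 : ℝ) 1,
        MeasureTheory.IntegrableOn (subleadingIntegrand U tz y) (Set.Ioi 0))) ∧
    -- the expansion, uniformly in the hopping and in the reduced temperature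
    (∀ K₁ ⊆ Set.Ioo (0 : ℝ) 2, IsCompact K₁ → ∀ K₂ ⊆ Set.Ico (0 : ℝ) 1, IsCompact K₂ →
      ∃ C > 0, ∃ U₀ > 0, ∀ U : ℝ, 0 < U → U < U₀ → ∀ tz ∈ K₁, ∀ T : ℝ, 0 ≤ T →
        T / neelTemperature U tz ∈ K₂ →
        |gapRatio U tz T - (fBCS (T / neelTemperature U tz) +
            subleading U tz (T / neelTemperature U tz))| ≤
          C * ((U ^ 2)⁻¹ * Real.exp (-(4 / (dos tz 0 * U))))) ∧
    -- zero temperature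
    (∀ K₁ ⊆ Set.Ioo (0 : ℝ) 2, IsCompact K₁ →
      ∃ C > 0, ∃ U₀ > 0, ∀ U : ℝ, 0 < U → U < U₀ → ∀ tz ∈ K₁,
        |gapRatio U tz 0 - (Real.pi * Real.exp (-Real.eulerMascheroniConstant) +
            subleading U tz 0)| ≤
          C * ((U ^ 2)⁻¹ * Real.exp (-(4 / (dos tz 0 * U))))) ∧
    (∀ U : ℝ, 0 < U → ∀ tz ∈ Set.Ioo (0 : ℝ) 2,
      subleading U tz 0 =
        Real.pi * Real.exp (-Real.eulerMascheroniConstant) *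
          ∫ ε in Set.Ioi (0 : ℝ),
            (dos tz (neelTemperature U tz * ε) - dos tz 0) / dos tz 0 *
              (1 / Real.sqrt (Real.pi ^ 2 * Real.exp (-2 * Real.eulerMascheroniConstant) + ε ^ 2) -
                Real.tanh (ε / 2) / ε)) := by
  refine ⟨⟨fun tz htz => ⟨differentiable_integratedDOS htz.1, dos_zero_pos htz⟩,
    fun U hU tz htz => ⟨existsUnique_isNeelTemperature hU htz,
      fun T hT => existsUnique_isPositiveGap hU htz hT⟩,
    fun y hy => existsUnique_isBCSGap hy, fun y hy => differentiableWithinAt_fBCS hy,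
    fun U _ tz htz y hy => integrableOn_subleadingIntegrand htz hy⟩, ?_, ?_,
    fun U _ tz _ => subleading_zero U tz⟩
  · intro K₁ hK₁ hc₁ K₂ hK₂ hc₂
    obtain ⟨a, B, ha, hB, h₁⟩ := exists_Icc_of_isCompact two_pos hK₁ hc₁
    obtain ⟨y₁, hy₁, h₂⟩ := exists_Icc_zero_of_isCompact hK₂ hc₂
    obtain ⟨C, hC, U₀, hU₀, h⟩ := abs_gapRatio_sub_le ha hB hy₁
    exact ⟨C, hC, U₀, hU₀, fun U hU hlt tz htz T _ hT => h U hU hlt tz (h₁ htz) T (h₂ hT)⟩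
  · intro K₁ hK₁ hc₁
    obtain ⟨a, B, ha, hB, h₁⟩ := exists_Icc_of_isCompact two_pos hK₁ hc₁
    -- Zero temperature is the degenerate reduced-temperature interval [0, 0].
    obtain ⟨C, hC, U₀, hU₀, h⟩ := abs_gapRatio_sub_le ha hB (y₁ := 0) (by simp)
    refine ⟨C, hC, U₀, hU₀, fun U hU hlt tz htz => ?_⟩
    have := h U hU hlt tz (h₁ htz) 0 (by simp)
    rwa [zero_div, fBCS_zero] at this
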